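/- Let $d\ge 1$ and let $\Omega\subset\mathbb R^d$ be a bounded open set with Lipschitz boundary. Let $m\in\mathbb N$ with $m>d/2$. For an open set $V$, $C^k(\overline V)$ denotes the functions of class $C^k$ in $V$ all of whose derivatives of order at most $k$ extend continuously to $\overline V$. Let $K\in C^{2m}(\overline{\Omega\times\Omega})$ be a symmetric positive definite kernel on $\Omega$, i.e. $\sum_{j,k}c_jc_kK(x_j,x_k)>0$ for all pairwise distinct $x_1,\dots,x_N\in\Omega$ and all $0\ne c\in\mathbb R^N$, and let $\mu\in C^m(\overline\Omega)$. Let $H^m(\Omega)$ be the $L^2$-based Sobolev space, with inner product $\sum_{|\alpha|\le m}\int_\Omega D^\alpha f\,D^\alpha g$. Then there is a probability measure $\mathbb P_K^\mu$ on $\big(H^m(\Omega),\mathcal B(H^m(\Omega))\big)$ such that for every linear differential operator $P=\sum_{|\alpha|\le m}c_\alpha D^\alpha$ with $c_\alpha\in C(\overline\Omega)$ and every linear boundary operator $B=\sum_{|\alpha|\le m-1}b_\alpha D^\alpha|_{\partial\Omega}$ with $b_\alpha\in C(\partial\Omega)$ the following holds: the stochastic processes $$PS_x(\omega):=P\omega(x)\quad(x\in\Omega),\qquad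 BS_x(\omega):=B\omega(x)\quad(x\in\partial\Omega),\qquad \omega\in H^m(\Omega),$$ are Gaussian fields on $\big(H^m(\Omega),\mathcal B(H^m(\Omega)),\mathbb P_K^\mu\big)$, with means $P\mu$ and $B\mu$ and with covariance kernels $P_1P_2K$ on $\Omega\times\Omega$ and $B_1B_2K$ on $\partial\Omega\times\partial\Omega$, respectively. In particular $\mathbb P_K^\mu$ does not depend on $P$ and $B$. Here the subscripts $1$ and $2$ mean that the operator acts on the first and on the second argument of $K$, and classical derivatives are extended continuously to $\partial\Omega$. Since $P\omega$ and $B\omega$ are only elements of $L^2(\Omega)$ and $L^2(\partial\Omega)$, their values at single points are understood as follows. Let $A$ be $P$ or $B$, with coefficients $a_\alpha$; for $x\in\Omega$, respectively $x\in\partial\Omega$, put $A_x\omega:=\sum_\alpha a_\alpha(x)D^\alpha\omega\in L^2(\Omega)$. There is a process $AS$ with each $AS_x$ Borel measurable such that: (i) for every $\omega$ and $x$, if there is a number $v$ with $\lim_{r\to0}\frac{1}{|B(x,r)\cap\Omega|}\int_{B(x,r)\cap\Omega}|A_x\omega(y)-v|\,dy=0$, then $AS_x(\omega)=v$; (ii)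 for every $x$, the means of $A_x\omega$ over $B(x,r)\cap\Omega$ converge to $AS_x$ in probability as $r\to0$, so that $AS_x$ is unique up to a null set; (iii) $PS_\cdot(\omega)=P\omega$ almost everywhere in $\Omega$ for every $\omega$, and, for almost every $\omega$, $BS_\cdot(\omega)=\sum_\alpha b_\alpha\,D^\alpha\omega|_{\partial\Omega}$ almost everywhere on $\partial\Omega$ with respect to surface measure, $D^\alpha\omega|_{\partial\Omega}\in L^2(\partial\Omega)$ being the trace. The fields $PS$ and $BS$ are these processes. -/

import Mathlib

open MeasureTheory ProbabilityTheory Filter Topology Set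
open scoped ENNReal NNReal ContDiff

noncomputable section

namespace GaussPDE

/-- Euclidean space `ℝ^d`. -/
abbrev Eu (d : ℕ) : Type := EuclideanSpace ℝ (Fin d)

/-! ### Classical derivatives and spaces of functions smooth up to the boundary -/

/-- The multi-indices `α ∈ ℕ₀^d` with `|α| ≤ k`. -/
def multiIdx (d k : ℕ) : Finset (Fin d → ℕ) :=
  (Fintype.piFinset fun _ => Finset.range (k + 1)).filter fun α => ∑ i, α i ≤ k

theorem mem_multiIdx {d k : ℕ} {α : Fin d → ℕ} : α ∈ multiIdx d k ↔ ∑ i, α i ≤ k := by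
  simp only [multiIdx, Finset.mem_filter, Fintype.mem_piFinset, Finset.mem_range,
    and_iff_right_iff_imp]
  intro h i
  have := Finset.single_le_sum (f := α) (fun j _ => Nat.zero_le _) (Finset.mem_univ i)
  omega

/-- The partial derivative `∂f/∂x_i`. -/
def partialD {d : ℕ} (i : Fin d) (f : Eu d → ℝ) : Eu d → ℝ :=
  fun x => fderiv ℝ f x (EuclideanSpace.single i 1)

/-- The classical derivative `D^α f = ∂₁^{α₁} ⋯ ∂_d^{α_d} f`. -/
def multiD {d : ℕ} (α : Fin d → ℕ) (f : Eu d → ℝ) : Eu d → ℝ :=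
  (List.finRange d).foldr (fun i g => (partialD i)^[α i] g) f

/-- `f ∈ C^k(closure U)` for an open set `U`: `f` is `C^k` in `U` and all its derivatives of order
at most `k` extend continuously to the closure of `U`. Only the values of `f` on `U` matter. -/
def ContDiffOnClosure {F : Type*} [NormedAddCommGroup F] [NormedSpace ℝ F]
    (k : ℕ) (U : Set F) (f : F → ℝ) : Prop :=
  ContDiffOn ℝ k f U ∧
    ∀ j ≤ k, ∃ G : F → F [×j]→L[ℝ] ℝ,
      ContinuousOn G (closure U) ∧ EqOn G (iteratedFDeriv ℝ j f) U

/-- Bounded open sets with Lipschitz boundary: near each boundary point, in suitable orthonormal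
coordinates with last coordinate direction `e`, the set is the strict epigraph of a Lipschitz
function of the other coordinates. -/
structure IsBoundedLipschitzDomain {d : ℕ} (U : Set (Eu d)) : Prop where
  isOpen : IsOpen U
  isBounded : Bornology.IsBounded U
  lipschitz : ∀ x ∈ frontier U, ∃ r > 0, ∃ e : Eu d, ‖e‖ = 1 ∧
    ∃ (L : ℝ≥0) (γ : Eu d → ℝ), LipschitzWith L γ ∧
      ∀ y ∈ Metric.ball x r, (y ∈ U ↔ γ (y - inner ℝ e y • e) < inner ℝ e y)

/-- Symmetric (strictly) positive definite kernels on `U`. -/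
structure IsPosDefKernel {d : ℕ} (U : Set (Eu d)) (K : Eu d → Eu d → ℝ) : Prop where
  continuousOn : ContinuousOn (fun p : Eu d × Eu d => K p.1 p.2) (U ×ˢ U)
  symm : ∀ x ∈ U, ∀ y ∈ U, K x y = K y x
  pos : ∀ (N : ℕ) (x : Fin N → Eu d), (∀ j, x j ∈ U) → Function.Injective x →
    ∀ c : Fin N → ℝ, c ≠ 0 → 0 < ∑ j, ∑ k, c j * c k * K (x j) (x k)

/-! ### Differential and boundary operators on classical functions -/

/-- `∑_{|α| ≤ k} c_α D^α f`. -/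
def diffOp {d : ℕ} (k : ℕ) (c : (Fin d → ℕ) → Eu d → ℝ) (f : Eu d → ℝ) (x : Eu d) : ℝ :=
  ∑ α ∈ multiIdx d k, c α x * multiD α f x

/-- `∑_{|α| ≤ k} b_α (D^α f)|_{∂U}`, where `D^α f`, defined on `U`, is extended to the boundary by
continuity. -/
def bdryOp {d : ℕ} (U : Set (Eu d)) (k : ℕ) (b : (Fin d → ℕ) → Eu d → ℝ) (f : Eu d → ℝ)
    (x : Eu d) : ℝ :=
  ∑ α ∈ multiIdx d k, b α x * extendFrom U (multiD α f) x

/-- `P₁ P₂ K (x, y)`: the operator is applied to the second, then to the first argument. -/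
def diffOpKernel {d : ℕ} (k : ℕ) (c : (Fin d → ℕ) → Eu d → ℝ) (K : Eu d → Eu d → ℝ)
    (x y : Eu d) : ℝ :=
  diffOp k c (fun z₁ => diffOp k c (fun z₂ => K z₁ z₂) y) x

/-- `B₁ B₂ K (x, y)`. -/
def bdryOpKernel {d : ℕ} (U : Set (Eu d)) (k : ℕ) (b : (Fin d → ℕ) → Eu d → ℝ)
    (K : Eu d → Eu d → ℝ) (x y : Eu d) : ℝ :=
  bdryOp U k b (fun z₁ => bdryOp U k b (fun z₂ => K z₁ z₂) y) x

/-! ### Weak derivatives and the Sobolev space -/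

/-- Test functions on `U`: smooth functions with compact support contained in `U`. -/
structure IsTest {d : ℕ} (U : Set (Eu d)) (g : Eu d → ℝ) : Prop where
  smooth : ContDiff ℝ ∞ g
  compact : HasCompactSupport g
  subset : tsupport g ⊆ U

/-- `h` is the weak derivative `D^α f` on `U`. -/
def IsWeakDeriv {d : ℕ} (U : Set (Eu d)) (α : Fin d → ℕ) (f h : Eu d → ℝ) : Prop :=
  ∀ g : Eu d → ℝ, IsTest U g →
    ∫ x in U, h x * g x = (-1) ^ (∑ i, α i) * ∫ x in U, f x * multiD α g x

theorem partialD_smooth_compact {d : ℕ} (i : Fin d) {g : Eu d → ℝ}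
    (h : ContDiff ℝ ∞ g ∧ HasCompactSupport g) :
    ContDiff ℝ ∞ (partialD i g) ∧ HasCompactSupport (partialD i g) := by
  refine ⟨?_, h.2.fderiv_apply (𝕜 := ℝ) _⟩
  exact (h.1.fderiv_right (m := ∞) (by simp)).clm_apply contDiff_const

theorem iterate_partialD_smooth_compact {d : ℕ} (i : Fin d) (n : ℕ) {g : Eu d → ℝ}
    (h : ContDiff ℝ ∞ g ∧ HasCompactSupport g) :
    ContDiff ℝ ∞ ((partialD i)^[n] g) ∧ HasCompactSupport ((partialD i)^[n] g) := by
  induction n with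
  | zero => simpa using h
  | succ n ih => rw [Function.iterate_succ_apply']; exact partialD_smooth_compact i ih

theorem multiD_smooth_compact {d : ℕ} (α : Fin d → ℕ) {g : Eu d → ℝ}
    (h : ContDiff ℝ ∞ g ∧ HasCompactSupport g) :
    ContDiff ℝ ∞ (multiD α g) ∧ HasCompactSupport (multiD α g) := by
  unfold multiD
  induction List.finRange d with
  | nil => simpa using h
  | cons i l ih => simpa using iterate_partialD_smooth_compact i (α i) ih

theorem integrable_mul_test {d : ℕ} {U : Set (Eu d)} (f : Lp ℝ 2 (volume.restrict U))
    {g : Eu d → ℝ} (h : ContDiff ℝ ∞ g ∧ HasCompactSupport g) :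
    Integrable (fun x => f x * g x) (volume.restrict U) :=
  MemLp.integrable_mul (p := 2) (q := 2) (Lp.memLp f)
    (h.1.continuous.memLp_of_hasCompactSupport h.2)

/-- The Sobolev space `H^m(U)`. A function `f ∈ H^m(U)` is recorded together with its weak
derivatives, as the tuple `(D^α f)_{|α| ≤ m}` of elements of `L²(U)`; the entry at `α = 0` is `f`
itself and determines the other entries. The inner product inherited from the `ℓ²`-product of the
`L²(U)` is `∑_{|α| ≤ m} ∫_U D^α f D^α g`. -/
def sobolevSubmodule {d : ℕ} (m : ℕ) (U : Set (Eu d)) :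
    Submodule ℝ (PiLp 2 fun _ : multiIdx d m => Lp ℝ 2 (volume.restrict U)) where
  carrier := {u | ∀ α : multiIdx d m,
    IsWeakDeriv U α (u ⟨0, mem_multiIdx.2 (by simp)⟩) (u α)}
  zero_mem' := by
    intro α g hg
    have h0 := Lp.coeFn_zero ℝ 2 ((volume : Measure (Eu d)).restrict U)
    have e1 : ∫ x in U, ((0 : Lp ℝ 2 (volume.restrict U)) : Eu d → ℝ) x * g x = 0 := by
      refine integral_eq_zero_of_ae ?_
      filter_upwards [h0] with x hx
      rw [hx]; simp
    have e2 : ∫ x in U, ((0 : Lp ℝ 2 (volume.restrict U)) : Eu d → ℝ) x * multiD (α : Fin d → ℕ) g x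
        = 0 := by
      refine integral_eq_zero_of_ae ?_
      filter_upwards [h0] with x hx
      rw [hx]; simp
    simp only [PiLp.zero_apply]
    rw [e1, e2, mul_zero]
  add_mem' := by
    intro u v hu hv α g hg
    have hgs := multiD_smooth_compact (α : Fin d → ℕ) ⟨hg.smooth, hg.compact⟩
    have key : ∀ (a b : Lp ℝ 2 (volume.restrict U)) (k : Eu d → ℝ),
        (ContDiff ℝ ∞ k ∧ HasCompactSupport k) →
        ∫ x in U, (a + b : Lp ℝ 2 (volume.restrict U)) x * k x
          = (∫ x in U, a x * k x) + ∫ x in U, b x * k x := by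
      intro a b k hk
      rw [← integral_add (integrable_mul_test a hk) (integrable_mul_test b hk)]
      refine integral_congr_ae ?_
      filter_upwards [Lp.coeFn_add a b] with x hx
      rw [hx, Pi.add_apply, add_mul]
    simp only [PiLp.add_apply]
    rw [key _ _ _ ⟨hg.smooth, hg.compact⟩, key _ _ _ hgs, hu α g hg, hv α g hg, mul_add]
  smul_mem' := by
    intro t u hu α g hg
    have key : ∀ (a : Lp ℝ 2 (volume.restrict U)) (k : Eu d → ℝ),
        ∫ x in U, (t • a : Lp ℝ 2 (volume.restrict U)) x * k x = t * ∫ x in U, a x * k x := by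
      intro a k
      rw [← integral_const_mul]
      refine integral_congr_ae ?_
      filter_upwards [Lp.coeFn_smul t a] with x hx
      rw [hx, Pi.smul_apply, smul_eq_mul, mul_assoc]
    simp only [PiLp.smul_apply]
    rw [key, key, hu α g hg]
    ring

/-- The Sobolev space `H^m(U)` as a type. -/
def Sobolev {d : ℕ} (m : ℕ) (U : Set (Eu d)) : Type := ↥(sobolevSubmodule m U)

instance {d : ℕ} (m : ℕ) (U : Set (Eu d)) : NormedAddCommGroup (Sobolev m U) :=
  inferInstanceAs (NormedAddCommGroup ↥(sobolevSubmodule m U))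

instance {d : ℕ} (m : ℕ) (U : Set (Eu d)) : InnerProductSpace ℝ (Sobolev m U) :=
  inferInstanceAs (InnerProductSpace ℝ ↥(sobolevSubmodule m U))

/-- `H^m(U)` carries its Borel σ-algebra. -/
instance {d : ℕ} (m : ℕ) (U : Set (Eu d)) : MeasurableSpace (Sobolev m U) := borel _

instance {d : ℕ} (m : ℕ) (U : Set (Eu d)) : BorelSpace (Sobolev m U) := ⟨rfl⟩

/-- A representative of the weak derivative `D^α u ∈ L²(U)` of `u ∈ H^m(U)`, `|α| ≤ m`. -/
def Sobolev.D {d m : ℕ} {U : Set (Eu d)} (u : Sobolev m U) (α : Fin d → ℕ) : Eu d → ℝ :=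
  if h : α ∈ multiIdx d m then ((u.1 ⟨α, h⟩ : Lp ℝ 2 (volume.restrict U)) : Eu d → ℝ) else 0

/-! ### Pointwise values, traces, and the processes given by an operator -/

/-- `v` is the value at `x ∈ closure U` of the (class of the) locally integrable function `f` on
`U`: `x` is a Lebesgue point of `f` relative to `U`, with value `v`. If `f` has the limit `v` at
`x` within `U`, this holds. -/
def HasValueAt {d : ℕ} (U : Set (Eu d)) (f : Eu d → ℝ) (x : Eu d) (v : ℝ) : Prop :=
  Tendsto (fun r : ℝ => ⨍ y in Metric.ball x r ∩ U, |f y - v|) (𝓝[>] 0) (𝓝 0)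

/-- `g` is the boundary trace, in `L²(∂U)`, of the function `f ∈ H¹(U)`: there are functions in
`C¹(closure U)` which converge to `f` in `H¹(U)` and whose boundary values converge to `g` in
`L²(∂U)`. -/
def HasTrace {d : ℕ} (U : Set (Eu d)) (f g : Eu d → ℝ) : Prop :=
  ∃ (h : Fin d → Eu d → ℝ) (φ : ℕ → Eu d → ℝ),
    (∀ i, MemLp (h i) 2 (volume.restrict U)) ∧
    (∀ i, IsWeakDeriv U (Pi.single i 1) f (h i)) ∧
    (∀ n, ContDiffOnClosure 1 U (φ n)) ∧
    Tendsto (fun n => eLpNorm (φ n - f) 2 (volume.restrict U)) atTop (𝓝 0) ∧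
    (∀ i, Tendsto (fun n => eLpNorm (partialD i (φ n) - h i) 2 (volume.restrict U)) atTop (𝓝 0)) ∧
    MemLp g 2 ((Measure.hausdorffMeasure ((d : ℝ) - 1)).restrict (frontier U)) ∧
    Tendsto (fun n => eLpNorm (extendFrom U (φ n) - g) 2
      ((Measure.hausdorffMeasure ((d : ℝ) - 1)).restrict (frontier U))) atTop (𝓝 0)

/-- The function `y ↦ ∑_{|α| ≤ k} a_α(x) D^α u(y)` on `U`; formally, its value at `y = x` is the
value at `x` of the operator `∑ a_α D^α` applied to `u`. -/
def frozenOp {d m : ℕ} {U : Set (Eu d)} (k : ℕ) (a : (Fin d → ℕ) → Eu d → ℝ) (u : Sobolev m U)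
    (x y : Eu d) : ℝ :=
  ∑ α ∈ multiIdx d k, a α x * u.D α y

/-- `Z x u` is the pointwise value at `x`, for `x ∈ T ⊆ closure U`, of the operator
`A = ∑_{|α| ≤ k} a_α D^α` applied to `u ∈ H^m(U)`. Each `Z x` is a random variable on
`(H^m(U), Q)`; whenever `A u` has a value at `x`, then `Z x u` is this value; in any case, `Z x` is
the limit in probability of the means of `A u` over smaller and smaller balls around `x`, which
determines `Z x` up to a null set, for each single `x`. -/
structure IsPointEvaluation {d m : ℕ} {U : Set (Eu d)} (Q : Measure (Sobolev m U)) (k : ℕ)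
    (a : (Fin d → ℕ) → Eu d → ℝ) (T : Set (Eu d)) (Z : Eu d → Sobolev m U → ℝ) : Prop where
  measurable : ∀ x ∈ T, Measurable (Z x)
  value : ∀ u, ∀ x ∈ T, ∀ v, HasValueAt U (frozenOp k a u x) x v → Z x u = v
  tendsto : ∀ x ∈ T, TendstoInMeasure Q
    (fun (r : ℝ) u => ⨍ y in Metric.ball x r ∩ U, frozenOp k a u x y) (𝓝[>] 0) (Z x)

/-- `Z` is the process `(x, u) ↦ (P u)(x)`, `x ∈ U`, for `P = ∑_{|α| ≤ k} c_α D^α`. -/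
structure IsDiffOpProcess {d m : ℕ} {U : Set (Eu d)} (Q : Measure (Sobolev m U)) (k : ℕ)
    (c : (Fin d → ℕ) → Eu d → ℝ) (Z : Eu d → Sobolev m U → ℝ) : Prop where
  eval : IsPointEvaluation Q k c U Z
  ae_eq : ∀ u, ∀ᵐ x ∂(volume.restrict U), Z x u = ∑ α ∈ multiIdx d k, c α x * u.D α x

/-- `Z` is the process `(x, u) ↦ (B u)(x)`, `x ∈ ∂U`, for `B = ∑_{|α| ≤ k} b_α D^α|_{∂U}`, where
`D^α u|_{∂U}` is the boundary trace. -/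
structure IsBdryOpProcess {d m : ℕ} {U : Set (Eu d)} (Q : Measure (Sobolev m U)) (k : ℕ)
    (b : (Fin d → ℕ) → Eu d → ℝ) (Z : Eu d → Sobolev m U → ℝ) : Prop where
  eval : IsPointEvaluation Q k b (frontier U) Z
  ae_eq : ∀ᵐ u ∂Q, ∃ g : (Fin d → ℕ) → Eu d → ℝ,
    (∀ α ∈ multiIdx d k, HasTrace U (u.D α) (g α)) ∧
    ∀ᵐ x ∂((Measure.hausdorffMeasure ((d : ℝ) - 1)).restrict (frontier U)),
      Z x u = ∑ α ∈ multiIdx d k, b α x * g α x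

/-- The process `(Z x)_{x ∈ T}` is a Gaussian field with the given mean and covariance kernel. -/
structure IsGaussianField {d : ℕ} {S : Type*} [MeasurableSpace S] (Q : Measure S) (T : Set (Eu d))
    (Z : Eu d → S → ℝ) (mean : Eu d → ℝ) (C : Eu d → Eu d → ℝ) : Prop where
  gaussian : IsGaussianProcess (fun x : T => Z x) Q
  mean_eq : ∀ x ∈ T, ∫ u, Z x u ∂Q = mean x
  cov_eq : ∀ x ∈ T, ∀ y ∈ T, covariance (Z x) (Z y) Q = C x y

end GaussPDE

end

/-!
The measure is the law of the Gaussian series `μ + ∑ ξ_i b_i`, where `(b_i)` is an orthonormal basis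
of the reproducing kernel Hilbert space `H` of `K` and the `ξ_i` are independent standard normal
variables. Everything takes place in Hilbert spaces and is elementary; no embedding theorem and no
trace theorem is used.

*The feature map.* Let `k x = K(x, ·) ∈ H`, so that `K(x, y) = ⟪k x, k y⟫`. Difference quotients of
`k` have inner products which are second difference quotients of `K`, hence they are Cauchy, and
the same argument applies to limits at the boundary. So `k` is of class `C^m` up to the boundary as
a map into `H` when `K` is of class `C^{2m}` (`contDiffOn_of_gram`, `smoothUpTo_feature`), and
`D^α D^β K(x, y) = ⟪D^α k x, D^β k y⟫`.

*The measure.* The inclusion `J : H → H^m(U)`, `h ↦ ⟪k ·, h⟫`, is Hilbert–Schmidt, because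
`∑_i ‖J b_i‖² ≤ ∑_α ∫_U ‖D^α k‖²` by Bessel's inequality (`SmoothUpTo.sum_norm_incl_sq_le`). Hence
`∑ ξ_i J b_i` converges in `L²(P; H^m(U))`; the law `Q` of the sum, shifted by `μ`, is the measure
(`exists_gaussianMeasure`). As `J` is injective, the range of its adjoint is dense, and a basis
`b_i = J† κ_i` inside this range makes the variables `ξ_i(u) = ⟪κ_i, u - μ⟫` functionals of the
sample `u` itself. With the isonormal process `W(h) = ∑ ⟪b_i, h⟫ ξ_i`, a functional `T` on
`H^m(U)` with `T ∘ J = ⟪g, ·⟫` satisfies `T u = T μ + W(g)` almost surely.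

*Pointwise values.* The mean of `D^α u` over `B(x, r) ∩ U` is such a functional, and its `g` is the
mean of `D^α k`, which converges to `D^α k(x)` uniformly for `x` in the closure of `U`. Along radii
for which the convergence is geometrically fast, the means therefore converge almost surely to
`D^α μ(x) + W(D^α k(x))`; the limit along these radii defines the process (`pointVal`). Its mean
and its covariance can be read off, interior values are identified by Lebesgue differentiation
(`Sobolev.ae_tendsto_mean`), and convergence in probability holds since `W` is an isometry.

*Traces.* The sets `{D^α k(x) : x ∈ closure U}` are compact, so the partial sums over suitable
finite sets of indices approximate all `D^α k(x)` at a geometric rate, uniformly in `x`. The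
corresponding partial sums of the Gaussian series are smooth up to the boundary. They converge in
`H^m(U)` almost surely, and, by Tonelli and the finiteness of the surface measure, their boundary
values converge almost surely in `L²(∂U)` to the pointwise values
(`HasFunctionals.ae_hasTrace`).
-/

noncomputable section

namespace GaussPDE

/-! ### Iterated partial derivatives -/

/-- The partial derivative `∂f/∂x_i` of a vector-valued function. -/
def pD {d : ℕ} {F : Type*} [NormedAddCommGroup F] [NormedSpace ℝ F] (i : Fin d)
    (f : Eu d → F) : Eu d → F :=
  fun x => fderiv ℝ f x (EuclideanSpace.single i 1)

/-- The iterated partial derivative along a list of coordinate directions; the head of the list is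
the derivative taken last. Lists are more convenient for induction than multi-indices. -/
def pL {d : ℕ} {F : Type*} [NormedAddCommGroup F] [NormedSpace ℝ F] (l : List (Fin d))
    (f : Eu d → F) : Eu d → F :=
  l.foldr pD f

/-- The list in which each direction `i` occurs `α i` times, in increasing order. -/
def idxList {d : ℕ} (α : Fin d → ℕ) : List (Fin d) :=
  (List.finRange d).flatMap fun i => List.replicate (α i) i

section Lists

variable {d : ℕ}

theorem multiD_eq_pL (α : Fin d → ℕ) (f : Eu d → ℝ) : multiD α f = pL (idxList α) f := by
  unfold multiD pL idxList
  have rep : ∀ (n : ℕ) (i : Fin d) (g : Eu d → ℝ),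
      (List.replicate n i).foldr pD g = (partialD i)^[n] g := by
    intro n i g
    induction n with
    | zero => rfl
    | succ n ih => rw [List.replicate_succ, List.foldr_cons, ih, Function.iterate_succ_apply']; rfl
  induction List.finRange d with
  | nil => rfl
  | cons i l ih => rw [List.foldr_cons, ih, List.flatMap_cons, List.foldr_append, rep]

theorem count_idxList (α : Fin d → ℕ) (j : Fin d) : (idxList α).count j = α j := by
  unfold idxList
  rw [List.count_flatMap]
  have : (List.map (List.count j ∘ fun i => List.replicate (α i) i) (List.finRange d)).sum
      = ∑ i, (List.replicate (α i) i).count j := by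
    rw [← List.sum_ofFn, List.ofFn_eq_map]; rfl
  rw [this, Finset.sum_eq_single j]
  · simp
  · intro b _ hb
    simp [List.count_replicate, hb]
  · simp

theorem length_idxList (α : Fin d → ℕ) : (idxList α).length = ∑ i, α i := by
  unfold idxList
  rw [List.length_flatMap, ← List.sum_ofFn, List.ofFn_eq_map]
  simp

theorem length_idxList_le {α : Fin d → ℕ} {m : ℕ} (h : α ∈ multiIdx d m) :
    (idxList α).length ≤ m := by
  rw [length_idxList]; exact mem_multiIdx.1 h

theorem idxList_zero : idxList (0 : Fin d → ℕ) = [] :=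
  List.eq_nil_of_length_eq_zero (by simp [length_idxList])

theorem idxList_add_single_perm (α : Fin d → ℕ) (i : Fin d) :
    (idxList (α + Pi.single i 1)).Perm (i :: idxList α) := by
  rw [List.perm_iff_count]
  intro j
  rw [count_idxList, List.count_cons, count_idxList]
  by_cases h : i = j
  · subst h; simp
  · simp [h, Ne.symm h]

theorem idxList_single (i : Fin d) : idxList (Pi.single i 1) = [i] := by
  have := idxList_add_single_perm (0 : Fin d → ℕ) i
  rw [zero_add, idxList_zero] at this
  exact List.perm_singleton.1 this

theorem add_single_mem_multiIdx {m : ℕ} {α : Fin d → ℕ} (h : α ∈ multiIdx d (m - 1)) (hm : 1 ≤ m)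
    (i : Fin d) : α + Pi.single i 1 ∈ multiIdx d m := by
  rw [mem_multiIdx] at *
  simp only [Pi.add_apply, Finset.sum_add_distrib, Finset.sum_pi_single', Finset.mem_univ, if_true]
  omega

theorem multiIdx_mono {k m : ℕ} (h : k ≤ m) : multiIdx d k ⊆ multiIdx d m := fun _ hα =>
  mem_multiIdx.2 ((mem_multiIdx.1 hα).trans h)

end Lists

section Calculus

variable {d : ℕ} {F F' : Type*} [NormedAddCommGroup F] [NormedSpace ℝ F]
  [NormedAddCommGroup F'] [NormedSpace ℝ F'] {U : Set (Eu d)}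

theorem pL_cons (i : Fin d) (l : List (Fin d)) (f : Eu d → F) : pL (i :: l) f = pD i (pL l f) := rfl

theorem pL_nil (f : Eu d → F) : pL ([] : List (Fin d)) f = f := rfl

theorem pL_append (l l' : List (Fin d)) (f : Eu d → F) : pL (l ++ l') f = pL l (pL l' f) :=
  List.foldr_append

theorem pD_congr (hU : IsOpen U) {f g : Eu d → F} (h : EqOn f g U) (i : Fin d) :
    EqOn (pD i f) (pD i g) U := fun x hx => by
  have : f =ᶠ[𝓝 x] g := Filter.eventuallyEq_of_mem (hU.mem_nhds hx) h
  simp only [pD, this.fderiv_eq]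

theorem pL_congr (hU : IsOpen U) {f g : Eu d → F} (h : EqOn f g U) (l : List (Fin d)) :
    EqOn (pL l f) (pL l g) U := by
  induction l with
  | nil => exact h
  | cons i l ih => exact pD_congr hU ih i

theorem contDiffOn_pD (hU : IsOpen U) {f : Eu d → F} {n : ℕ} (h : ContDiffOn ℝ (n + 1 : ℕ) f U)
    (i : Fin d) : ContDiffOn ℝ n (pD i f) U := by
  refine (h.fderiv_of_isOpen hU (m := n) ?_).clm_apply contDiffOn_const
  norm_cast

theorem contDiffOn_pL (hU : IsOpen U) {f : Eu d → F} {m : ℕ} (h : ContDiffOn ℝ m f U) :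
    ∀ (l : List (Fin d)) (n : ℕ), l.length + n ≤ m → ContDiffOn ℝ n (pL l f) U
  | [], n, hn => h.of_le (by simpa using hn)
  | i :: l, n, hn => contDiffOn_pD hU
      (contDiffOn_pL hU h l (n + 1) (by simp only [List.length_cons] at hn; omega)) i

theorem differentiableAt_pL (hU : IsOpen U) {f : Eu d → F} {m : ℕ} (h : ContDiffOn ℝ m f U)
    {l : List (Fin d)} (hl : l.length < m) {x : Eu d} (hx : x ∈ U) :
    DifferentiableAt ℝ (pL l f) x :=
  (((contDiffOn_pL hU h l 1 hl).contDiffAt (hU.mem_nhds hx)).differentiableAt (by simp))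

theorem pD_comm (hU : IsOpen U) {f : Eu d → F} (h : ContDiffOn ℝ 2 f U) (i j : Fin d) :
    EqOn (pD i (pD j f)) (pD j (pD i f)) U := fun x hx => by
  have hc := h.contDiffAt (hU.mem_nhds hx)
  have hs : IsSymmSndFDerivAt ℝ f x := hc.isSymmSndFDerivAt (by simp)
  have hd : DifferentiableAt ℝ (fderiv ℝ f) x :=
    (hc.fderiv_right (m := 1) (by norm_num)).differentiableAt (by simp)
  have key : ∀ v w : Eu d,
      fderiv ℝ (fun y => fderiv ℝ f y v) x w = fderiv ℝ (fderiv ℝ f) x w v := by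
    intro v w
    rw [fderiv_clm_apply hd (differentiableAt_const v)]
    simp
  unfold pD
  rw [key, key, hs.eq]

/-- Iterated partial derivatives do not depend on the order of differentiation. -/
theorem pL_perm (hU : IsOpen U) {f : Eu d → F} {m : ℕ} (h : ContDiffOn ℝ m f U)
    {l l' : List (Fin d)} (hp : l.Perm l') (hl : l.length ≤ m) :
    EqOn (pL l f) (pL l' f) U := by
  induction hp with
  | nil => exact fun _ _ => rfl
  | cons i _ ih => exact pD_congr hU (ih (by simp only [List.length_cons] at hl; omega)) i
  | swap i j l =>
    exact pD_comm hU (contDiffOn_pL hU h l 2 (by simp only [List.length_cons] at hl; omega)) j i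
  | trans h1 _ ih1 ih2 => exact (ih1 hl).trans (ih2 (h1.length_eq ▸ hl))

theorem pL_clm (hU : IsOpen U) {f : Eu d → F} {m : ℕ} (h : ContDiffOn ℝ m f U) (L : F →L[ℝ] F') :
    ∀ (l : List (Fin d)), l.length ≤ m →
      EqOn (pL l fun x => L (f x)) (fun x => L (pL l f x)) U
  | [], _ => fun _ _ => rfl
  | i :: l, hl => fun x hx => by
    rw [pL_cons, pD_congr hU (pL_clm hU h L l (by simp only [List.length_cons] at hl; omega)) i hx]
    have hd : DifferentiableAt ℝ (pL l f) x := differentiableAt_pL hU h hl hx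
    simp only [pL_cons, pD]
    have := (L.hasFDerivAt (x := pL l f x)).comp x hd.hasFDerivAt
    exact congrArg (fun T : Eu d →L[ℝ] F' => T (EuclideanSpace.single i 1)) this.fderiv

theorem pL_add (hU : IsOpen U) {f g : Eu d → F} {m : ℕ} (hf : ContDiffOn ℝ m f U)
    (hg : ContDiffOn ℝ m g U) :
    ∀ (l : List (Fin d)), l.length ≤ m →
      EqOn (pL l fun x => f x + g x) (fun x => pL l f x + pL l g x) U
  | [], _ => fun _ _ => rfl
  | i :: l, hl => fun x hx => by
    have ih := pL_add hU hf hg l (by simp only [List.length_cons] at hl; omega)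
    rw [pL_cons, pD_congr hU ih i hx]
    simp only [pL_cons, pD]
    rw [fderiv_fun_add (differentiableAt_pL hU hf hl hx) (differentiableAt_pL hU hg hl hx)]
    rfl

theorem fderiv_eq_sum_pD (f : Eu d → F) (x : Eu d) :
    fderiv ℝ f x = ∑ i, (EuclideanSpace.proj i : Eu d →L[ℝ] ℝ).smulRight (pD i f x) := by
  ext v
  have hv : v = ∑ i, v i • (EuclideanSpace.single i (1 : ℝ) : Eu d) := by
    ext j; simp [Finset.sum_apply, Pi.single_apply]
  conv_lhs => rw [hv]
  simp [pD]

/-- Iterated directional derivatives are values of `iteratedFDeriv`. -/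
theorem foldr_fderiv_eq_iteratedFDeriv {E : Type*} [NormedAddCommGroup E] [NormedSpace ℝ E]
    {V : Set E} (hV : IsOpen V) {f : E → F} {n : ℕ} (h : ContDiffOn ℝ n f V) :
    ∀ (L : List E), L.length ≤ n → ∀ x ∈ V,
      L.foldr (fun v g y => fderiv ℝ g y v) f x = iteratedFDeriv ℝ L.length f x L.get
  | [], _ => fun x _ => by simp
  | v :: L, hL => fun x hx => by
    have ih := foldr_fderiv_eq_iteratedFDeriv hV h L
      (by simp only [List.length_cons] at hL; omega)
    have he : L.foldr (fun v g y => fderiv ℝ g y v) f =ᶠ[𝓝 x]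
        fun y => iteratedFDeriv ℝ L.length f y L.get :=
      Filter.eventuallyEq_of_mem (hV.mem_nhds hx) ih
    have hd : DifferentiableAt ℝ (iteratedFDeriv ℝ L.length f) x :=
      (h.contDiffAt (hV.mem_nhds hx)).differentiableAt_iteratedFDeriv
        (by exact_mod_cast hL)
    rw [List.foldr_cons, he.fderiv_eq]
    refine Eq.trans ?_ (iteratedFDeriv_succ_apply_left (v :: L).get).symm
    have := (ContinuousMultilinearMap.apply ℝ (fun _ : Fin L.length => E) F
      L.get).hasFDerivAt.comp x hd.hasFDerivAt
    rw [show (fun y => iteratedFDeriv ℝ L.length f y L.get) =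
      (ContinuousMultilinearMap.apply ℝ (fun _ : Fin L.length => E) F L.get) ∘
        iteratedFDeriv ℝ L.length f from rfl, this.fderiv]
    rfl

end Calculus

section UpToBoundary

variable {d : ℕ} {F F' : Type*} [NormedAddCommGroup F] [NormedSpace ℝ F]
  [NormedAddCommGroup F'] [NormedSpace ℝ F'] {U : Set (Eu d)} {m : ℕ}

/-- `f` is `C^m` in `U` and its iterated partial derivatives of order at most `m` have limits at
all points of the closure. This is `ContDiffOnClosure` for vector-valued functions, in terms of
partial derivatives. -/
structure SmoothUpTo (m : ℕ) (U : Set (Eu d)) (f : Eu d → F) : Prop where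
  contDiffOn : ContDiffOn ℝ m f U
  exists_lim : ∀ l : List (Fin d), l.length ≤ m → ∀ x ∈ closure U,
    ∃ y, Tendsto (pL l f) (𝓝[U] x) (𝓝 y)

theorem SmoothUpTo.continuousOn_ext {f : Eu d → F} (h : SmoothUpTo m U f) {l : List (Fin d)}
    (hl : l.length ≤ m) : ContinuousOn (extendFrom U (pL l f)) (closure U) :=
  continuousOn_extendFrom subset_rfl (h.exists_lim l hl)

theorem SmoothUpTo.tendsto_ext {f : Eu d → F} (h : SmoothUpTo m U f) {l : List (Fin d)}
    (hl : l.length ≤ m) {x : Eu d} (hx : x ∈ closure U) :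
    Tendsto (pL l f) (𝓝[U] x) (𝓝 (extendFrom U (pL l f) x)) :=
  tendsto_extendFrom (h.exists_lim l hl x hx)

theorem SmoothUpTo.ext_eq {f : Eu d → F} (hU : IsOpen U) (h : SmoothUpTo m U f)
    {l : List (Fin d)} (hl : l.length ≤ m) {x : Eu d} (hx : x ∈ U) :
    extendFrom U (pL l f) x = pL l f x := by
  refine extendFrom_eq (subset_closure hx) ?_
  have : ContinuousOn (pL l f) U := (contDiffOn_pL hU h.contDiffOn l 0 hl).continuousOn
  exact this x hx

theorem SmoothUpTo.clm {f : Eu d → F} (hU : IsOpen U) (h : SmoothUpTo m U f) (L : F →L[ℝ] F') :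
    SmoothUpTo m U fun x => L (f x) where
  contDiffOn := L.contDiff.comp_contDiffOn h.contDiffOn
  exists_lim l hl x hx := by
    refine ⟨L (extendFrom U (pL l f) x), ?_⟩
    refine ((L.continuous.tendsto _).comp (h.tendsto_ext hl hx)).congr' ?_
    filter_upwards [self_mem_nhdsWithin] with y hy
    exact (pL_clm hU h.contDiffOn L l hl hy).symm

theorem SmoothUpTo.ext_clm {f : Eu d → F} (hU : IsOpen U) (h : SmoothUpTo m U f) (L : F →L[ℝ] F')
    {l : List (Fin d)} (hl : l.length ≤ m) {x : Eu d} (hx : x ∈ closure U) :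
    extendFrom U (pL l fun x => L (f x)) x = L (extendFrom U (pL l f) x) := by
  refine extendFrom_eq hx ?_
  refine ((L.continuous.tendsto _).comp (h.tendsto_ext hl hx)).congr' ?_
  filter_upwards [self_mem_nhdsWithin] with y hy
  exact (pL_clm hU h.contDiffOn L l hl hy).symm

theorem SmoothUpTo.add {f g : Eu d → F} (hU : IsOpen U) (hf : SmoothUpTo m U f)
    (hg : SmoothUpTo m U g) : SmoothUpTo m U fun x => f x + g x where
  contDiffOn := hf.contDiffOn.add hg.contDiffOn
  exists_lim l hl x hx := by
    refine ⟨_, ((hf.tendsto_ext hl hx).add (hg.tendsto_ext hl hx)).congr' ?_⟩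
    filter_upwards [self_mem_nhdsWithin] with y hy
    exact (pL_add hU hf.contDiffOn hg.contDiffOn l hl hy).symm

theorem SmoothUpTo.ext_add {f g : Eu d → F} (hU : IsOpen U) (hf : SmoothUpTo m U f)
    (hg : SmoothUpTo m U g) {l : List (Fin d)} (hl : l.length ≤ m) {x : Eu d}
    (hx : x ∈ closure U) :
    extendFrom U (pL l fun x => f x + g x) x =
      extendFrom U (pL l f) x + extendFrom U (pL l g) x := by
  refine extendFrom_eq hx (((hf.tendsto_ext hl hx).add (hg.tendsto_ext hl hx)).congr' ?_)
  filter_upwards [self_mem_nhdsWithin] with y hy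
  exact (pL_add hU hf.contDiffOn hg.contDiffOn l hl hy).symm

theorem SmoothUpTo.exists_bound {f : Eu d → F} (hb : Bornology.IsBounded U)
    (h : SmoothUpTo m U f) :
    ∃ C : ℝ, 0 ≤ C ∧ ∀ α ∈ multiIdx d m, ∀ x ∈ closure U,
      ‖extendFrom U (pL (idxList α) f) x‖ ≤ C := by
  have hc : IsCompact (closure U) := hb.isCompact_closure
  have : ∀ α : multiIdx d m, ∃ C : ℝ, ∀ x ∈ closure U,
      ‖extendFrom U (pL (idxList α.1) f) x‖ ≤ C := fun α =>
    hc.exists_bound_of_continuousOn (h.continuousOn_ext (length_idxList_le α.2))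
  choose C hC using this
  refine ⟨∑ α, |C α|, Finset.sum_nonneg fun _ _ => abs_nonneg _, fun α hα x hx => ?_⟩
  exact (hC ⟨α, hα⟩ x hx).trans ((le_abs_self _).trans
    (Finset.single_le_sum (f := fun α => |C α|) (fun _ _ => abs_nonneg _)
      (Finset.mem_univ (⟨α, hα⟩ : multiIdx d m))))

theorem pL_eq_foldr (l : List (Fin d)) (f : Eu d → F) :
    pL l f = (l.map fun i => (EuclideanSpace.single i 1 : Eu d)).foldr
      (fun v g y => fderiv ℝ g y v) f := by
  induction l with
  | nil => rfl
  | cons i l ih => rw [pL_cons, ih]; rfl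

theorem ContDiffOnClosure.smoothUpTo (hU : IsOpen U) {f : Eu d → ℝ} (h : ContDiffOnClosure m U f) :
    SmoothUpTo m U f where
  contDiffOn := h.1
  exists_lim l hl x hx := by
    set L := l.map fun i => (EuclideanSpace.single i 1 : Eu d) with hL
    have hLl : L.length ≤ m := by simpa [hL] using hl
    obtain ⟨G, hG, hGe⟩ := h.2 L.length hLl
    refine ⟨G x L.get, ?_⟩
    have h1 : Tendsto G (𝓝[U] x) (𝓝 (G x)) := (hG x hx).mono_left (nhdsWithin_mono _ subset_closure)
    have h2 := ((ContinuousMultilinearMap.apply ℝ (fun _ : Fin L.length => Eu d) ℝ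
      L.get).continuous.tendsto _).comp h1
    refine h2.congr' ?_
    filter_upwards [self_mem_nhdsWithin] with y hy
    rw [pL_eq_foldr, ← hL, foldr_fderiv_eq_iteratedFDeriv hU h.1 L hLl y hy, ← hGe hy]
    rfl

/-- `C¹` up to the boundary can be checked on partial derivatives. -/
theorem SmoothUpTo.contDiffOnClosure_one (hU : IsOpen U) {f : Eu d → ℝ} (h : SmoothUpTo 1 U f) :
    ContDiffOnClosure 1 U f := by
  refine ⟨h.contDiffOn, fun j hj => ?_⟩
  interval_cases j
  · refine ⟨fun x => (ContinuousMultilinearMap.uncurry0 ℝ (Eu d) (extendFrom U f x)), ?_, ?_⟩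
    · have := h.continuousOn_ext (l := []) (by simp)
      exact (continuousMultilinearCurryFin0 ℝ (Eu d) ℝ).symm.continuous.comp_continuousOn this
    · intro x hx
      have := h.ext_eq hU (l := []) (by simp) hx
      ext v
      simpa [pL_nil] using this
  · let G : Eu d → (Eu d →L[ℝ] ℝ) := fun x =>
      ∑ i, (EuclideanSpace.proj i : Eu d →L[ℝ] ℝ).smulRight (extendFrom U (pL [i] f) x)
    refine ⟨fun x => (continuousMultilinearCurryFin1 ℝ (Eu d) ℝ).symm (G x), ?_, ?_⟩
    · refine (continuousMultilinearCurryFin1 ℝ (Eu d) ℝ).symm.continuous.comp_continuousOn ?_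
      refine continuousOn_finsetSum _ fun i _ => ?_
      have h1 := h.continuousOn_ext (l := [i]) (by simp)
      exact ((ContinuousLinearMap.smulRightL ℝ (Eu d) ℝ
        (EuclideanSpace.proj i)).continuous.comp_continuousOn h1)
    · intro x hx
      have hG : G x = fderiv ℝ f x := by
        rw [fderiv_eq_sum_pD]
        refine Finset.sum_congr rfl fun i _ => ?_
        rw [h.ext_eq hU (by simp) hx]; rfl
      ext v
      rw [iteratedFDeriv_one_apply]
      simp [hG]

theorem SmoothUpTo.iteratedDeriv {f : Eu d → F} {k : ℕ} (hU : IsOpen U) (h : SmoothUpTo m U f)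
    (l : List (Fin d)) (hl : l.length + k ≤ m) : SmoothUpTo k U (pL l f) where
  contDiffOn := contDiffOn_pL hU h.contDiffOn l k hl
  exists_lim l' hl' x hx := by
    rw [← pL_append]
    exact h.exists_lim _ (by rw [List.length_append]; omega) x hx

end UpToBoundary

/-! ### Differentiability of a feature map from that of its kernel -/

/-- The kernel `(x, y) ↦ ⟪f x, f y⟫` of a map into an inner product space. -/
def gram {E H : Type*} [NormedAddCommGroup H] [InnerProductSpace ℝ H] (f : E → H)
    (p : E × E) : ℝ :=
  inner ℝ (f p.1) (f p.2)

theorem norm_sub_sq_eq_gram {E H : Type*} [NormedAddCommGroup H] [InnerProductSpace ℝ H]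
    (f : E → H) (x y : E) :
    ‖f x - f y‖ ^ 2 = gram f (x, x) - 2 * gram f (x, y) + gram f (y, y) := by
  rw [norm_sub_sq_real]
  simp only [gram, real_inner_self_eq_norm_sq]

theorem eventually_norm_sub_lt_of_continuousAt {X Y : Type*} [TopologicalSpace X]
    [NormedAddCommGroup Y] {g : X → Y} {p : X} (h : ContinuousAt g p) {ε : ℝ} (hε : 0 < ε) :
    ∀ᶠ q in 𝓝 p, ‖g q - g p‖ < ε := by
  filter_upwards [h.eventually (Metric.ball_mem_nhds _ hε)] with q hq
  rwa [← dist_eq_norm]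

section Feature

variable {E H : Type*} [NormedAddCommGroup E] [NormedSpace ℝ E]
  [NormedAddCommGroup H] [InnerProductSpace ℝ H]

/-- The mixed second derivative `∂_{1,v} ∂_{2,w}` of the kernel of `f`. -/
def gram₂ (f : E → H) (p : E × E) (v w : E) : ℝ :=
  fderiv ℝ (fderiv ℝ (gram f)) p (0, w) (v, 0)

/-- Second differences of the kernel are approximated by its mixed second derivative. -/
theorem inner_sub_sub_approx {V : Set E} (hV : IsOpen V) {f : E → H}
    (hG : ContDiffOn ℝ 2 (gram f) (V ×ˢ V)) {x y : E} (hx : x ∈ V) (hy : y ∈ V) {ε : ℝ}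
    (hε : 0 < ε) : ∃ δ > 0, ∀ v w : E, ‖v‖ < δ → ‖w‖ < δ →
      |inner ℝ (f (x + v) - f x) (f (y + w) - f y) - gram₂ f (x, y) v w| ≤ ε * ‖v‖ * ‖w‖ := by
  have hVV : IsOpen (V ×ˢ V) := hV.prod hV
  have hp : (x, y) ∈ V ×ˢ V := ⟨hx, hy⟩
  have hD1 : ContDiffOn ℝ 1 (fderiv ℝ (gram f)) (V ×ˢ V) :=
    hG.fderiv_of_isOpen hVV (by norm_num)
  have hD2 : ContinuousOn (fderiv ℝ (fderiv ℝ (gram f))) (V ×ˢ V) :=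
    (hD1.fderiv_of_isOpen hVV (m := 0) (by norm_num)).continuousOn
  set D := fderiv ℝ (fderiv ℝ (gram f)) (x, y) with hD
  have hnear : ∀ᶠ q in 𝓝 (x, y), ‖fderiv ℝ (fderiv ℝ (gram f)) q - D‖ < ε :=
    eventually_norm_sub_lt_of_continuousAt (Y := E × E →L[ℝ] E × E →L[ℝ] ℝ)
      (hD2.continuousAt (hVV.mem_nhds hp)) hε
  have hev := hnear.and (hVV.mem_nhds hp)
  obtain ⟨δ, hδ, hball⟩ := Metric.eventually_nhds_iff_ball.1 hev
  have hmem : ∀ v w : E, ‖v‖ < δ → ‖w‖ < δ → (x + v, y + w) ∈ Metric.ball (x, y) δ := by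
    intro v w hv hw
    rw [Metric.mem_ball, Prod.dist_eq, max_lt_iff]
    simpa [dist_eq_norm] using ⟨hv, hw⟩
  have hdiff1 : ∀ q ∈ V ×ˢ V, HasFDerivAt (gram f) (fderiv ℝ (gram f) q) q := fun q hq =>
    ((hG.contDiffAt (hVV.mem_nhds hq)).differentiableAt (by simp)).hasFDerivAt
  have hdiff2 : ∀ q ∈ V ×ˢ V,
      HasFDerivAt (fderiv ℝ (gram f)) (fderiv ℝ (fderiv ℝ (gram f)) q) q := fun q hq =>
    ((hD1.contDiffAt (hVV.mem_nhds hq)).differentiableAt (by simp)).hasFDerivAt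
  refine ⟨δ, hδ, ?_⟩
  -- first the mean value inequality in the second argument
  have step : ∀ v w u : E, ‖v‖ < δ → ‖w‖ < δ →
      |fderiv ℝ (gram f) (x + v, y + w) (u, 0) - fderiv ℝ (gram f) (x + v, y) (u, 0)
        - D (0, w) (u, 0)| ≤ ε * ‖u‖ * ‖w‖ := by
    intro v w u hv hw
    have hder : ∀ w' ∈ Metric.ball (0 : E) δ, HasFDerivWithinAt
        (fun w' => fderiv ℝ (gram f) (x + v, y + w') (u, 0) - D (0, w') (u, 0))
        (((ContinuousLinearMap.apply ℝ ℝ ((u, 0) : E × E)).comp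
          ((fderiv ℝ (fderiv ℝ (gram f)) (x + v, y + w') - D).comp
            (ContinuousLinearMap.inr ℝ E E)))) (Metric.ball (0 : E) δ) w' := by
      intro w' hw'
      have hq := (hball _ (hmem v w' hv (by simpa using hw'))).2
      have h1 : HasFDerivAt (fun w' : E => (x + v, y + w')) (ContinuousLinearMap.inr ℝ E E) w' := by
        have := (hasFDerivAt_const (𝕜 := ℝ) (x + v) w').prodMk ((hasFDerivAt_id w').const_add y)
        exact this
      have h2 := (hdiff2 _ hq).comp w' h1
      have h3 := (ContinuousLinearMap.apply ℝ ℝ ((u, 0) : E × E)).hasFDerivAt.comp w' h2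
      have h4 : HasFDerivAt (fun w' : E => D (0, w') (u, 0))
          ((ContinuousLinearMap.apply ℝ ℝ ((u, 0) : E × E)).comp
            (D.comp (ContinuousLinearMap.inr ℝ E E))) w' :=
        ((ContinuousLinearMap.apply ℝ ℝ ((u, 0) : E × E)).comp
            (D.comp (ContinuousLinearMap.inr ℝ E E))).hasFDerivAt
      have h5 := (h3.sub h4).hasFDerivWithinAt (s := Metric.ball (0 : E) δ)
      refine h5.congr_fderiv ?_
      ext z; simp
    have hbound : ∀ w' ∈ Metric.ball (0 : E) δ,
        ‖(((ContinuousLinearMap.apply ℝ ℝ ((u, 0) : E × E)).comp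
          ((fderiv ℝ (fderiv ℝ (gram f)) (x + v, y + w') - D).comp
            (ContinuousLinearMap.inr ℝ E E))))‖ ≤ ε * ‖u‖ := by
      intro w' hw'
      have hq := (hball _ (hmem v w' hv (by simpa using hw'))).1
      refine ContinuousLinearMap.opNorm_le_bound _ (by positivity) fun z => ?_
      have := (fderiv ℝ (fderiv ℝ (gram f)) (x + v, y + w') - D).le_opNorm₂ ((0, z) : E × E)
        ((u, 0) : E × E)
      have hz : ‖((0, z) : E × E)‖ = ‖z‖ := by simp [Prod.norm_def]
      have hu : ‖((u, 0) : E × E)‖ = ‖u‖ := by simp [Prod.norm_def]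
      rw [hz, hu] at this
      calc _ ≤ _ := this
        _ ≤ ε * ‖z‖ * ‖u‖ := by gcongr
        _ = _ := by ring
    have := (convex_ball (0 : E) δ).norm_image_sub_le_of_norm_hasFDerivWithin_le hder hbound
      (Metric.mem_ball_self hδ) (by simpa using hw)
    simp only [add_zero, sub_zero, Real.norm_eq_abs] at this
    have h0 : D ((0 : E), (0 : E)) ((u, 0) : E × E) = 0 := by
      have : ((0 : E), (0 : E)) = 0 := rfl
      rw [this]; simp
    rw [h0, sub_zero] at this
    convert this using 2
    ring
  -- then in the first argument
  intro v w hv hw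
  have hder : ∀ v' ∈ Metric.ball (0 : E) δ, HasFDerivWithinAt
      (fun v' => gram f (x + v', y + w) - gram f (x + v', y) - D (0, w) (v', 0))
      ((fderiv ℝ (gram f) (x + v', y + w) - fderiv ℝ (gram f) (x + v', y) - D (0, w)).comp
        (ContinuousLinearMap.inl ℝ E E)) (Metric.ball (0 : E) δ) v' := by
    intro v' hv'
    have hq : ∀ w, ‖w‖ < δ → (x + v', y + w) ∈ V ×ˢ V := fun w hw =>
      (hball _ (hmem v' w (by simpa using hv') hw)).2
    have h1 : ∀ z : E, HasFDerivAt (fun v' : E => (x + v', z)) (ContinuousLinearMap.inl ℝ E E) v' :=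
      fun z => ((hasFDerivAt_id v').const_add x).prodMk (hasFDerivAt_const z v')
    have h2 := (hdiff1 _ (hq w hw)).comp v' (h1 (y + w))
    have h3 := (hdiff1 _ (by simpa using hq 0 (by simpa using hδ))).comp v' (h1 y)
    have h4 : HasFDerivAt (fun v' : E => D (0, w) (v', 0))
        ((D (0, w)).comp (ContinuousLinearMap.inl ℝ E E)) v' :=
      ((D (0, w)).comp (ContinuousLinearMap.inl ℝ E E)).hasFDerivAt
    have h5 := ((h2.sub h3).sub h4).hasFDerivWithinAt (s := Metric.ball (0 : E) δ)
    refine h5.congr_fderiv ?_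
    ext z; simp
  have hbound : ∀ v' ∈ Metric.ball (0 : E) δ,
      ‖(fderiv ℝ (gram f) (x + v', y + w) - fderiv ℝ (gram f) (x + v', y) - D (0, w)).comp
        (ContinuousLinearMap.inl ℝ E E)‖ ≤ ε * ‖w‖ := by
    intro v' hv'
    refine ContinuousLinearMap.opNorm_le_bound _ (by positivity) fun u => ?_
    calc _ ≤ ε * ‖u‖ * ‖w‖ := step v' w u (by simpa using hv') hw
      _ = _ := by ring
  have := (convex_ball (0 : E) δ).norm_image_sub_le_of_norm_hasFDerivWithin_le hder hbound
    (Metric.mem_ball_self hδ) (by simpa using hv)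
  have h0 : D ((0 : E), w) (((0 : E), (0 : E)) : E × E) = 0 := by
    have : ((0 : E), (0 : E)) = 0 := rfl
    rw [this]; simp
  simp only [add_zero, sub_zero, Real.norm_eq_abs, h0] at this
  have h1 : inner ℝ (f (x + v) - f x) (f (y + w) - f y) - gram₂ f (x, y) v w =
      gram f (x + v, y + w) - gram f (x + v, y) - D (0, w) (v, 0)
        - (gram f (x, y + w) - gram f (x, y)) := by
    simp only [inner_sub_left, inner_sub_right, gram, gram₂, hD]
    ring
  rw [h1]
  calc _ ≤ _ := this
    _ = _ := by ring

theorem gram₂_smul_smul (f : E → H) (p : E × E) (a b : ℝ) (v w : E) :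
    gram₂ f p (a • v) (b • w) = a * b * gram₂ f p v w := by
  have h1 : ((0 : E), b • w) = b • ((0 : E), w) := by simp
  have h2 : (a • v, (0 : E)) = a • (v, (0 : E)) := by simp
  simp only [gram₂]
  rw [h1, h2, map_smul, map_smul]
  simp only [FunLike.coe_smul, Pi.smul_apply, smul_eq_mul]
  ring

theorem gram₂_add_left (f : E → H) (p : E × E) (v v' w : E) :
    gram₂ f p (v + v') w = gram₂ f p v w + gram₂ f p v' w := by
  have h2 : (v + v', (0 : E)) = (v, (0 : E)) + (v', 0) := by simp
  simp only [gram₂]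
  rw [h2, map_add]

theorem gram₂_add_right (f : E → H) (p : E × E) (v w w' : E) :
    gram₂ f p v (w + w') = gram₂ f p v w + gram₂ f p v w' := by
  have h2 : ((0 : E), w + w') = ((0 : E), w) + (0, w') := by simp
  simp only [gram₂]
  rw [h2, map_add]
  rfl

theorem gram₂_smul_left (f : E → H) (p : E × E) (a : ℝ) (v w : E) :
    gram₂ f p (a • v) w = a * gram₂ f p v w := by
  simpa using gram₂_smul_smul f p a 1 v w

theorem gram₂_smul_right (f : E → H) (p : E × E) (a : ℝ) (v w : E) :
    gram₂ f p v (a • w) = a * gram₂ f p v w := by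
  simpa using gram₂_smul_smul f p 1 a v w

/-- Difference quotients of the feature map form a Cauchy sequence, because their inner products
are second difference quotients of the kernel. -/
theorem exists_deriv_of_gram [CompleteSpace H] {V : Set E} (hV : IsOpen V) {f : E → H}
    (hG : ContDiffOn ℝ 2 (gram f) (V ×ˢ V)) :
    ∃ f' : E → E → H,
      (∀ x ∈ V, ∀ y ∈ V, ∀ v w, inner ℝ (f' x v) (f' y w) = gram₂ f (x, y) v w) ∧
      ∀ x ∈ V, ∀ ε > 0, ∃ δ > 0, ∀ v w : E, ‖w‖ < δ →
        |inner ℝ (f' x v) (f (x + w) - f x) - gram₂ f (x, x) v w| ≤ ε * ‖v‖ * ‖w‖ := by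
  let t : ℕ → ℝ := fun n => 1 / ((n : ℝ) + 1)
  have ht0 : ∀ n, 0 < t n := fun n => by positivity
  have ht : Tendsto t atTop (𝓝 0) := tendsto_one_div_add_atTop_nhds_zero_nat
  let q : E → E → ℕ → H := fun x v n => (t n)⁻¹ • (f (x + t n • v) - f x)
  have hsmall : ∀ (v : E) (δ : ℝ), 0 < δ → ∀ᶠ n in atTop, ‖t n • v‖ < δ := by
    intro v δ hδ
    have : Tendsto (fun n => ‖t n • v‖) atTop (𝓝 0) := by
      simpa using ((ht.smul_const v).norm)
    exact this.eventually_lt_const hδ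
  -- inner products of difference quotients
  have hq : ∀ x ∈ V, ∀ y ∈ V, ∀ v w : E, ∀ ε > 0, ∃ N, ∀ n ≥ N, ∀ k ≥ N,
      |inner ℝ (q x v n) (q y w k) - gram₂ f (x, y) v w| ≤ ε * ‖v‖ * ‖w‖ := by
    intro x hx y hy v w ε hε
    obtain ⟨δ, hδ, h⟩ := inner_sub_sub_approx hV hG hx hy hε
    obtain ⟨N, hN⟩ := eventually_atTop.1 ((hsmall v δ hδ).and (hsmall w δ hδ))
    refine ⟨N, fun n hn k hk => ?_⟩
    have := h _ _ (hN n hn).1 (hN k hk).2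
    rw [gram₂_smul_smul, norm_smul, norm_smul, Real.norm_of_nonneg (ht0 n).le,
      Real.norm_of_nonneg (ht0 k).le] at this
    have e : inner ℝ (q x v n) (q y w k) - gram₂ f (x, y) v w = (t n)⁻¹ * (t k)⁻¹ *
        (inner ℝ (f (x + t n • v) - f x) (f (y + t k • w) - f y)
          - t n * t k * gram₂ f (x, y) v w) := by
      simp only [q, real_inner_smul_left, real_inner_smul_right]
      have := (ht0 n).ne'
      have := (ht0 k).ne'
      field_simp
    rw [e, abs_mul, abs_of_pos (mul_pos (inv_pos.2 (ht0 n)) (inv_pos.2 (ht0 k)))]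
    calc _ ≤ (t n)⁻¹ * (t k)⁻¹ * (ε * (t n * ‖v‖) * (t k * ‖w‖)) := by
          have := ht0 n
          have := ht0 k
          gcongr
      _ = _ := by
          have := (ht0 n).ne'
          have := (ht0 k).ne'
          field_simp
  have hcauchy : ∀ x ∈ V, ∀ v, ∃ z, Tendsto (q x v) atTop (𝓝 z) := by
    intro x hx v
    refine cauchySeq_tendsto_of_complete (Metric.cauchySeq_iff'.2 fun ε hε => ?_)
    obtain ⟨N, hN⟩ := hq x hx x hx v v (ε ^ 2 / (8 * (‖v‖ * ‖v‖ + 1))) (by positivity)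
    refine ⟨N, fun n hn => ?_⟩
    have h1 := abs_le.1 (hN n hn n hn)
    have h2 := abs_le.1 (hN n hn N le_rfl)
    have h3 := abs_le.1 (hN N le_rfl N le_rfl)
    have hle : ε ^ 2 / (8 * (‖v‖ * ‖v‖ + 1)) * ‖v‖ * ‖v‖ ≤ ε ^ 2 / 8 := by
      have : 0 ≤ ‖v‖ * ‖v‖ := by positivity
      rw [div_mul_eq_mul_div, div_mul_eq_mul_div, div_le_div_iff₀ (by positivity) (by norm_num)]
      nlinarith [sq_nonneg ε]
    -- each of the inner products in the expansion of `‖q n - q N‖²` is close to `gram₂`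
    rw [dist_eq_norm]
    refine lt_of_pow_lt_pow_left₀ 2 hε.le ?_
    rw [norm_sub_sq_real, ← real_inner_self_eq_norm_sq, ← real_inner_self_eq_norm_sq]
    nlinarith [sq_pos_of_pos hε]
  choose! f' hf' using hcauchy
  refine ⟨f', fun x hx y hy v w => ?_, fun x hx ε hε => ?_⟩
  · have hlim := (hf' x hx v).inner (𝕜 := ℝ) (hf' y hy w)
    refine tendsto_nhds_unique hlim (Metric.tendsto_atTop.2 fun ε hε => ?_)
    obtain ⟨N, hN⟩ := hq x hx y hy v w (ε / (2 * (‖v‖ * ‖w‖ + 1))) (by positivity)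
    refine ⟨N, fun n hn => (hN n hn n hn).trans_lt ?_⟩
    have : 0 ≤ ‖v‖ * ‖w‖ := by positivity
    rw [div_mul_eq_mul_div, div_mul_eq_mul_div, div_lt_iff₀ (by positivity)]
    nlinarith
  · obtain ⟨δ, hδ, h⟩ := inner_sub_sub_approx hV hG hx hx hε
    refine ⟨δ, hδ, fun v w hw => ?_⟩
    have hlim : Tendsto (fun n => |inner ℝ (q x v n) (f (x + w) - f x) - gram₂ f (x, x) v w|) atTop
        (𝓝 |inner ℝ (f' x v) (f (x + w) - f x) - gram₂ f (x, x) v w|) :=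
      (((hf' x hx v).inner (𝕜 := ℝ) tendsto_const_nhds).sub tendsto_const_nhds).abs
    refine le_of_tendsto hlim ?_
    filter_upwards [hsmall v δ hδ] with n hn
    have := h _ _ hn hw
    rw [gram₂_smul_left, norm_smul, Real.norm_of_nonneg (ht0 n).le] at this
    have e : inner ℝ (q x v n) (f (x + w) - f x) - gram₂ f (x, x) v w = (t n)⁻¹ *
        (inner ℝ (f (x + t n • v) - f x) (f (x + w) - f x) - t n * gram₂ f (x, x) v w) := by
      simp only [q, real_inner_smul_left]
      have := (ht0 n).ne'
      field_simp
    rw [e, abs_mul, abs_of_pos (inv_pos.2 (ht0 n))]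
    calc _ ≤ (t n)⁻¹ * (ε * (t n * ‖v‖) * ‖w‖) := by
          have := ht0 n
          gcongr
      _ = _ := by
          have := (ht0 n).ne'
          field_simp

/-- A map into a Hilbert space is Fréchet differentiable if its kernel is `C²`. -/
theorem exists_hasFDerivAt_of_gram [FiniteDimensional ℝ E] [CompleteSpace H] {V : Set E}
    (hV : IsOpen V) {f : E → H} (hG : ContDiffOn ℝ 2 (gram f) (V ×ˢ V)) :
    ∃ f' : E → E →L[ℝ] H, (∀ x ∈ V, HasFDerivAt f (f' x) x) ∧
      ∀ x ∈ V, ∀ y ∈ V, ∀ v w, inner ℝ (f' x v) (f' y w) = gram₂ f (x, y) v w := by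
  obtain ⟨f', h1, h2⟩ := exists_deriv_of_gram hV hG
  have hadd : ∀ x ∈ V, ∀ v w, f' x (v + w) = f' x v + f' x w := by
    -- the squared norm of the difference is a combination of values of the bilinear `gram₂`
    intro x hx v w
    rw [← sub_eq_zero, ← inner_self_eq_zero (𝕜 := ℝ)]
    simp only [inner_sub_left, inner_sub_right, inner_add_left, inner_add_right, h1 x hx x hx,
      gram₂_add_left, gram₂_add_right]
    ring
  have hsmul : ∀ x ∈ V, ∀ (a : ℝ) v, f' x (a • v) = a • f' x v := by
    intro x hx a v
    rw [← sub_eq_zero, ← inner_self_eq_zero (𝕜 := ℝ)]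
    simp only [inner_sub_left, inner_sub_right, real_inner_smul_left, real_inner_smul_right,
      h1 x hx x hx, gram₂_smul_left, gram₂_smul_right]
    ring
  classical
  let T : E → E →L[ℝ] H := fun x => if hx : x ∈ V then
    LinearMap.toContinuousLinearMap
      { toFun := f' x, map_add' := hadd x hx, map_smul' := hsmul x hx } else 0
  have hT : ∀ x ∈ V, ∀ v, T x v = f' x v := fun x hx v => by simp [T, hx]
  refine ⟨T, fun x hx => ?_, fun x hx y hy v w => by rw [hT x hx, hT y hy, h1 x hx y hy]⟩
  rw [hasFDerivAt_iff_isLittleO_nhds_zero, Asymptotics.isLittleO_iff]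
  intro c hc
  obtain ⟨δ₁, hδ₁, ha⟩ := inner_sub_sub_approx hV hG hx hx (ε := c ^ 2 / 3) (by positivity)
  obtain ⟨δ₂, hδ₂, hb⟩ := h2 x hx (c ^ 2 / 3) (by positivity)
  filter_upwards [Metric.ball_mem_nhds (0 : E) (lt_min hδ₁ hδ₂)] with w hw
  rw [mem_ball_zero_iff, lt_min_iff] at hw
  have e1 := abs_le.1 (ha w w hw.1 hw.1)
  have e2 := abs_le.1 (hb w w hw.2)
  have e3 := h1 x hx x hx w w
  refine le_of_sq_le_sq ?_ (by positivity)
  rw [hT x hx, norm_sub_sq_real, ← real_inner_self_eq_norm_sq, ← real_inner_self_eq_norm_sq,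
    real_inner_comm (f' x w), e3]
  nlinarith

/-- A map into a Hilbert space is `C^n` if its kernel is `C^{2n}`. -/
theorem contDiffOn_of_gram [FiniteDimensional ℝ E] [CompleteSpace H] {V : Set E}
    (hV : IsOpen V) (n : ℕ) : ∀ f : E → H,
      ContDiffOn ℝ (2 * n : ℕ) (gram f) (V ×ˢ V) → ContDiffOn ℝ n f V := by
  induction n with
  | zero =>
    intro f hG
    have hc : ContinuousOn (gram f) (V ×ˢ V) := hG.continuousOn
    refine contDiffOn_zero.2 fun x hx => ?_
    rw [ContinuousWithinAt, tendsto_iff_norm_sub_tendsto_zero]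
    have hsq : Tendsto (fun y => ‖f y - f x‖ ^ 2) (𝓝[V] x) (𝓝 0) := by
      have hm : ∀ y ∈ V, ∀ z ∈ V, ContinuousWithinAt (gram f) (V ×ˢ V) (y, z) := fun y hy z hz =>
        hc _ ⟨hy, hz⟩
      have hid : Tendsto (fun y : E => y) (𝓝[V] x) (𝓝[V] x) := tendsto_id
      have hcx : Tendsto (fun _ : E => x) (𝓝[V] x) (𝓝[V] x) :=
        tendsto_nhdsWithin_iff.2 ⟨tendsto_const_nhds, Eventually.of_forall fun _ => hx⟩
      have hg : Tendsto (gram f) (𝓝[V] x ×ˢ 𝓝[V] x) (𝓝 (gram f (x, x))) := by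
        rw [← nhdsWithin_prod_eq]; exact hm x hx x hx
      have h1 := hg.comp (hid.prodMk hid)
      have h2 := hg.comp (hid.prodMk hcx)
      have h3 := (h1.sub (h2.const_mul 2)).add (tendsto_const_nhds (x := gram f (x, x)))
      refine (h3.congr fun y => ?_).trans (by ring_nf; exact le_rfl)
      rw [norm_sub_sq_eq_gram]; rfl
    have := hsq.sqrt
    simpa using this
  | succ n ih =>
    intro f hG
    have h2 : ContDiffOn ℝ 2 (gram f) (V ×ˢ V) := hG.of_le (by norm_cast; omega)
    obtain ⟨f', hf, hi⟩ := exists_hasFDerivAt_of_gram hV h2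
    have hfd : ∀ x ∈ V, fderiv ℝ f x = f' x := fun x hx => (hf x hx).fderiv
    have : ((n + 1 : ℕ) : WithTop ℕ∞) = (n : WithTop ℕ∞) + 1 := by norm_cast
    rw [this, contDiffOn_succ_iff_fderiv_of_isOpen hV]
    refine ⟨fun x hx => (hf x hx).differentiableAt.differentiableWithinAt, by simp, ?_⟩
    refine ContDiffOn.congr (f := f') ?_ hfd
    -- the kernel of `x ↦ f' x v` is a second derivative of the kernel of `f`
    rw [contDiffOn_clm_apply]
    intro v
    refine ih _ ?_
    have hVV : IsOpen (V ×ˢ V) := hV.prod hV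
    have hd1 : ContDiffOn ℝ (2 * n + 1 : ℕ) (fderiv ℝ (gram f)) (V ×ˢ V) :=
      hG.fderiv_of_isOpen hVV (by norm_cast)
    have hd2 : ContDiffOn ℝ (2 * n : ℕ) (fderiv ℝ (fderiv ℝ (gram f))) (V ×ˢ V) :=
      hd1.fderiv_of_isOpen hVV (by norm_cast)
    refine ((hd2.clm_apply (contDiffOn_const (c := ((0 : E), v)))).clm_apply
      (contDiffOn_const (c := (v, (0 : E))))).congr fun p hp => ?_
    exact hi p.1 hp.1 p.2 hp.2 v v

end Feature

/-! ### The feature map of the kernel -/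

/-- The feature map `x ↦ K(x, ·)` of a positive definite kernel into its reproducing kernel Hilbert
space: the kernel is the Gram matrix, and the features are total. -/
theorem IsPosDefKernel.exists_feature {d : ℕ} {U : Set (Eu d)} {K : Eu d → Eu d → ℝ}
    (hK : IsPosDefKernel U K) :
    ∃ (H : Type) (_ : NormedAddCommGroup H) (_ : InnerProductSpace ℝ H) (_ : CompleteSpace H)
      (k : Eu d → H), (∀ x ∈ U, ∀ y ∈ U, inner ℝ (k x) (k y) = K x y) ∧
        ∀ h : H, (∀ x ∈ U, inner ℝ (k x) h = 0) → h = 0 := by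
  classical
  let M : Matrix U U (ℝ →L[ℝ] ℝ) := fun x y => K x y • ContinuousLinearMap.id ℝ ℝ
  have hM : M.PosSemidef := by
    refine (RKHS.posSemidef_tfae.out 0 2 rfl rfl).2 ⟨?_, fun c => ?_⟩
    · refine Matrix.IsHermitian.ext fun x y => ?_
      simp only [M, hK.symm _ y.2 _ x.2, ContinuousLinearMap.star_eq_adjoint, map_smulₛₗ,
        ContinuousLinearMap.adjoint_id, conj_trivial]
    · by_cases hc : c = 0
      · simp [hc]
      let e := c.support.equivFin.symm
      have hpos := hK.pos c.support.card (fun j => ((e j : U) : Eu d)) (fun j => (e j : U).2)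
        (Subtype.val_injective.comp (Subtype.val_injective.comp e.injective))
        (fun j => c (e j)) (by
          obtain ⟨x, hx⟩ := Finsupp.ne_iff.1 hc
          intro h0
          have := congrFun h0 (e.symm ⟨x, Finsupp.mem_support_iff.2 hx⟩)
          simp at this
          exact hx this)
      refine hpos.le.trans (le_of_eq ?_)
      simp only [Finsupp.sum, M]
      rw [← Finset.sum_coe_sort c.support, ← e.sum_comp]
      simp only [RCLike.re_to_real]
      refine Finset.sum_congr rfl fun j _ => ?_
      rw [← Finset.sum_coe_sort c.support, ← e.sum_comp]
      refine Finset.sum_congr rfl fun k _ => ?_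
      rw [hK.symm _ (e j : U).2 _ (e k : U).2]
      simp
      ring
  have : Fact M.PosSemidef := ⟨hM⟩
  let k : Eu d → RKHS.OfKernel M := fun x =>
    if hx : x ∈ U then RKHS.kerFun (RKHS.OfKernel M) (⟨x, hx⟩ : U) (1 : ℝ) else 0
  refine ⟨RKHS.OfKernel M, inferInstance, inferInstance, inferInstance, k, fun x hx y hy => ?_,
    fun h hh => ?_⟩
  · simp only [k, hx, hy, dif_pos]
    rw [← RKHS.kernel_inner, RKHS.OfKernel.kernel_ofKernel]
    simp [M, hK.symm _ hx _ hy]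
  · refine RKHS.ext fun x => ?_
    have := hh x x.2
    simp only [k, x.2, dif_pos] at this
    simpa using this

section Features

variable {d m : ℕ} {H : Type*} [NormedAddCommGroup H] [InnerProductSpace ℝ H] {U : Set (Eu d)}

theorem contDiffOn_foldr_fderiv {E F : Type*} [NormedAddCommGroup E] [NormedSpace ℝ E]
    [NormedAddCommGroup F] [NormedSpace ℝ F] {V : Set E} (hV : IsOpen V) {f : E → F} {m : ℕ}
    (h : ContDiffOn ℝ m f V) : ∀ (L : List E) (n : ℕ), L.length + n ≤ m →
      ContDiffOn ℝ n (L.foldr (fun v g y => fderiv ℝ g y v) f) V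
  | [], n, hn => h.of_le (by simpa using hn)
  | v :: L, n, hn => by
    have ih := contDiffOn_foldr_fderiv hV h L (n + 1)
      (by simp only [List.length_cons] at hn; omega)
    exact (ih.fderiv_of_isOpen hV (m := n) (by norm_cast)).clm_apply contDiffOn_const

/-- Mixed derivatives of the kernel are inner products of derivatives of the features. -/
theorem foldr_gram_eq (hU : IsOpen U) {k : Eu d → H} (hk : ContDiffOn ℝ m k U)
    (hG : ContDiffOn ℝ (2 * m : ℕ) (gram k) (U ×ˢ U))
    (l l' : List (Fin d)) (hl : l.length ≤ m) (hl' : l'.length ≤ m) :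
    ∀ p ∈ U ×ˢ U,
    ((l.map fun i => ((EuclideanSpace.single i 1, 0) : Eu d × Eu d)) ++
      l'.map fun i => ((0, EuclideanSpace.single i 1) : Eu d × Eu d)).foldr
      (fun v g y => fderiv ℝ g y v) (gram k) p = inner ℝ (pL l k p.1) (pL l' k p.2) := by
  have hUU : IsOpen (U ×ˢ U) := hU.prod hU
  have hdiff : ∀ L : List (Eu d × Eu d), L.length < 2 * m → ∀ p ∈ U ×ˢ U,
      DifferentiableAt ℝ (L.foldr (fun v g y => fderiv ℝ g y v) (gram k)) p := fun L hL p hp =>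
    ((contDiffOn_foldr_fderiv hUU hG L 1 hL).contDiffAt (hUU.mem_nhds hp)).differentiableAt
      (by simp)
  induction l with
  | nil =>
    induction l' with
    | nil => intro p _; rfl
    | cons i l' ih =>
      have hl'' : l'.length ≤ m := by simp only [List.length_cons] at hl'; omega
      intro p hp
      have ih := ih hl''
      simp only [List.map_nil, List.nil_append, List.map_cons, List.foldr_cons] at ih ⊢
      have hd := hdiff (l'.map fun i => ((0, EuclideanSpace.single i 1) : Eu d × Eu d))
        (by simp only [List.length_cons, List.length_map] at *; omega) p hp
      set Φ := (l'.map fun i => ((0, EuclideanSpace.single i 1) : Eu d × Eu d)).foldr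
        (fun v g y => fderiv ℝ g y v) (gram k)
      have h1 : HasFDerivAt (fun y : Eu d => (p.1, y)) (ContinuousLinearMap.inr ℝ (Eu d) (Eu d))
          p.2 := (hasFDerivAt_const (𝕜 := ℝ) p.1 p.2).prodMk (hasFDerivAt_id p.2)
      have h2 : HasFDerivAt (fun y : Eu d => Φ (p.1, y)) _ p.2 := hd.hasFDerivAt.comp p.2 h1
      have he : (fun y : Eu d => Φ (p.1, y)) =ᶠ[𝓝 p.2]
          fun y => innerSL ℝ (k p.1) (pL l' k y) :=
        Filter.eventuallyEq_of_mem (hU.mem_nhds hp.2) fun y hy => ih (p.1, y) ⟨hp.1, hy⟩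
      have h3 := (innerSL ℝ (k p.1)).hasFDerivAt.comp p.2
        (differentiableAt_pL hU hk hl' hp.2).hasFDerivAt
      have h4 := congrArg (fun T : Eu d →L[ℝ] ℝ => T (EuclideanSpace.single i 1))
        (h2.unique (h3.congr_of_eventuallyEq he))
      simpa [pL_cons, pL_nil, pD] using h4
  | cons i l ih =>
    have hl1 : l.length ≤ m := by simp only [List.length_cons] at hl; omega
    intro p hp
    have ih := ih hl1
    rw [List.map_cons, List.cons_append, List.foldr_cons]
    have hd := hdiff ((l.map fun i => ((EuclideanSpace.single i 1, 0) : Eu d × Eu d)) ++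
      l'.map fun i => ((0, EuclideanSpace.single i 1) : Eu d × Eu d))
      (by simp only [List.length_append, List.length_cons, List.length_map] at *; omega) p hp
    set Φ := ((l.map fun i => ((EuclideanSpace.single i 1, 0) : Eu d × Eu d)) ++
      l'.map fun i => ((0, EuclideanSpace.single i 1) : Eu d × Eu d)).foldr
        (fun v g y => fderiv ℝ g y v) (gram k)
    have h1 : HasFDerivAt (fun y : Eu d => (y, p.2)) (ContinuousLinearMap.inl ℝ (Eu d) (Eu d))
        p.1 := (hasFDerivAt_id p.1).prodMk (hasFDerivAt_const (𝕜 := ℝ) p.2 p.1)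
    have h2 : HasFDerivAt (fun y : Eu d => Φ (y, p.2)) _ p.1 := hd.hasFDerivAt.comp p.1 h1
    have he : (fun y : Eu d => Φ (y, p.2)) =ᶠ[𝓝 p.1]
        fun y => innerSL ℝ (pL l' k p.2) (pL l k y) :=
      Filter.eventuallyEq_of_mem (hU.mem_nhds hp.1) fun y hy =>
        (ih (y, p.2) ⟨hy, hp.2⟩).trans (real_inner_comm _ _)
    have h3 := (innerSL ℝ (pL l' k p.2)).hasFDerivAt.comp p.1
      (differentiableAt_pL hU hk hl hp.1).hasFDerivAt
    have h4 := congrArg (fun T : Eu d →L[ℝ] ℝ => T (EuclideanSpace.single i 1))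
      (h2.unique (h3.congr_of_eventuallyEq he))
    rw [real_inner_comm]
    simpa [pL_cons, pD] using h4

/-- The feature map of a kernel in `C^{2m}` up to the boundary is `C^m` up to the boundary: the
derivatives of the features satisfy the Cauchy criterion at boundary points because their inner
products, which are derivatives of the kernel, converge. -/
theorem smoothUpTo_feature [CompleteSpace H] (hU : IsOpen U) {k : Eu d → H}
    (hG : ContDiffOnClosure (2 * m) (U ×ˢ U) (gram k)) : SmoothUpTo m U k := by
  have hUU : IsOpen (U ×ˢ U) := hU.prod hU
  have hk : ContDiffOn ℝ m k U := contDiffOn_of_gram hU m k hG.1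
  refine ⟨hk, fun l hl x hx => ?_⟩
  set L := (l.map fun i => ((EuclideanSpace.single i 1, 0) : Eu d × Eu d)) ++
      l.map fun i => ((0, EuclideanSpace.single i 1) : Eu d × Eu d) with hL
  have hLl : L.length ≤ 2 * m := by simp [hL]; omega
  obtain ⟨G, hGc, hGe⟩ := hG.2 L.length hLl
  have hxx : (x, x) ∈ closure (U ×ˢ U) := by rw [closure_prod_eq]; exact ⟨hx, hx⟩
  have h1 : Tendsto G (𝓝[U ×ˢ U] (x, x)) (𝓝 (G (x, x))) :=
    (hGc (x, x) hxx).mono_left (nhdsWithin_mono _ subset_closure)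
  have h2 := ((ContinuousMultilinearMap.apply ℝ (fun _ : Fin L.length => Eu d × Eu d) ℝ
    L.get).continuous.tendsto _).comp h1
  have h3 : Tendsto (gram (pL l k)) (𝓝[U] x ×ˢ 𝓝[U] x) (𝓝 (G (x, x) L.get)) := by
    rw [← nhdsWithin_prod_eq]
    refine h2.congr' ?_
    filter_upwards [self_mem_nhdsWithin] with p hp
    have e1 := foldr_fderiv_eq_iteratedFDeriv hUU hG.1 L hLl p hp
    rw [hL, foldr_gram_eq hU hk hG.1 l l hl hl p hp, ← hL, ← hGe hp] at e1
    exact e1.symm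
  have hne : (𝓝[U] x).NeBot := mem_closure_iff_nhdsWithin_neBot.1 hx
  have hcau : Cauchy (map (pL l k) (𝓝[U] x)) := by
    rw [cauchy_map_iff']
    have hf : Tendsto (fun p : Eu d × Eu d => p.1) (𝓝[U] x ×ˢ 𝓝[U] x) (𝓝[U] x) := tendsto_fst
    have hs : Tendsto (fun p : Eu d × Eu d => p.2) (𝓝[U] x ×ˢ 𝓝[U] x) (𝓝[U] x) := tendsto_snd
    have h4 := ((h3.comp (hf.prodMk hf)).sub (h3.const_mul 2)).add (h3.comp (hs.prodMk hs))
    have h5 : Tendsto (fun p : Eu d × Eu d => ‖pL l k p.1 - pL l k p.2‖ ^ 2)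
        (𝓝[U] x ×ˢ 𝓝[U] x) (𝓝 0) := by
      refine (h4.congr fun p => ?_).trans (by ring_nf; exact le_rfl)
      rw [norm_sub_sq_eq_gram]; rfl
    have h6 := h5.sqrt
    simp only [Real.sqrt_zero, norm_nonneg, Real.sqrt_sq] at h6
    rw [tendsto_uniformity_iff_dist_tendsto_zero]
    simpa [dist_eq_norm] using h6
  obtain ⟨y, hy⟩ := cauchy_map_iff_exists_tendsto.1 hcau
  exact ⟨y, hy⟩

end Features

/-! ### Finiteness of the surface measure of a Lipschitz boundary -/

section Boundary

variable {d : ℕ}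

/-- Near a boundary point, the boundary of a Lipschitz domain is contained in the graph of the
Lipschitz function. -/
theorem frontier_subset_graph {U : Set (Eu d)} (hU : IsOpen U) {x e : Eu d} {r : ℝ}
    {L : ℝ≥0} {γ : Eu d → ℝ} (hγ : LipschitzWith L γ)
    (h : ∀ y ∈ Metric.ball x r, (y ∈ U ↔ γ (y - inner ℝ e y • e) < inner ℝ e y)) :
    ∀ y ∈ frontier U ∩ Metric.ball x r, γ (y - inner ℝ e y • e) = inner ℝ e y := by
  rintro y ⟨hy, hyb⟩
  have hyU : y ∉ U := fun hyU => by
    rw [hU.frontier_eq] at hy; exact hy.2 hyU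
  refine le_antisymm ?_ (not_lt.1 fun hlt => hyU ((h y hyb).2 hlt))
  by_contra! hlt
  have hc : Continuous fun z : Eu d => γ (z - inner ℝ e z • e) :=
    hγ.continuous.comp (by fun_prop)
  have hc' : Continuous fun z : Eu d => (inner ℝ e z : ℝ) := by fun_prop
  have hev : ∀ᶠ z in 𝓝 y, z ∉ U := by
    filter_upwards [(hc'.tendsto y).eventually_lt (hc.tendsto y) hlt,
      Metric.isOpen_ball.mem_nhds hyb] with z hz hzb hzU
    exact absurd ((h z hzb).1 hzU) (not_lt.2 hz.le)
  have := mem_closure_iff_frequently.1 (frontier_subset_closure hy)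
  exact this hev

/-- A bounded part of a Lipschitz graph is a Lipschitz image of a ball in `ℝ^n`. -/
theorem hausdorffMeasure_graph_lt_top {n : ℕ} {e : Eu (n + 1)} (he : ‖e‖ = 1) {L : ℝ≥0}
    {γ : Eu (n + 1) → ℝ} (hγ : LipschitzWith L γ) {S : Set (Eu (n + 1))}
    (hS : Bornology.IsBounded S) (h : ∀ y ∈ S, γ (y - inner ℝ e y • e) = inner ℝ e y) :
    (Measure.hausdorffMeasure (n : ℝ) : Measure (Eu (n + 1))) S < ⊤ := by
  have hfin : Fact (Module.finrank ℝ (Eu (n + 1)) = n + 1) := ⟨by simp⟩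
  have he0 : e ≠ 0 := fun h0 => by simp [h0] at he
  let V : Submodule ℝ (Eu (n + 1)) := (ℝ ∙ e)ᗮ
  have hV : Module.finrank ℝ V = n := Submodule.finrank_orthogonal_span_singleton he0
  let b : OrthonormalBasis (Fin n) ℝ V := (stdOrthonormalBasis ℝ V).reindex (finCongr hV)
  -- coordinates on the hyperplane orthogonal to `e`
  let T : (Fin n → ℝ) →L[ℝ] Eu (n + 1) := V.subtypeL.comp
    ((b.repr.symm.toContinuousLinearEquiv : EuclideanSpace ℝ (Fin n) →L[ℝ] V).comp
      ((EuclideanSpace.equiv (Fin n) ℝ).symm : (Fin n → ℝ) →L[ℝ] EuclideanSpace ℝ (Fin n)))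
  let ψ : (Fin n → ℝ) → Eu (n + 1) := fun t => T t + γ (T t) • e
  have hψ : ∃ C, LipschitzWith C ψ := by
    have h1 : LipschitzWith ‖T‖₊ T := T.lipschitz
    have h2 : LipschitzWith (‖ContinuousLinearMap.toSpanSingleton ℝ e‖₊ * (L * ‖T‖₊))
        fun t => γ (T t) • e :=
      (ContinuousLinearMap.toSpanSingleton ℝ e).lipschitz.comp (hγ.comp h1)
    exact ⟨_, h1.add h2⟩
  obtain ⟨C, hC⟩ := hψ
  obtain ⟨R, hR⟩ := hS.exists_norm_le
  have hsub : S ⊆ ψ '' Metric.closedBall 0 (2 * |R|) := by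
    intro y hy
    have hp : y - inner ℝ e y • e ∈ V := by
      rw [Submodule.mem_orthogonal_singleton_iff_inner_right, inner_sub_right,
        real_inner_smul_right, real_inner_self_eq_norm_sq, he]
      ring
    let t : Fin n → ℝ := EuclideanSpace.equiv (Fin n) ℝ (b.repr ⟨_, hp⟩)
    have hTt : T t = y - inner ℝ e y • e := by simp [T, t]
    refine ⟨t, ?_, ?_⟩
    · rw [mem_closedBall_zero_iff, pi_norm_le_iff_of_nonneg (by positivity)]
      intro i
      have h1 : ‖t i‖ ≤ ‖b.repr ⟨_, hp⟩‖ := PiLp.norm_apply_le (b.repr ⟨_, hp⟩) i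
      rw [LinearIsometryEquiv.norm_map, Submodule.coe_norm] at h1
      have h2 : ‖y - inner ℝ e y • e‖ ≤ ‖y‖ + ‖y‖ := by
        refine (norm_sub_le _ _).trans (add_le_add_right ?_ _)
        rw [norm_smul, he, mul_one]
        simpa [he] using norm_inner_le_norm (𝕜 := ℝ) e y
      have := (hR y hy).trans (le_abs_self R)
      linarith
    · simp only [ψ]
      rw [hTt, h y hy]
      abel
  have hvol : (Measure.hausdorffMeasure (n : ℝ) : Measure (Fin n → ℝ)) = volume := by
    simpa using hausdorffMeasure_pi_real (ι := Fin n)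
  calc (Measure.hausdorffMeasure (n : ℝ) : Measure (Eu (n + 1))) S
      ≤ Measure.hausdorffMeasure (n : ℝ) (ψ '' Metric.closedBall 0 (2 * |R|)) :=
        measure_mono hsub
    _ ≤ (C : ℝ≥0∞) ^ (n : ℝ) *
          Measure.hausdorffMeasure (n : ℝ) (Metric.closedBall (0 : Fin n → ℝ) (2 * |R|)) :=
        (hC.lipschitzOnWith (s := _)).hausdorffMeasure_image_le (Nat.cast_nonneg n)
    _ < ⊤ := by
        rw [hvol]
        refine ENNReal.mul_lt_top
          (ENNReal.rpow_lt_top_of_nonneg (Nat.cast_nonneg n) ENNReal.coe_ne_top) ?_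
        exact measure_closedBall_lt_top

theorem IsBoundedLipschitzDomain.hausdorffMeasure_frontier_lt_top (hd : 1 ≤ d) {U : Set (Eu d)}
    (hU : IsBoundedLipschitzDomain U) :
    (Measure.hausdorffMeasure ((d : ℝ) - 1) : Measure (Eu d)) (frontier U) < ⊤ := by
  obtain ⟨n, rfl⟩ : ∃ n, d = n + 1 := ⟨d - 1, by omega⟩
  have hn : (((n + 1 : ℕ) : ℝ) - 1) = n := by push_cast; ring
  rw [hn]
  have hcomp : IsCompact (frontier U) :=
    Metric.isCompact_of_isClosed_isBounded isClosed_frontier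
      (hU.isBounded.closure.subset frontier_subset_closure)
  refine hcomp.measure_lt_top_of_nhdsWithin fun x hx => ?_
  obtain ⟨r, hr, e, he, L, γ, hγ, h⟩ := hU.lipschitz x hx
  refine ⟨frontier U ∩ Metric.ball x r,
    inter_mem_nhdsWithin _ (Metric.ball_mem_nhds x hr), ?_⟩
  exact hausdorffMeasure_graph_lt_top he hγ (Metric.isBounded_ball.subset inter_subset_right)
    (frontier_subset_graph hU.isOpen hγ h)

end Boundary

/-! ### Classical derivatives are weak derivatives -/

section Weak

variable {d m : ℕ} {U : Set (Eu d)}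

theorem IsTest.pD {g : Eu d → ℝ} (h : IsTest U g) (i : Fin d) : IsTest U (pD i g) where
  smooth := (partialD_smooth_compact i ⟨h.smooth, h.compact⟩).1
  compact := (partialD_smooth_compact i ⟨h.smooth, h.compact⟩).2
  subset := (tsupport_fderiv_apply_subset ℝ _).trans h.subset

theorem integrable_mul_of_isTest (hU : IsOpen U) {f g : Eu d → ℝ} (hf : ContinuousOn f U)
    (hg : IsTest U g) : Integrable fun x => f x * g x := by
  have hc : Continuous fun x => f x * g x := by
    refine continuous_iff_continuousAt.2 fun x => ?_
    by_cases hx : x ∈ U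
    · exact (hf.continuousAt (hU.mem_nhds hx)).mul hg.smooth.continuous.continuousAt
    · have h0 : (fun x => f x * g x) =ᶠ[𝓝 x] fun _ => 0 := by
        have := notMem_tsupport_iff_eventuallyEq.1 fun h => hx (hg.subset h)
        filter_upwards [this] with y hy
        rw [hy]; simp
      exact continuousAt_const.congr h0.symm
  exact hc.integrable_of_hasCompactSupport hg.compact.mul_left

theorem setIntegral_mul_isTest {f g : Eu d → ℝ} (hg : IsTest U g) :
    ∫ x in U, f x * g x = ∫ x, f x * g x := by
  refine setIntegral_eq_integral_of_forall_compl_eq_zero fun x hx => ?_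
  rw [image_eq_zero_of_notMem_tsupport fun h => hx (hg.subset h), mul_zero]

theorem integral_pD_mul (hU : IsOpen U) {f : Eu d → ℝ} (hf : ContDiffOn ℝ (1 : ℕ) f U)
    {g : Eu d → ℝ} (hg : IsTest U g) (i : Fin d) :
    ∫ x in U, pD i f x * g x = -∫ x in U, f x * pD i g x := by
  have hf' : ContinuousOn (pD i f) U := (contDiffOn_pD hU (n := 0) hf i).continuousOn
  rw [setIntegral_mul_isTest hg, setIntegral_mul_isTest (hg.pD i)]
  unfold pD
  rw [integral_mul_fderiv_eq_neg_fderiv_mul_of_integrable, neg_neg]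
  · exact integrable_mul_of_isTest hU hf' hg
  · exact integrable_mul_of_isTest hU hf.continuousOn (hg.pD i)
  · exact integrable_mul_of_isTest hU hf.continuousOn hg
  · exact fun x hx => (hf.contDiffAt (hU.mem_nhds (hg.subset hx))).differentiableAt (by simp)
  · exact fun x _ => hg.smooth.differentiable (by simp) x

theorem integral_pL_mul (hU : IsOpen U) {f : Eu d → ℝ} (hf : ContDiffOn ℝ m f U) :
    ∀ (l : List (Fin d)), l.length ≤ m → ∀ g : Eu d → ℝ, IsTest U g →
      ∫ x in U, pL l f x * g x = (-1) ^ l.length * ∫ x in U, f x * pL l.reverse g x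
  | [], _, g, _ => by simp [pL_nil]
  | i :: l, hl, g, hg => by
    rw [pL_cons, integral_pD_mul hU (contDiffOn_pL hU hf l 1 hl) hg i,
      integral_pL_mul hU hf l (by simp only [List.length_cons] at hl; omega) _ (hg.pD i),
      List.reverse_cons, pL_append, List.length_cons, pow_succ]
    simp only [pL_cons, pL_nil]
    ring

theorem pL_perm_of_smooth {g : Eu d → ℝ} (hg : ContDiff ℝ ∞ g) {l l' : List (Fin d)}
    (h : l.Perm l') : pL l g = pL l' g :=
  funext fun x => pL_perm isOpen_univ (m := l.length)
    (hg.of_le (by exact_mod_cast le_top)).contDiffOn h le_rfl (mem_univ x)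

theorem isWeakDeriv_multiD (hU : IsOpen U) {f : Eu d → ℝ} (hf : ContDiffOn ℝ m f U)
    {α : Fin d → ℕ} (hα : α ∈ multiIdx d m) : IsWeakDeriv U α f (pL (idxList α) f) := by
  intro g hg
  rw [integral_pL_mul hU hf _ (length_idxList_le hα) g hg, length_idxList, multiD_eq_pL,
    pL_perm_of_smooth hg.smooth (List.reverse_perm _)]

theorem IsWeakDeriv.congr {α : Fin d → ℕ} {f f' h h' : Eu d → ℝ} (hw : IsWeakDeriv U α f h)
    (hf : f =ᵐ[volume.restrict U] f') (hh : h =ᵐ[volume.restrict U] h') :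
    IsWeakDeriv U α f' h' := by
  intro g hg
  have e1 : ∫ x in U, h' x * g x = ∫ x in U, h x * g x :=
    integral_congr_ae (hh.symm.mul (EventuallyEq.refl _ g))
  have e2 : ∫ x in U, f' x * multiD α g x = ∫ x in U, f x * multiD α g x :=
    integral_congr_ae (hf.symm.mul (EventuallyEq.refl _ _))
  rw [e1, e2, hw g hg]

end Weak

/-! ### The Sobolev space -/

section SobolevSpace

variable {d m : ℕ} {U : Set (Eu d)}

theorem continuous_integral_mul_test {g : Eu d → ℝ} (h : ContDiff ℝ ∞ g ∧ HasCompactSupport g) :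
    Continuous fun f : Lp ℝ 2 (volume.restrict U) => ∫ x in U, f x * g x := by
  have hg : MemLp g 2 (volume.restrict U) := h.1.continuous.memLp_of_hasCompactSupport h.2
  have : (fun f : Lp ℝ 2 (volume.restrict U) => ∫ x in U, f x * g x) =
      fun f => inner ℝ (hg.toLp g) f := by
    funext f
    rw [L2.inner_def]
    refine integral_congr_ae ?_
    filter_upwards [hg.coeFn_toLp] with x hx
    rw [hx]
    simp
  rw [this]
  exact continuous_const.inner continuous_id

theorem isClosed_sobolevSubmodule :
    IsClosed (X := PiLp 2 fun _ : multiIdx d m => Lp ℝ 2 (volume.restrict U))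
      (SetLike.coe (sobolevSubmodule m U)) := by
  have : SetLike.coe (sobolevSubmodule m U) =
      ⋂ (α : multiIdx d m) (g : Eu d → ℝ) (_ : IsTest U g), {u | ∫ x in U, (u α) x * g x =
        (-1) ^ (∑ i, α.1 i) * ∫ x in U, (u ⟨0, mem_multiIdx.2 (by simp)⟩) x * multiD α g x} := by
    ext u
    simp only [mem_iInter]
    rfl
  rw [this]
  refine isClosed_iInter fun α => isClosed_iInter fun g => isClosed_iInter fun hg => ?_
  refine isClosed_eq ?_ (continuous_const.mul ?_)
  · exact (continuous_integral_mul_test ⟨hg.smooth, hg.compact⟩).comp (PiLp.continuous_apply 2 _ α)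
  · exact (continuous_integral_mul_test (multiD_smooth_compact _ ⟨hg.smooth, hg.compact⟩)).comp
      (PiLp.continuous_apply 2 _ _)

instance : CompleteSpace (Sobolev m U) :=
  isClosed_sobolevSubmodule.completeSpace_coe

instance : SecondCountableTopology (Sobolev m U) := by
  have : Fact ((2 : ℝ≥0∞) ≠ ⊤) := ⟨by simp⟩
  have : SecondCountableTopology (Lp ℝ 2 ((volume : Measure (Eu d)).restrict U)) :=
    Lp.SecondCountableTopology
  have : SecondCountableTopology (PiLp 2 fun _ : multiIdx d m => Lp ℝ 2 (volume.restrict U)) :=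
    (PiLp.homeomorph 2 _).secondCountableTopology
  exact inferInstanceAs (SecondCountableTopology ↥(sobolevSubmodule m U))

/-- The weak derivative `D^α` as a continuous linear map `H^m(U) → L²(U)`. -/
def Sobolev.deriv (α : multiIdx d m) : Sobolev m U →L[ℝ] Lp ℝ 2 (volume.restrict U) :=
  (PiLp.proj 2 (fun _ : multiIdx d m => Lp ℝ 2 (volume.restrict U)) α).comp
    (sobolevSubmodule m U).subtypeL

theorem Sobolev.D_eq {α : Fin d → ℕ} (h : α ∈ multiIdx d m) (u : Sobolev m U) :
    u.D α = Sobolev.deriv ⟨α, h⟩ u := by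
  simp only [Sobolev.D, h, dif_pos]
  rfl

theorem Sobolev.memLp_D {α : Fin d → ℕ} (h : α ∈ multiIdx d m) (u : Sobolev m U) :
    MemLp (u.D α) 2 (volume.restrict U) := by
  rw [Sobolev.D_eq h]; exact Lp.memLp _

theorem Sobolev.norm_sq (u : Sobolev m U) :
    ‖u‖ ^ 2 = ∑ α : multiIdx d m, ‖Sobolev.deriv α u‖ ^ 2 :=
  PiLp.norm_sq_eq_of_L2 _ u.1

theorem Sobolev.isWeakDeriv {α : Fin d → ℕ} (h : α ∈ multiIdx d m) (u : Sobolev m U) :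
    IsWeakDeriv U α (u.D 0) (u.D α) := by
  have h0 : (0 : Fin d → ℕ) ∈ multiIdx d m := mem_multiIdx.2 (by simp)
  rw [Sobolev.D_eq h, Sobolev.D_eq h0]
  exact u.2 ⟨α, h⟩

/-- Weak derivatives of `D^α u` are weak derivatives of `u` of higher order. -/
theorem Sobolev.isWeakDeriv_D_add_single {α : Fin d → ℕ} (hα : α ∈ multiIdx d (m - 1))
    (hm : 1 ≤ m) (u : Sobolev m U) (i : Fin d) :
    IsWeakDeriv U (Pi.single i 1) (u.D α) (u.D (α + Pi.single i 1)) := by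
  intro g hg
  rw [Sobolev.isWeakDeriv (add_single_mem_multiIdx hα hm i) u g hg]
  have e1 : multiD (Pi.single i 1) g = pD i g := by rw [multiD_eq_pL, idxList_single]; rfl
  have e2 : multiD (α + Pi.single i 1) g = multiD α (pD i g) := by
    rw [multiD_eq_pL, multiD_eq_pL, pL_perm_of_smooth hg.smooth
      ((idxList_add_single_perm α i).trans (List.perm_append_singleton i _).symm), pL_append]
    rfl
  rw [e1, e2, Sobolev.isWeakDeriv (multiIdx_mono (Nat.sub_le m 1) hα) u _ (hg.pD i)]
  simp only [Pi.add_apply, Finset.sum_add_distrib, Finset.sum_pi_single', Finset.mem_univ, if_true]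
  rw [pow_add, pow_one, ← mul_assoc, mul_comm ((-1 : ℝ) ^ _)]

section OfSmooth

variable (hU : IsOpen U) (hb : Bornology.IsBounded U)

theorem SmoothUpTo.memLp_pL (hU : IsOpen U) (hb : Bornology.IsBounded U) {F : Type*}
    [NormedAddCommGroup F] [NormedSpace ℝ F] {f : Eu d → F}
    (hf : SmoothUpTo m U f) {α : Fin d → ℕ} (hα : α ∈ multiIdx d m) :
    MemLp (pL (idxList α) f) 2 (volume.restrict U) := by
  obtain ⟨C, _, hC⟩ := hf.exists_bound hb
  have : IsFiniteMeasure (volume.restrict U) := ⟨by simpa using hb.measure_lt_top⟩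
  have hc : ContinuousOn (pL (idxList α) f) U :=
    (contDiffOn_pL hU hf.contDiffOn _ 0 (length_idxList_le hα)).continuousOn
  refine MemLp.of_bound (hc.aestronglyMeasurable hU.measurableSet) C ?_
  filter_upwards [ae_restrict_mem hU.measurableSet] with x hx
  rw [← hf.ext_eq hU (length_idxList_le hα) hx]
  exact hC α hα x (subset_closure hx)

/-- A function which is smooth up to the boundary, as an element of the Sobolev space. -/
def SmoothUpTo.toSobolev {f : Eu d → ℝ} (hf : SmoothUpTo m U f) : Sobolev m U :=
  ⟨WithLp.toLp 2 fun α => (hf.memLp_pL hU hb α.2).toLp _, fun α =>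
    (isWeakDeriv_multiD hU hf.contDiffOn α.2).congr (by
      have h0 : (0 : Fin d → ℕ) ∈ multiIdx d m := mem_multiIdx.2 (by simp)
      have e : pL (idxList 0) f = f := by rw [idxList_zero]; rfl
      exact (EventuallyEq.of_eq e.symm).trans (hf.memLp_pL hU hb h0).coeFn_toLp.symm)
      (hf.memLp_pL hU hb α.2).coeFn_toLp.symm⟩

theorem SmoothUpTo.deriv_toSobolev {f : Eu d → ℝ} (hf : SmoothUpTo m U f) (α : multiIdx d m) :
    Sobolev.deriv α (hf.toSobolev hU hb) = (hf.memLp_pL hU hb α.2).toLp _ := rfl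

theorem SmoothUpTo.D_toSobolev {f : Eu d → ℝ} (hf : SmoothUpTo m U f) {α : Fin d → ℕ}
    (hα : α ∈ multiIdx d m) :
    (hf.toSobolev hU hb).D α =ᵐ[volume.restrict U] pL (idxList α) f := by
  rw [Sobolev.D_eq hα, SmoothUpTo.deriv_toSobolev]
  exact (hf.memLp_pL hU hb hα).coeFn_toLp

theorem Sobolev.ext_deriv {u v : Sobolev m U} (h : ∀ α, Sobolev.deriv α u = Sobolev.deriv α v) :
    u = v := by
  rw [← sub_eq_zero, ← norm_eq_zero, ← sq_eq_zero_iff, Sobolev.norm_sq]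
  exact Finset.sum_eq_zero fun α _ => by rw [map_sub, h α, sub_self]; simp

variable {H : Type*} [NormedAddCommGroup H] [InnerProductSpace ℝ H] {k : Eu d → H}

theorem SmoothUpTo.inner_right (hU : IsOpen U) (hk : SmoothUpTo m U k) (h : H) :
    SmoothUpTo m U fun x => inner ℝ (k x) h := by
  have := hk.clm hU (innerSL ℝ h)
  simpa [real_inner_comm] using this

theorem SmoothUpTo.pL_inner (hU : IsOpen U) (hk : SmoothUpTo m U k) (h : H) {l : List (Fin d)}
    (hl : l.length ≤ m) {x : Eu d} (hx : x ∈ U) :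
    pL l (fun x => inner ℝ (k x) h) x = inner ℝ (pL l k x) h := by
  have := pL_clm hU hk.contDiffOn (innerSL ℝ h) l hl hx
  simpa [real_inner_comm] using this

theorem SmoothUpTo.ext_inner (hU : IsOpen U) (hk : SmoothUpTo m U k) (h : H) {l : List (Fin d)}
    (hl : l.length ≤ m) {x : Eu d} (hx : x ∈ closure U) :
    extendFrom U (pL l (fun x => inner ℝ (k x) h)) x =
      inner ℝ (extendFrom U (pL l k) x) h := by
  have := hk.ext_clm hU (innerSL ℝ h) hl hx
  simpa [real_inner_comm] using this

theorem SmoothUpTo.exists_norm_toSobolev_le (hk : SmoothUpTo m U k) : ∃ C : ℝ, ∀ h : H,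
    ‖(hk.inner_right hU h).toSobolev hU hb‖ ≤ C * ‖h‖ := by
  obtain ⟨C, hC0, hC⟩ := hk.exists_bound hb
  have : IsFiniteMeasure (volume.restrict U) := ⟨by simpa using hb.measure_lt_top⟩
  obtain ⟨A, hA⟩ : ∃ A : ℝ, A = measureUnivNNReal (volume.restrict U) ^ (2 : ℝ≥0∞).toReal⁻¹ * C :=
    ⟨_, rfl⟩
  have hA0 : 0 ≤ A := by rw [hA]; positivity
  refine ⟨√(Fintype.card (multiIdx d m)) * A, fun h => ?_⟩
  have hbd : ∀ α : multiIdx d m,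
      ‖Sobolev.deriv α ((hk.inner_right hU h).toSobolev hU hb)‖ ≤ A * ‖h‖ := by
    intro α
    have hae : ∀ᵐ x ∂(volume.restrict U),
        ‖Sobolev.deriv α ((hk.inner_right hU h).toSobolev hU hb) x‖ ≤ C * ‖h‖ := by
      rw [SmoothUpTo.deriv_toSobolev]
      filter_upwards [((hk.inner_right hU h).memLp_pL hU hb α.2).coeFn_toLp,
        ae_restrict_mem hU.measurableSet] with x hx hxU
      rw [hx, hk.pL_inner hU _ (length_idxList_le α.2) hxU]
      refine (norm_inner_le_norm _ _).trans ?_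
      gcongr
      rw [← hk.ext_eq hU (length_idxList_le α.2) hxU]
      exact hC _ α.2 x (subset_closure hxU)
    refine (Lp.norm_le_of_ae_bound (by positivity) hae).trans_eq ?_
    rw [hA]; ring
  refine le_of_sq_le_sq ?_ (by positivity)
  rw [Sobolev.norm_sq, mul_assoc, mul_pow, Real.sq_sqrt (Nat.cast_nonneg _), ← nsmul_eq_mul,
    ← Finset.card_univ]
  exact Finset.sum_le_card_nsmul _ _ _ fun α _ => pow_le_pow_left₀ (norm_nonneg _) (hbd α) 2

/-- The linear map `h ↦ ⟪k ·, h⟫` from the feature space into the Sobolev space. -/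
def SmoothUpTo.inclₗ (hk : SmoothUpTo m U k) : H →ₗ[ℝ] Sobolev m U where
  toFun h := (hk.inner_right hU h).toSobolev hU hb
  map_add' h h' := by
    refine Sobolev.ext_deriv fun α => ?_
    simp only [map_add, SmoothUpTo.deriv_toSobolev]
    rw [← MemLp.toLp_add, MemLp.toLp_eq_toLp_iff]
    filter_upwards [ae_restrict_mem hU.measurableSet] with x hx
    rw [Pi.add_apply, hk.pL_inner hU _ (length_idxList_le α.2) hx,
      hk.pL_inner hU _ (length_idxList_le α.2) hx, hk.pL_inner hU _ (length_idxList_le α.2) hx,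
      inner_add_right]
  map_smul' c h := by
    refine Sobolev.ext_deriv fun α => ?_
    simp only [map_smul, SmoothUpTo.deriv_toSobolev, RingHom.id_apply]
    rw [← MemLp.toLp_const_smul, MemLp.toLp_eq_toLp_iff]
    filter_upwards [ae_restrict_mem hU.measurableSet] with x hx
    rw [Pi.smul_apply, hk.pL_inner hU _ (length_idxList_le α.2) hx,
      hk.pL_inner hU _ (length_idxList_le α.2) hx, real_inner_smul_right, smul_eq_mul]

/-- The map `h ↦ ⟪k ·, h⟫` as a bounded operator. For the feature map of a reproducing kernel this
is the inclusion of the reproducing kernel Hilbert space into `H^m(U)`. -/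
def SmoothUpTo.incl (hk : SmoothUpTo m U k) : H →L[ℝ] Sobolev m U :=
  (hk.inclₗ hU hb).mkContinuousOfExistsBound (hk.exists_norm_toSobolev_le hU hb)

theorem SmoothUpTo.incl_apply (hk : SmoothUpTo m U k) (h : H) :
    hk.incl hU hb h = (hk.inner_right hU h).toSobolev hU hb := rfl

theorem SmoothUpTo.D_incl (hk : SmoothUpTo m U k) (h : H) {α : Fin d → ℕ}
    (hα : α ∈ multiIdx d m) : (hk.incl hU hb h).D α =ᵐ[volume.restrict U]
      fun x => inner ℝ (pL (idxList α) k x) h := by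
  rw [SmoothUpTo.incl_apply]
  filter_upwards [(hk.inner_right hU h).D_toSobolev hU hb hα,
    ae_restrict_mem hU.measurableSet] with x hx hxU
  rw [hx, hk.pL_inner hU _ (length_idxList_le hα) hxU]

/-- If the features are total, then the inclusion into the Sobolev space is injective. -/
theorem SmoothUpTo.incl_injective (hk : SmoothUpTo m U k)
    (htot : ∀ h : H, (∀ x ∈ U, inner ℝ (k x) h = 0) → h = 0) :
    Function.Injective (hk.incl hU hb) := by
  refine (injective_iff_map_eq_zero _).2 fun h hh => htot h fun x hx => ?_
  have h0 : (0 : Fin d → ℕ) ∈ multiIdx d m := mem_multiIdx.2 (by simp)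
  have hD := hk.D_incl hU hb h h0
  rw [hh, Sobolev.D_eq h0, map_zero, idxList_zero, pL_nil] at hD
  have hae : (fun x => inner ℝ (k x) h) =ᵐ[volume.restrict U] fun _ => (0 : ℝ) :=
    hD.symm.trans (Lp.coeFn_zero ℝ 2 _)
  exact Measure.eqOn_open_of_ae_eq hae hU (hk.inner_right hU h).contDiffOn.continuousOn
    continuousOn_const hx

end OfSmooth

end SobolevSpace

/-! ### Gaussian series in Hilbert spaces -/

section GaussianSeries

/-- Independent standard normal random variables. -/
structure IsStdGaussianSeq {ι Ω : Type*} [MeasurableSpace Ω] (ξ : ι → Ω → ℝ) (P : Measure Ω) :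
    Prop where
  law : ∀ i, HasLaw (ξ i) (gaussianReal 0 1) P
  indep : iIndepFun ξ P

theorem exists_isStdGaussianSeq (ι : Type) : ∃ (Ω : Type) (_ : MeasurableSpace Ω) (P : Measure Ω)
    (_ : IsProbabilityMeasure P) (ξ : ι → Ω → ℝ), IsStdGaussianSeq ξ P := by
  refine ⟨ι → ℝ, inferInstance, Measure.infinitePi fun _ => gaussianReal 0 1, inferInstance,
    fun i o => o i,
    fun i => (measurePreserving_eval_infinitePi (fun _ => gaussianReal 0 1) i).hasLaw, ?_⟩
  exact iIndepFun_infinitePi (X := fun _ o => o) (fun _ => measurable_id)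

variable {ι Ω : Type*} [MeasurableSpace Ω] {P : Measure Ω}
  {ξ : ι → Ω → ℝ} {E : Type*} [NormedAddCommGroup E] [InnerProductSpace ℝ E]

theorem IsStdGaussianSeq.hasGaussianLaw (hξ : IsStdGaussianSeq ξ P) (i : ι) :
    HasGaussianLaw (ξ i) P := (hξ.law i).hasGaussianLaw

theorem integral_mul_eq_inner (X Y : Lp ℝ 2 P) : ∫ o, X o * Y o ∂P = inner ℝ X Y := by
  rw [L2.inner_def]
  refine integral_congr_ae (Eventually.of_forall fun o => ?_)
  simp [mul_comm]

theorem IsStdGaussianSeq.integral_eq_zero (hξ : IsStdGaussianSeq ξ P) (i : ι) :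
    ∫ o, ξ i o ∂P = 0 := by
  rw [(hξ.law i).integral_eq, integral_id_gaussianReal]

theorem IsStdGaussianSeq.memLp (hξ : IsStdGaussianSeq ξ P) (i : ι) (v : E) :
    MemLp (fun o => ξ i o • v) 2 P :=
  (ContinuousLinearMap.toSpanSingleton ℝ v).comp_memLp' (hξ.hasGaussianLaw i).memLp_two

theorem IsStdGaussianSeq.integral_mul (hξ : IsStdGaussianSeq ξ P) [DecidableEq ι] (i j : ι) :
    ∫ o, ξ i o * ξ j o ∂P = if i = j then 1 else 0 := by
  split_ifs with h
  · subst h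
    have hv := (hξ.law i).variance_eq
    rw [variance_id_gaussianReal, variance_of_integral_eq_zero (hξ.law i).aemeasurable
      (hξ.integral_eq_zero i)] at hv
    simpa [sq] using hv
  · have := (hξ.indep.indepFun h).integral_fun_mul_eq_mul_integral
      (hξ.hasGaussianLaw i).memLp_two.aestronglyMeasurable
      (hξ.hasGaussianLaw j).memLp_two.aestronglyMeasurable
    rw [this, hξ.integral_eq_zero i, zero_mul]

theorem IsStdGaussianSeq.inner_toLp (hξ : IsStdGaussianSeq ξ P) [DecidableEq ι] (i j : ι)
    (v w : E) : inner ℝ ((hξ.memLp i v).toLp _) ((hξ.memLp j w).toLp _) =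
      if i = j then inner ℝ v w else 0 := by
  have h : ∫ o, ξ i o * ξ j o * inner ℝ v w ∂P = if i = j then inner ℝ v w else 0 := by
    rw [integral_mul_const, hξ.integral_mul]
    split_ifs <;> simp
  rw [← h, L2.inner_def]
  refine integral_congr_ae ?_
  filter_upwards [(hξ.memLp i v).coeFn_toLp, (hξ.memLp j w).coeFn_toLp] with o h1 h2
  rw [h1, h2, real_inner_smul_left, real_inner_smul_right]
  ring

/-- The isometry `v ↦ ξ_i v` of a Hilbert space `E` into `L²(P; E)`. -/
def IsStdGaussianSeq.term (hξ : IsStdGaussianSeq ξ P) (i : ι) : E →ₗᵢ[ℝ] Lp E 2 P where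
  toFun v := (hξ.memLp i v).toLp _
  map_add' v w := by
    rw [← MemLp.toLp_add, MemLp.toLp_eq_toLp_iff]
    exact Eventually.of_forall fun o => smul_add _ _ _
  map_smul' c v := by
    rw [← MemLp.toLp_const_smul, MemLp.toLp_eq_toLp_iff]
    exact Eventually.of_forall fun o => smul_comm _ _ _
  norm_map' v := by
    classical
    have : ‖(hξ.memLp i v).toLp _‖ ^ 2 = ‖v‖ ^ 2 := by
      rw [← real_inner_self_eq_norm_sq, hξ.inner_toLp, if_pos rfl, real_inner_self_eq_norm_sq]
    exact (sq_eq_sq₀ (norm_nonneg _) (norm_nonneg _)).1 this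

theorem IsStdGaussianSeq.term_apply (hξ : IsStdGaussianSeq ξ P) (i : ι) (v : E) :
    hξ.term i v = (hξ.memLp i v).toLp _ := rfl

theorem IsStdGaussianSeq.orthogonalFamily (hξ : IsStdGaussianSeq ξ P) :
    OrthogonalFamily ℝ (fun _ : ι => E) (fun i => hξ.term (E := E) i) := by
  classical
  intro i j hij v w
  exact (hξ.inner_toLp i j v w).trans (if_neg hij)

variable [CompleteSpace E]

/-- The Gaussian series `∑ ξ_i v_i`, for a square summable family `v` in a Hilbert space. -/
def IsStdGaussianSeq.series (hξ : IsStdGaussianSeq ξ P) : lp (fun _ : ι => E) 2 →ₗᵢ[ℝ] Lp E 2 P :=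
  hξ.orthogonalFamily.linearIsometry

theorem IsStdGaussianSeq.hasSum_series (hξ : IsStdGaussianSeq ξ P) (v : lp (fun _ : ι => E) 2) :
    HasSum (fun i => hξ.term i (v i)) (hξ.series v) :=
  hξ.orthogonalFamily.hasSum_linearIsometry v

/-- Bounded linear maps can be applied to Gaussian series term by term. -/
theorem IsStdGaussianSeq.compLp_series (hξ : IsStdGaussianSeq ξ P) {F : Type*}
    [NormedAddCommGroup F] [InnerProductSpace ℝ F] [CompleteSpace F] (T : E →L[ℝ] F)
    (v : lp (fun _ : ι => E) 2) (w : lp (fun _ : ι => F) 2) (h : ∀ i, T (v i) = w i) :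
    T.compLp (hξ.series v) = hξ.series w := by
  have h1 := (hξ.hasSum_series v).mapL (T.compLpL 2 P)
  have e : (fun i => T.compLpL 2 P (hξ.term i (v i))) = fun i => hξ.term i (w i) := by
    funext i
    refine Lp.ext ?_
    filter_upwards [T.coeFn_compLpL (hξ.term i (v i)), (hξ.memLp i (v i)).coeFn_toLp,
      (hξ.memLp i (w i)).coeFn_toLp] with o h1 h2 h3
    rw [hξ.term_apply] at h1 ⊢
    rw [h1, hξ.term_apply, h3, h2, map_smul, h]
  rw [e] at h1
  exact h1.unique (hξ.hasSum_series w)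

theorem integral_eq_inner_one [IsProbabilityMeasure P] (X : Lp ℝ 2 P) :
    ∫ o, X o ∂P = inner ℝ ((memLp_const (1 : ℝ)).toLp (fun _ : Ω => (1 : ℝ)) : Lp ℝ 2 P) X := by
  rw [L2.inner_def]
  refine integral_congr_ae ?_
  filter_upwards [(memLp_const (p := 2) (μ := P) (1 : ℝ)).coeFn_toLp] with o ho
  rw [ho]; simp

theorem variance_coe_Lp [IsProbabilityMeasure P] (X : Lp ℝ 2 P) :
    Var[X; P] = ‖X‖ ^ 2 - (∫ o, X o ∂P) ^ 2 := by
  rw [variance_eq_sub (Lp.memLp X), ← real_inner_self_eq_norm_sq, ← integral_mul_eq_inner]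
  simp [sq]

/-- Limits of Gaussian random variables in `L²` are Gaussian. -/
theorem isClosed_hasGaussianLaw [IsProbabilityMeasure P] :
    IsClosed {X : Lp ℝ 2 P | HasGaussianLaw X P} := by
  refine IsSeqClosed.isClosed fun X Y hX hlim => ?_
  have hmeas : ∀ Z : Lp ℝ 2 P, AEMeasurable Z P := fun Z => (Lp.aestronglyMeasurable Z).aemeasurable
  have h1 : TendstoInMeasure P (fun n => X n) atTop Y := tendstoInMeasure_of_tendsto_Lp hlim
  have h2 := (h1.tendstoInDistribution fun n => hmeas _).tendsto
  have h3 := ProbabilityMeasure.tendsto_iff_tendsto_charFun.1 h2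
  have hmean : Tendsto (fun n => ∫ o, X n o ∂P) atTop (𝓝 (∫ o, Y o ∂P)) := by
    simp only [integral_eq_inner_one]
    exact tendsto_const_nhds.inner hlim
  have hvar : Tendsto (fun n => Var[X n; P]) atTop (𝓝 Var[Y; P]) := by
    simp only [variance_coe_Lp]
    exact (hlim.norm.pow 2).sub (hmean.pow 2)
  have hm : ∀ (t : ℝ) (Z : Lp ℝ 2 P), ∫ o, (inner ℝ t (Z o) : ℝ) ∂P = t * ∫ o, Z o ∂P := by
    intro t Z
    rw [← integral_const_mul]
    exact integral_congr_ae (Eventually.of_forall fun o => by simp [mul_comm])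
  have hv : ∀ (t : ℝ) (Z : Lp ℝ 2 P),
      Var[fun o => (inner ℝ t (Z o) : ℝ); P] = t ^ 2 * Var[Z; P] := by
    intro t Z
    rw [← variance_const_mul]
    congr 1
    ext o
    simp [mul_comm]
  refine (hasGaussianLaw_iff_charFun_map_eq (hmeas Y)).2 fun t => ?_
  refine tendsto_nhds_unique (h3 t) ?_
  have h4 : ∀ n, charFun (P.map (X n)) t = _ := fun n => (hX n).charFun_map_eq t
  simp only [ProbabilityMeasure.coe_mk]
  simp only [h4, hm, hv]
  refine (Complex.continuous_exp.tendsto _).comp ?_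
  refine Tendsto.sub ?_ ?_
  · exact (Complex.continuous_ofReal.tendsto _ |>.comp (hmean.const_mul t)).mul_const _
  · exact (Complex.continuous_ofReal.tendsto _ |>.comp (hvar.const_mul (t ^ 2))).div_const _

theorem IsStdGaussianSeq.hasGaussianLaw_series [IsProbabilityMeasure P] (hξ : IsStdGaussianSeq ξ P)
    (w : lp (fun _ : ι => ℝ) 2) : HasGaussianLaw (hξ.series w) P := by
  refine isClosed_hasGaussianLaw.mem_of_tendsto (hξ.hasSum_series w) (Eventually.of_forall ?_)
  intro s
  have hs : (∑ i ∈ s, hξ.term i (w i) : Lp ℝ 2 P) =ᵐ[P] fun o => ∑ i : s, ξ i o * w i := by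
    have h1 : ∀ᵐ o ∂P, ∀ i : s, hξ.term (i : ι) (w i) o = ξ i o * w i :=
      ae_all_iff.2 fun i => (hξ.memLp (i : ι) (w i)).coeFn_toLp
    filter_upwards [h1, Lp.coeFn_finsetSum s fun i => hξ.term i (w i)] with o h1 h2
    rw [h2, Finset.sum_apply, ← Finset.sum_coe_sort]
    exact Finset.sum_congr rfl fun i _ => h1 i
  refine HasGaussianLaw.congr ?_ hs.symm
  have hind : iIndepFun (fun i : s => fun o => ξ i o * w i) P :=
    (hξ.indep.precomp Subtype.val_injective).comp (fun (i : s) (x : ℝ) => x * w i)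
      (fun i => by fun_prop)
  refine hind.hasGaussianLaw_fun_sum fun i => ?_
  have := (hξ.hasGaussianLaw i).fun_smul (w i)
  simpa [mul_comm] using this

theorem IsStdGaussianSeq.integral_series [IsProbabilityMeasure P] (hξ : IsStdGaussianSeq ξ P)
    (w : lp (fun _ : ι => ℝ) 2) :
    ∫ o, hξ.series w o ∂P = 0 := by
  rw [integral_eq_inner_one]
  have h := (hξ.hasSum_series w).mapL (innerSL ℝ
    ((memLp_const (1 : ℝ)).toLp (fun _ : Ω => (1 : ℝ)) : Lp ℝ 2 P))
  refine h.unique ?_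
  convert hasSum_zero using 2 with i
  rw [innerSL_apply_apply, ← integral_eq_inner_one, hξ.term_apply,
    integral_congr_ae (hξ.memLp i (w i)).coeFn_toLp]
  simp only [smul_eq_mul]
  rw [integral_mul_const, hξ.integral_eq_zero, zero_mul]

section Isonormal

variable {H : Type*} [NormedAddCommGroup H] [InnerProductSpace ℝ H]

/-- The isonormal Gaussian process `W(h) = ∑ ξ_i ⟪b_i, h⟫` over a Hilbert space with Hilbert
basis `b`. -/
def IsStdGaussianSeq.iso (hξ : IsStdGaussianSeq ξ P) (b : HilbertBasis ι ℝ H) :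
    H →ₗᵢ[ℝ] Lp ℝ 2 P :=
  (hξ.series (E := ℝ)).comp b.repr.toLinearIsometry

theorem IsStdGaussianSeq.hasGaussianLaw_iso [IsProbabilityMeasure P] (hξ : IsStdGaussianSeq ξ P)
    (b : HilbertBasis ι ℝ H) (h : H) : HasGaussianLaw (hξ.iso b h) P := hξ.hasGaussianLaw_series _

theorem IsStdGaussianSeq.integral_iso [IsProbabilityMeasure P] (hξ : IsStdGaussianSeq ξ P)
    (b : HilbertBasis ι ℝ H) (h : H) : ∫ o, hξ.iso b h o ∂P = 0 := hξ.integral_series _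

theorem IsStdGaussianSeq.integral_iso_mul (hξ : IsStdGaussianSeq ξ P) (b : HilbertBasis ι ℝ H)
    (h h' : H) : ∫ o, hξ.iso b h o * hξ.iso b h' o ∂P = inner ℝ h h' := by
  rw [integral_mul_eq_inner, LinearIsometry.inner_map_map]

theorem IsStdGaussianSeq.iso_basis (hξ : IsStdGaussianSeq ξ P) (b : HilbertBasis ι ℝ H)
    (i : ι) : hξ.iso b (b i) =ᵐ[P] ξ i := by
  classical
  have h1 : hξ.iso b (b i) = hξ.term i (1 : ℝ) := by
    change hξ.series (b.repr (b i)) = _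
    rw [b.repr_self]
    exact hξ.orthogonalFamily.linearIsometry_apply_single (1 : ℝ)
  rw [h1, hξ.term_apply]
  filter_upwards [(hξ.memLp i (1 : ℝ)).coeFn_toLp] with o ho
  rw [ho]; simp

/-- A functional of a Gaussian series in `E` is a value of the isonormal process. -/
theorem IsStdGaussianSeq.clm_series (hξ : IsStdGaussianSeq ξ P) (b : HilbertBasis ι ℝ H)
    (v : lp (fun _ : ι => E) 2) (T : E →L[ℝ] ℝ) (h : H) (hT : ∀ i, T (v i) = inner ℝ (b i) h) :
    ∀ᵐ o ∂P, T (hξ.series v o) = hξ.iso b h o := by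
  have h1 : T.compLp (hξ.series v) = hξ.iso b h :=
    hξ.compLp_series T v _ fun i => by
      rw [hT, ← b.repr_apply_apply]; rfl
  rw [← h1]
  filter_upwards [T.coeFn_compLp (hξ.series v)] with o ho
  exact ho.symm

end Isonormal

end GaussianSeries

/-! ### Gaussian measures on Hilbert spaces -/

section GaussianMeasure

/-- The adjoint of an injective operator `J` has dense range. Hence the Gram–Schmidt process,
applied to the image under the adjoint of a dense sequence, gives a Hilbert basis `b_i = J† κ_i`
contained in this range. -/
theorem exists_hilbertBasis_range_adjoint {H E : Type} [NormedAddCommGroup H]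
    [InnerProductSpace ℝ H] [CompleteSpace H] [NormedAddCommGroup E] [InnerProductSpace ℝ E]
    [CompleteSpace E] [SecondCountableTopology E] (J : H →L[ℝ] E) (hJ : Function.Injective J) :
    ∃ (ι : Type) (b : HilbertBasis ι ℝ H) (κ : ι → E),
      ∀ i h, inner ℝ (b i) h = inner ℝ (κ i) (J h) := by
  classical
  set f : ℕ → H := fun n => ContinuousLinearMap.adjoint J (TopologicalSpace.denseSeq E n) with hf
  set g := InnerProductSpace.gramSchmidtNormed ℝ f with hg
  have hspan : Submodule.span ℝ (range g) = Submodule.span ℝ (range f) := by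
    rw [hg, InnerProductSpace.span_gramSchmidtNormed_range, InnerProductSpace.span_gramSchmidt]
  have hort : Orthonormal ℝ fun i : {i | g i ≠ 0} => g i :=
    InnerProductSpace.gramSchmidtNormed_orthonormal' f
  have hrange : ∀ n, ∃ e : E, ContinuousLinearMap.adjoint J e = g n := by
    intro n
    have h1 : g n ∈ Submodule.span ℝ (range f) := hspan ▸ Submodule.subset_span (mem_range_self n)
    have h2 : Submodule.span ℝ (range f) ≤ (ContinuousLinearMap.adjoint J : E →L[ℝ] H).range := by
      rw [Submodule.span_le]
      rintro _ ⟨n, rfl⟩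
      exact ⟨_, rfl⟩
    exact h2 h1
  have hbot : (Submodule.span ℝ (range fun i : {i | g i ≠ 0} => g i))ᗮ = ⊥ := by
    rw [Submodule.eq_bot_iff]
    intro h hh
    have h1 : ∀ n, inner ℝ (f n) h = 0 := by
      have h2 : ∀ n, inner ℝ (g n) h = 0 := by
        intro n
        by_cases hn : g n = 0
        · rw [hn, inner_zero_left]
        · exact (Submodule.mem_orthogonal _ _).1 hh _ (Submodule.subset_span ⟨⟨n, hn⟩, rfl⟩)
      intro n
      have h3 : h ∈ (Submodule.span ℝ (range g))ᗮ := by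
        rw [Submodule.mem_orthogonal]
        intro u hu
        induction hu using Submodule.span_induction with
        | mem x hx => obtain ⟨n, rfl⟩ := hx; exact h2 n
        | zero => exact inner_zero_left _
        | add x y _ _ hx hy => rw [inner_add_left, hx, hy, add_zero]
        | smul c x _ hx => rw [real_inner_smul_left, hx, mul_zero]
      rw [hspan] at h3
      exact (Submodule.mem_orthogonal _ _).1 h3 _ (Submodule.subset_span ⟨n, rfl⟩)
    have h4 : ∀ e : E, inner ℝ e (J h) = 0 := by
      intro e
      have hc : IsClosed {e : E | inner ℝ e (J h) = 0} :=
        isClosed_eq (continuous_id.inner continuous_const) continuous_const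
      have hsub : range (TopologicalSpace.denseSeq E) ⊆ {e : E | inner ℝ e (J h) = 0} := by
        rintro _ ⟨n, rfl⟩
        have := h1 n
        rwa [hf, ContinuousLinearMap.adjoint_inner_left] at this
      exact (closure_minimal hsub hc) ((TopologicalSpace.denseRange_denseSeq E) e)
    have h5 : J h = 0 := inner_self_eq_zero.1 (h4 (J h))
    exact hJ (h5.trans (map_zero J).symm)
  choose e he using hrange
  refine ⟨{i | g i ≠ 0}, HilbertBasis.mkOfOrthogonalEqBot hort hbot, fun i => e i, fun i h => ?_⟩
  rw [HilbertBasis.coe_mkOfOrthogonalEqBot, ← he, ContinuousLinearMap.adjoint_inner_left]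

/-- For a Hilbert–Schmidt injection `J : H → E` and `m ∈ E`, there is a probability measure on `E`
under which the identity is `m + ∑ ξ_i J b_i` for a Hilbert basis `b` of `H`, where the standard
normal variables `ξ_i` are themselves continuous affine functionals of the points of `E`. -/
theorem exists_gaussianMeasure {H E : Type} [NormedAddCommGroup H]
    [InnerProductSpace ℝ H] [CompleteSpace H] [NormedAddCommGroup E] [InnerProductSpace ℝ E]
    [CompleteSpace E] [SecondCountableTopology E] [MeasurableSpace E] [BorelSpace E]
    (J : H →L[ℝ] E) (hJ : Function.Injective J)
    {M : ℝ} (hM : ∀ (ι : Type) (b : ι → H), Orthonormal ℝ b → ∀ s : Finset ι,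
      ∑ i ∈ s, ‖J (b i)‖ ^ 2 ≤ M) (m : E) :
    ∃ (Q : Measure E) (_ : IsProbabilityMeasure Q) (ι : Type) (b : HilbertBasis ι ℝ H)
      (κ : ι → E) (v : lp (fun _ : ι => E) 2)
      (hξ : IsStdGaussianSeq (fun i u => inner ℝ (κ i) (u - m)) Q),
      (∀ i h, inner ℝ (b i) h = inner ℝ (κ i) (J h)) ∧ (∀ i, v i = J (b i)) ∧
      ∀ᵐ u ∂Q, u = m + hξ.series v u := by
  classical
  obtain ⟨ι, b, κ, hκ⟩ := exists_hilbertBasis_range_adjoint J hJ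
  have hv : Memℓp (fun i => J (b i)) 2 := by
    rw [memℓp_gen_iff (by norm_num)]
    have : Summable fun i => ‖J (b i)‖ ^ 2 :=
      summable_of_sum_le (fun i => by positivity) (hM ι b b.orthonormal)
    simpa using this
  set v : lp (fun _ : ι => E) 2 := ⟨fun i => J (b i), hv⟩ with hvdef
  obtain ⟨Ω, _, P, _, ξ, hξ⟩ := exists_isStdGaussianSeq ι
  have hs := Lp.stronglyMeasurable (hξ.series v)
  -- `Q` is the law of `X`, and `⟪κ_i, X - m⟫ = ξ_i` almost surely
  set X : Ω → E := fun o => m + hξ.series v o with hX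
  have hXm : Measurable X := (hs.measurable).const_add m
  set Q := P.map X with hQ
  have hmp : MeasurePreserving X P Q := ⟨hXm, rfl⟩
  have hQp : IsProbabilityMeasure Q := Measure.isProbabilityMeasure_map hXm.aemeasurable
  have hm' : ∀ i, Measurable fun u : E => (inner ℝ (κ i) (u - m) : ℝ) := fun i => by
    have : Continuous fun u : E => (inner ℝ (κ i) (u - m) : ℝ) := by fun_prop
    exact this.measurable
  have hcomp : ∀ i, (fun o => (inner ℝ (κ i) (X o - m) : ℝ)) =ᵐ[P] ξ i := by
    intro i
    have h1 := hξ.clm_series b v (innerSL ℝ (κ i)) (b i) (fun j => by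
      rw [innerSL_apply_apply, hvdef]
      change inner ℝ (κ i) (J (b j)) = _
      rw [← hκ, real_inner_comm])
    filter_upwards [h1, hξ.iso_basis b i] with o h1 h2
    rw [hX]
    simp only [add_sub_cancel_left]
    rw [← h2, ← h1, innerSL_apply_apply]
  have hξ' : IsStdGaussianSeq (fun i u => inner ℝ (κ i) (u - m)) Q := by
    constructor
    · intro i
      refine ⟨(hm' i).aemeasurable, ?_⟩
      rw [hQ, Measure.map_map (hm' i) hXm, ← (hξ.law i).map_eq]
      exact Measure.map_congr (hcomp i)
    · have hind : iIndepFun (fun i o => (inner ℝ (κ i) (X o - m) : ℝ)) P :=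
        hξ.indep.congr fun i => (hcomp i).symm
      rw [iIndepFun_iff_measure_inter_preimage_eq_mul] at hind ⊢
      intro S sets hsets
      have hpre : ∀ i ∈ S, MeasurableSet ((fun u : E => (inner ℝ (κ i) (u - m) : ℝ)) ⁻¹' sets i) :=
        fun i hi => hm' i (hsets i hi)
      rw [hQ, Measure.map_apply hXm (Finset.measurableSet_biInter S hpre)]
      rw [Finset.prod_congr rfl fun i hi => Measure.map_apply hXm (hpre i hi)]
      rw [preimage_iInter₂]
      exact hind S hsets
  refine ⟨Q, hQp, ι, b, κ, v, hξ', hκ, fun i => rfl, ?_⟩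
  -- composition with `X` identifies the series over `Q` with the original series
  let C : Lp E 2 Q →ₗᵢ[ℝ] Lp E 2 P := Lp.compMeasurePreservingₗᵢ ℝ X hmp
  have hCs : C (hξ'.series v) = hξ.series v := by
    have h1 := (hξ'.hasSum_series v).mapL C.toContinuousLinearMap
    refine h1.unique ?_
    convert hξ.hasSum_series v using 2 with i
    refine Lp.ext ?_
    have h2 : C (hξ'.term i (v i)) =ᵐ[P] hξ'.term i (v i) ∘ X :=
      Lp.coeFn_compMeasurePreserving _ hmp
    have h3 := hmp.quasiMeasurePreserving.ae (hξ'.memLp i (v i)).coeFn_toLp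
    filter_upwards [h2, h3, hcomp i, (hξ.memLp i (v i)).coeFn_toLp] with o h2 h3 h4 h5
    refine h2.trans ?_
    rw [hξ.term_apply, h5, ← h4]
    exact h3
  have h6 : ∀ᵐ o ∂P, X o = m + hξ'.series v (X o) := by
    have h2 : C (hξ'.series v) =ᵐ[P] hξ'.series v ∘ X := Lp.coeFn_compMeasurePreserving _ hmp
    rw [hCs] at h2
    filter_upwards [h2] with o ho
    change m + hξ.series v o = _
    rw [ho]
    rfl
  have hmeas : MeasurableSet {u : E | u = m + hξ'.series v u} :=
    measurableSet_eq_fun measurable_id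
      ((Lp.stronglyMeasurable (hξ'.series v)).measurable.const_add m)
  exact (ae_map_iff hXm.aemeasurable hmeas).2 h6

/-! ### Almost sure approximation and Gaussian fields -/

theorem ae_tendsto_zero_of_tsum_lintegral {Ω : Type*} [MeasurableSpace Ω] {P : Measure Ω}
    {g : ℕ → Ω → ℝ≥0∞} (hg : ∀ n, AEMeasurable (g n) P) (h : ∑' n, ∫⁻ o, g n o ∂P ≠ ⊤) :
    ∀ᵐ o ∂P, Tendsto (fun n => g n o) atTop (𝓝 0) := by
  rw [← lintegral_tsum hg] at h
  filter_upwards [ae_lt_top' (AEMeasurable.tsum hg) h] with o ho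
  exact ENNReal.tendsto_atTop_zero_of_tsum_ne_top ho.ne

theorem tsum_ofReal_two_pow_ne_top (C : ℝ≥0∞) (hC : C ≠ ⊤) :
    ∑' n : ℕ, C * (ENNReal.ofReal ((1 / 2) ^ n)) ^ 2 ≠ ⊤ := by
  rw [ENNReal.tsum_mul_left]
  refine ENNReal.mul_ne_top hC ?_
  have : ∀ n : ℕ, (ENNReal.ofReal ((1 / 2) ^ n)) ^ 2 = ENNReal.ofReal ((1 / 4) ^ n) := by
    intro n
    rw [← ENNReal.ofReal_pow (by positivity), ← pow_mul, mul_comm, pow_mul]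
    norm_num
  simp only [this]
  exact (summable_geometric_of_lt_one (by norm_num) (by norm_num)).tsum_ofReal_ne_top

theorem lintegral_enorm_sq_eq {Ω E : Type*} [MeasurableSpace Ω] {P : Measure Ω}
    [NormedAddCommGroup E] (F : Lp E 2 P) :
    ∫⁻ o, ‖F o‖ₑ ^ 2 ∂P = ‖F‖ₑ ^ 2 := by
  have h := eLpNorm_nnreal_pow_eq_lintegral (f := F) (μ := P) (p := 2) (by norm_num)
  rw [Lp.enorm_def]
  simpa using h.symm

/-- Geometrically fast convergence in `L²` implies convergence almost everywhere. -/
theorem ae_tendsto_of_norm_sub_le {Ω E : Type*} [MeasurableSpace Ω] {P : Measure Ω}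
    [NormedAddCommGroup E] {F : ℕ → Lp E 2 P} {G : Lp E 2 P}
    (h : ∀ n, ‖F n - G‖ ≤ (1 / 2) ^ n) : ∀ᵐ o ∂P, Tendsto (fun n => F n o) atTop (𝓝 (G o)) := by
  have h1 : ∀ n, ∫⁻ o, ‖(F n - G : Lp E 2 P) o‖ₑ ^ 2 ∂P
      ≤ 1 * (ENNReal.ofReal ((1 / 2) ^ n)) ^ 2 := by
    intro n
    rw [lintegral_enorm_sq_eq, one_mul]
    gcongr
    rw [← ofReal_norm]
    exact ENNReal.ofReal_le_ofReal (h n)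
  have h2 := ae_tendsto_zero_of_tsum_lintegral
    (fun n => ((Lp.aestronglyMeasurable (F n - G : Lp E 2 P)).enorm).pow_const 2)
    (ne_top_of_le_ne_top (tsum_ofReal_two_pow_ne_top 1 ENNReal.one_ne_top)
      (ENNReal.tsum_le_tsum h1))
  have h3 : ∀ᵐ o ∂P, ∀ n, (F n - G : Lp E 2 P) o = F n o - G o :=
    ae_all_iff.2 fun n => Lp.coeFn_sub _ _
  filter_upwards [h2, h3] with o h2 h3
  rw [tendsto_iff_norm_sub_tendsto_zero]
  have h4 : Tendsto (fun n => (‖F n o - G o‖ₑ ^ 2).toReal) atTop (𝓝 0) := by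
    simp only [h3] at h2
    simpa [Function.comp_def] using (ENNReal.tendsto_toReal (a := 0) (by simp)).comp h2
  have h5 := h4.sqrt
  simpa using h5

variable {Ω : Type*} [MeasurableSpace Ω] {P : Measure Ω} {ι H : Type*} [NormedAddCommGroup H]
  [InnerProductSpace ℝ H] {ξ : ι → Ω → ℝ}

/-- A process of values of an isonormal process is a Gaussian process. -/
theorem IsStdGaussianSeq.isGaussianProcess [IsProbabilityMeasure P] (hξ : IsStdGaussianSeq ξ P)
    (b : HilbertBasis ι ℝ H) {T : Type*} (Z : T → Ω → ℝ) (c : T → ℝ) (h : T → H)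
    (hZ : ∀ t, ∀ᵐ o ∂P, Z t o = c t + hξ.iso b (h t) o) : IsGaussianProcess Z P := by
  classical
  refine ⟨fun I => ?_⟩
  have hm : AEMeasurable (fun o => I.restrict (Z · o)) P := by
    refine aemeasurable_pi_lambda _ fun t => ?_
    have : AEMeasurable (fun o => c t + hξ.iso b (h t) o) P :=
      (Lp.aestronglyMeasurable _).aemeasurable.const_add _
    exact this.congr ((hZ t).mono fun o ho => ho.symm)
  refine ⟨⟨fun L => ?_⟩⟩
  set w : I → ℝ := fun t => L (Pi.single t 1) with hw
  have hL : ∀ y : I → ℝ, L y = ∑ t : I, y t * w t := by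
    intro y
    conv_lhs => rw [← Finset.univ_sum_single y]
    rw [map_sum]
    refine Finset.sum_congr rfl fun t _ => ?_
    rw [hw, ← smul_eq_mul, ← map_smul, ← Pi.single_smul, smul_eq_mul, mul_one]
  set g : H := ∑ t : I, w t • h t with hg
  have hae : (fun o => L (I.restrict (Z · o))) =ᵐ[P]
      fun o => (∑ t : I, c t * w t) + hξ.iso b g o := by
    have h1 : ∀ᵐ o ∂P, ∀ t : I, Z t o = c t + hξ.iso b (h t) o := ae_all_iff.2 fun t => hZ t
    have h2 : hξ.iso b g = ∑ t : I, w t • hξ.iso b (h t) := by simp [hg, map_sum]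
    have h3 : ∀ᵐ o ∂P, ∀ t : I, (w t • hξ.iso b (h t) : Lp ℝ 2 P) o = w t * hξ.iso b (h t) o :=
      ae_all_iff.2 fun t => Lp.coeFn_smul _ _
    filter_upwards [h1, h3, Lp.coeFn_finsetSum Finset.univ fun t : I => w t • hξ.iso b (h t)]
      with o h1 h3 h4
    rw [hL, h2, h4, Finset.sum_apply, ← Finset.sum_add_distrib]
    refine Finset.sum_congr rfl fun t _ => ?_
    rw [h3, Finset.restrict, h1]
    ring
  have hlaw : HasGaussianLaw (fun o => (∑ t : I, c t * w t) + hξ.iso b g o) P := by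
    have h1 := hξ.hasGaussianLaw_iso b g
    have h2 := h1.isGaussian_map
    constructor
    have h3 : P.map (fun o => (∑ t : I, c t * w t) + hξ.iso b g o)
        = (P.map (hξ.iso b g)).map (fun x => (∑ t : I, c t * w t) + x) :=
      (AEMeasurable.map_map_of_aemeasurable (by fun_prop) h1.aemeasurable).symm
    rw [h3]
    infer_instance
  have h5 := hlaw.congr hae.symm
  have h6 := h5.map_eq_gaussianReal
  have hLm : Measurable L := L.continuous.measurable
  have h7 : (P.map fun o => I.restrict (Z · o)).map L
      = P.map (fun o => L (I.restrict (Z · o))) :=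
    AEMeasurable.map_map_of_aemeasurable hLm.aemeasurable hm
  have h8 : ∫ x, L x ∂(P.map fun o => I.restrict (Z · o)) = ∫ o, L (I.restrict (Z · o)) ∂P :=
    integral_map hm L.continuous.aestronglyMeasurable
  have h9 : Var[L; P.map fun o => I.restrict (Z · o)] = Var[fun o => L (I.restrict (Z · o)); P] :=
    variance_map L.continuous.aemeasurable hm
  rw [h7, h8, h9]
  exact h6

theorem IsStdGaussianSeq.isGaussianField [IsProbabilityMeasure P] (hξ : IsStdGaussianSeq ξ P)
    (b : HilbertBasis ι ℝ H) {d : ℕ} {T : Set (Eu d)} {Z : Eu d → Ω → ℝ} {mean : Eu d → ℝ}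
    {C : Eu d → Eu d → ℝ} {h : Eu d → H}
    (hZ : ∀ x ∈ T, ∀ᵐ o ∂P, Z x o = mean x + hξ.iso b (h x) o)
    (hC : ∀ x ∈ T, ∀ y ∈ T, inner ℝ (h x) (h y) = C x y) : IsGaussianField P T Z mean C := by
  have hint : ∀ g : H, Integrable (hξ.iso b g) P := fun g =>
    (Lp.memLp (hξ.iso b g)).integrable (by norm_num)
  have hmean : ∀ x ∈ T, ∫ o, Z x o ∂P = mean x := by
    intro x hx
    rw [integral_congr_ae (hZ x hx), integral_add (integrable_const _) (hint _), hξ.integral_iso]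
    simp
  refine ⟨hξ.isGaussianProcess b _ (fun t : T => mean t) (fun t : T => h t) fun t => hZ t t.2,
    hmean, fun x hx y hy => ?_⟩
  rw [covariance, hmean x hx, hmean y hy, ← hC x hx y hy, ← hξ.integral_iso_mul b]
  refine integral_congr_ae ?_
  filter_upwards [hZ x hx, hZ y hy] with o h1 h2
  rw [h1, h2]
  ring

/-- On a compact set, the partial sums of the expansion in a Hilbert basis converge uniformly. -/
theorem eventually_norm_sub_sum_le (b : HilbertBasis ι ℝ H) {S : Set H} (hS : IsCompact S)
    {ε : ℝ} (hε : 0 < ε) :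
    ∀ᶠ s : Finset ι in atTop, ∀ h ∈ S, ‖h - ∑ i ∈ s, (inner ℝ (b i) h : ℝ) • b i‖ ≤ ε := by
  classical
  obtain ⟨t, ht, htf, hcov⟩ := hS.finite_cover_balls (e := ε / 2) (by positivity)
  have h1 : ∀ᶠ s : Finset ι in atTop, ∀ h ∈ t,
      ‖h - ∑ i ∈ s, (inner ℝ (b i) h : ℝ) • b i‖ < ε / 2 := by
    rw [eventually_all_finite htf]
    intro h _
    have h2 := b.hasSum_repr h
    simp only [b.repr_apply_apply] at h2
    have h3 := (tendsto_iff_norm_sub_tendsto_zero.1 h2).eventually (gt_mem_nhds (half_pos hε))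
    filter_upwards [h3] with s hs
    rwa [norm_sub_rev]
  filter_upwards [h1] with s hs h hh
  obtain ⟨g, hg, hgh⟩ := mem_iUnion₂.1 (hcov hh)
  -- the complementary projection is a contraction
  have hc : ∀ x : H, ‖x - ∑ i ∈ s, (inner ℝ (b i) x : ℝ) • b i‖ ≤ ‖x‖ := by
    intro x
    have h3 : inner ℝ (x - ∑ i ∈ s, (inner ℝ (b i) x : ℝ) • b i)
        (∑ i ∈ s, (inner ℝ (b i) x : ℝ) • b i) = 0 := by
      rw [inner_sub_left, b.orthonormal.inner_sum]
      simp only [inner_sum, real_inner_smul_right, real_inner_comm]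
      simp
    have h4 := norm_add_sq_eq_norm_sq_add_norm_sq_of_inner_eq_zero _ _ h3
    rw [sub_add_cancel] at h4
    nlinarith [norm_nonneg (x - ∑ i ∈ s, (inner ℝ (b i) x : ℝ) • b i), norm_nonneg x,
      norm_nonneg (∑ i ∈ s, (inner ℝ (b i) x : ℝ) • b i)]
  have h5 : h - ∑ i ∈ s, (inner ℝ (b i) h : ℝ) • b i
      = ((h - g) - ∑ i ∈ s, (inner ℝ (b i) (h - g) : ℝ) • b i)
        + (g - ∑ i ∈ s, (inner ℝ (b i) g : ℝ) • b i) := by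
    simp only [inner_sub_right, sub_smul, Finset.sum_sub_distrib]
    abel
  rw [h5]
  refine (norm_add_le _ _).trans ?_
  have h6 : ‖h - g‖ < ε / 2 := by rwa [Metric.mem_ball, dist_eq_norm] at hgh
  linarith [hc (h - g), hs g hg]

/-- Finite sets of indices along which a given Gaussian series converges almost surely, and along
which the expansions in the Hilbert basis converge uniformly on a compact set. -/
theorem IsStdGaussianSeq.exists_finset_seq {E : Type*} [NormedAddCommGroup E]
    [InnerProductSpace ℝ E] [CompleteSpace E] (hξ : IsStdGaussianSeq ξ P) (b : HilbertBasis ι ℝ H)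
    {S : Set H} (hS : IsCompact S) (v : lp (fun _ : ι => E) 2) :
    ∃ s : ℕ → Finset ι,
      (∀ j, ∀ h ∈ S, ‖h - ∑ i ∈ s j, (inner ℝ (b i) h : ℝ) • b i‖ ≤ (1 / 2) ^ j) ∧
      ∀ᵐ o ∂P, Tendsto (fun j => ∑ i ∈ s j, ξ i o • v i) atTop (𝓝 (hξ.series v o)) := by
  have h1 : ∀ j : ℕ, ∀ᶠ s : Finset ι in atTop,
      ‖∑ i ∈ s, hξ.term i (v i) - hξ.series v‖ < (1 / 2) ^ j := fun j =>
    (tendsto_iff_norm_sub_tendsto_zero.1 (hξ.hasSum_series v)).eventually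
      (gt_mem_nhds (by positivity))
  choose s hs using fun j : ℕ =>
    ((eventually_norm_sub_sum_le b hS (ε := (1 / 2) ^ j) (by positivity)).and (h1 j)).exists
  refine ⟨s, fun j => (hs j).1, ?_⟩
  have h2 := ae_tendsto_of_norm_sub_le fun j => (hs j).2.le
  have h3 : ∀ᵐ o ∂P, ∀ j,
      (∑ i ∈ s j, hξ.term i (v i) : Lp E 2 P) o = ∑ i ∈ s j, ξ i o • v i := by
    refine ae_all_iff.2 fun j => ?_
    have h4 : ∀ᵐ o ∂P, ∀ i : s j, hξ.term (i : ι) (v i) o = ξ i o • v i :=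
      ae_all_iff.2 fun i => (hξ.memLp (i : ι) (v i)).coeFn_toLp
    filter_upwards [h4, Lp.coeFn_finsetSum (s j) fun i => hξ.term i (v i)] with o h4 h5
    rw [h5, Finset.sum_apply]
    exact Finset.sum_congr rfl fun i hi => h4 ⟨i, hi⟩
  filter_upwards [h2, h3] with o h2 h3
  simpa only [h3] using h2

theorem IsStdGaussianSeq.lintegral_sum_sub_iso (hξ : IsStdGaussianSeq ξ P)
    (b : HilbertBasis ι ℝ H) (s : Finset ι) (h : H) :
    ∫⁻ o, ‖∑ i ∈ s, ξ i o * (inner ℝ (b i) h : ℝ) - hξ.iso b h o‖ₑ ^ 2 ∂P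
      = ‖h - ∑ i ∈ s, (inner ℝ (b i) h : ℝ) • b i‖ₑ ^ 2 := by
  have h1 : ‖h - ∑ i ∈ s, (inner ℝ (b i) h : ℝ) • b i‖ₑ
      = ‖∑ i ∈ s, (inner ℝ (b i) h : ℝ) • hξ.iso b (b i) - hξ.iso b h‖ₑ := by
    have : ∑ i ∈ s, (inner ℝ (b i) h : ℝ) • hξ.iso b (b i) - hξ.iso b h
        = hξ.iso b (∑ i ∈ s, (inner ℝ (b i) h : ℝ) • b i - h) := by
      simp [map_sum]
    rw [this, LinearIsometry.enorm_map, ← neg_sub, enorm_neg]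
  rw [h1, ← lintegral_enorm_sq_eq]
  refine lintegral_congr_ae ?_
  have h3 : ∀ᵐ o ∂P, ∀ i : s, ((inner ℝ (b i) h : ℝ) • hξ.iso b (b i) : Lp ℝ 2 P) o
      = ξ i o * (inner ℝ (b i) h : ℝ) := by
    refine ae_all_iff.2 fun i => ?_
    filter_upwards [Lp.coeFn_smul (inner ℝ (b i) h : ℝ) (hξ.iso b (b i)), hξ.iso_basis b i]
      with o h4 h5
    rw [h4, Pi.smul_apply, h5, smul_eq_mul, mul_comm]
  filter_upwards [h3, Lp.coeFn_sub (∑ i ∈ s, (inner ℝ (b i) h : ℝ) • hξ.iso b (b i)) (hξ.iso b h),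
    Lp.coeFn_finsetSum s fun i => (inner ℝ (b i) h : ℝ) • hξ.iso b (b i)] with o h3 h4 h5
  rw [h4, Pi.sub_apply, h5, Finset.sum_apply]
  congr 3
  exact Finset.sum_congr rfl fun i hi => (h3 ⟨i, hi⟩).symm

end GaussianMeasure

/-! ### Means of weak derivatives over small balls -/

section Means

variable {d m : ℕ} {U : Set (Eu d)}

theorem isFiniteMeasure_restrict (hb : Bornology.IsBounded U) :
    IsFiniteMeasure ((volume : Measure (Eu d)).restrict U) := ⟨by simpa using hb.measure_lt_top⟩

theorem volume_ball_inter_ne_top (x : Eu d) (r : ℝ) : volume (Metric.ball x r ∩ U) ≠ ⊤ :=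
  ne_top_of_le_ne_top measure_ball_lt_top.ne (measure_mono inter_subset_left)

theorem volume_ball_inter_ne_zero (hU : IsOpen U) {x : Eu d} (hx : x ∈ closure U) {r : ℝ}
    (hr : 0 < r) : volume (Metric.ball x r ∩ U) ≠ 0 :=
  ((Metric.isOpen_ball.inter hU).measure_pos volume
    (mem_closure_iff.1 hx _ Metric.isOpen_ball (Metric.mem_ball_self hr))).ne'

theorem integrableOn_ball_inter {F : Type*} [NormedAddCommGroup F] (hb : Bornology.IsBounded U)
    {f : Eu d → F} (hf : MemLp f 2 (volume.restrict U)) (x : Eu d) (r : ℝ) :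
    IntegrableOn f (Metric.ball x r ∩ U) := by
  have := isFiniteMeasure_restrict hb
  have h : IntegrableOn f U := hf.integrable (by norm_num)
  exact h.mono_set inter_subset_right

/-- The mean of the weak derivative `D^α u` over `B(x, r) ∩ U`. -/
def Sobolev.mean (u : Sobolev m U) (α : Fin d → ℕ) (x : Eu d) (r : ℝ) : ℝ :=
  ⨍ y in Metric.ball x r ∩ U, u.D α y

/-- `Sobolev.mean` as a continuous linear functional. -/
def Sobolev.meanL (m : ℕ) (U : Set (Eu d)) (α : multiIdx d m) (x : Eu d) (r : ℝ) :
    Sobolev m U →L[ℝ] ℝ :=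
  (volume.real (Metric.ball x r ∩ U))⁻¹ •
    (innerSL ℝ (indicatorConstLp 2 (measurableSet_ball (x := x) (ε := r))
      (ne_top_of_le_ne_top measure_ball_lt_top.ne (Measure.restrict_apply_le U _)) (1 : ℝ))).comp
      (Sobolev.deriv α)

theorem Sobolev.mean_eq {α : Fin d → ℕ} (h : α ∈ multiIdx d m) (u : Sobolev m U) (x : Eu d)
    (r : ℝ) : u.mean α x r = Sobolev.meanL m U ⟨α, h⟩ x r u := by
  rw [Sobolev.mean, Sobolev.meanL, setAverage_eq, smul_apply,
    ContinuousLinearMap.comp_apply, innerSL_apply_apply, L2.inner_indicatorConstLp_one,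
    Measure.restrict_restrict measurableSet_ball, Sobolev.D_eq h]

theorem Sobolev.continuous_mean {α : Fin d → ℕ} (h : α ∈ multiIdx d m) (x : Eu d) (r : ℝ) :
    Continuous fun u : Sobolev m U => u.mean α x r := by
  simp only [Sobolev.mean_eq h]
  exact (Sobolev.meanL m U ⟨α, h⟩ x r).continuous

theorem Sobolev.measurable_mean_left (hU : IsOpen U) {α : Fin d → ℕ} (h : α ∈ multiIdx d m)
    (u : Sobolev m U) (r : ℝ) : Measurable fun x => u.mean α x r := by
  have hS : MeasurableSet {p : Eu d × Eu d | p.2 ∈ Metric.ball p.1 r ∩ U} :=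
    (isOpen_lt (by fun_prop : Continuous fun p : Eu d × Eu d => dist p.2 p.1)
      continuous_const).measurableSet.inter (measurable_snd hU.measurableSet)
  have hg : StronglyMeasurable (u.D α) := by
    rw [Sobolev.D_eq h]; exact Lp.stronglyMeasurable _
  have h1 : StronglyMeasurable fun p : Eu d × Eu d =>
      {p : Eu d × Eu d | p.2 ∈ Metric.ball p.1 r ∩ U}.indicator (fun p => u.D α p.2) p :=
    (hg.comp_measurable measurable_snd).indicator hS
  have h2 := (h1.integral_prod_right' (ν := volume)).measurable
  have h3 : Measurable fun x : Eu d => volume.real (Metric.ball x r ∩ U) :=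
    (measurable_measure_prodMk_left (ν := (volume : Measure (Eu d))) hS).ennreal_toReal
  have h4 : (fun x => u.mean α x r) = fun x => (volume.real (Metric.ball x r ∩ U))⁻¹ *
      ∫ y, {p : Eu d × Eu d | p.2 ∈ Metric.ball p.1 r ∩ U}.indicator
        (fun p => u.D α p.2) (x, y) := by
    funext x
    rw [Sobolev.mean, setAverage_eq, smul_eq_mul,
      ← integral_indicator (measurableSet_ball.inter hU.measurableSet)]
    rfl
  rw [h4]
  exact h3.inv.mul h2

theorem measurable_swap_of_continuous {α β : Type*} [MeasurableSpace α] [TopologicalSpace β]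
    [TopologicalSpace.MetrizableSpace β] [MeasurableSpace β] [SecondCountableTopology β]
    [OpensMeasurableSpace β] {f : β → α → ℝ} (hc : ∀ a, Continuous fun b => f b a)
    (hm : ∀ b, Measurable (f b)) : Measurable fun p : α × β => f p.2 p.1 :=
  (measurable_uncurry_of_continuous_of_measurable hc hm).comp measurable_swap

theorem Sobolev.measurable_mean (hU : IsOpen U) {α : Fin d → ℕ} (h : α ∈ multiIdx d m) (r : ℝ) :
    Measurable fun p : Eu d × Sobolev m U => p.2.mean α p.1 r := by
  have h1 : ∀ x : Eu d, Continuous fun u : Sobolev m U => u.mean α x r :=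
    fun x => Sobolev.continuous_mean h x r
  have h2 : ∀ u : Sobolev m U, Measurable fun x => u.mean α x r :=
    fun u => Sobolev.measurable_mean_left hU h u r
  exact measurable_swap_of_continuous (f := fun (u : Sobolev m U) x => u.mean α x r) h1 h2

/-- The means of `∑ a_α(x) D^α u` around `x` are the corresponding combinations of means. -/
theorem setAverage_frozenOp (hb : Bornology.IsBounded U) {k : ℕ} (hk : k ≤ m)
    (a : (Fin d → ℕ) → Eu d → ℝ) (u : Sobolev m U) (x : Eu d) (r : ℝ) :
    ⨍ y in Metric.ball x r ∩ U, frozenOp k a u x y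
      = ∑ α ∈ multiIdx d k, a α x * u.mean α x r := by
  simp only [frozenOp, Sobolev.mean, setAverage_eq]
  rw [integral_finsetSum _ fun _ hα => (integrableOn_ball_inter hb
    (Sobolev.memLp_D (multiIdx_mono hk hα) u) x r).const_mul _, Finset.smul_sum]
  refine Finset.sum_congr rfl fun α _ => ?_
  rw [integral_const_mul, smul_eq_mul, smul_eq_mul]
  ring

theorem integrableOn_frozenOp (hb : Bornology.IsBounded U) {k : ℕ} (hk : k ≤ m)
    (a : (Fin d → ℕ) → Eu d → ℝ) (u : Sobolev m U) (x z : Eu d) (r : ℝ) :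
    IntegrableOn (frozenOp k a u x) (Metric.ball z r ∩ U) :=
  integrable_finsetSum _ fun _ hα => (integrableOn_ball_inter hb
    (Sobolev.memLp_D (multiIdx_mono hk hα) u) z r).const_mul _

/-- At a Lebesgue point, the means converge to the value. -/
theorem HasValueAt.tendsto_setAverage (hU : IsOpen U) {f : Eu d → ℝ} {x : Eu d}
    (hx : x ∈ closure U) {v : ℝ} (hf : ∀ r, IntegrableOn f (Metric.ball x r ∩ U))
    (h : HasValueAt U f x v) :
    Tendsto (fun r => ⨍ y in Metric.ball x r ∩ U, f y) (𝓝[>] 0) (𝓝 v) := by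
  rw [tendsto_iff_norm_sub_tendsto_zero]
  refine squeeze_zero' (Eventually.of_forall fun _ => norm_nonneg _) ?_ h
  filter_upwards [self_mem_nhdsWithin] with r hr
  have h0 := volume_ball_inter_ne_zero hU hx hr
  have ht := volume_ball_inter_ne_top (U := U) x r
  have hc : v = ⨍ _ in Metric.ball x r ∩ U, v ∂(volume : Measure (Eu d)) :=
    (setAverage_const h0 ht v).symm
  have hi : IntegrableOn (fun _ : Eu d => v) (Metric.ball x r ∩ U) :=
    integrableOn_const ht
  calc ‖(⨍ y in Metric.ball x r ∩ U, f y) - v‖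
      = ‖⨍ y in Metric.ball x r ∩ U, (f y - v)‖ := by
        conv_lhs => rw [hc]
        simp only [setAverage_eq]
        rw [integral_sub (hf r) hi, smul_sub]
    _ ≤ ⨍ y in Metric.ball x r ∩ U, |f y - v| := by
        simp only [setAverage_eq, smul_eq_mul]
        rw [norm_mul, Real.norm_of_nonneg (by positivity)]
        gcongr
        exact norm_integral_le_integral_norm _

/-- The means of the derivatives of a function which is smooth up to the boundary converge
uniformly. -/
theorem SmoothUpTo.eventually_setAverage_le {F : Type*} [NormedAddCommGroup F] [NormedSpace ℝ F]
    [CompleteSpace F] (hU : IsOpen U) (hb : Bornology.IsBounded U) {f : Eu d → F}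
    (hf : SmoothUpTo m U f) {α : Fin d → ℕ} (hα : α ∈ multiIdx d m) {ε : ℝ} (hε : 0 < ε) :
    ∀ᶠ r in 𝓝[>] (0 : ℝ), ∀ x ∈ closure U,
      ‖(⨍ y in Metric.ball x r ∩ U, pL (idxList α) f y) - extendFrom U (pL (idxList α) f) x‖
        ≤ ε := by
  have hl := length_idxList_le hα
  have hcomp : IsCompact (closure U) := hb.isCompact_closure
  have huc := hcomp.uniformContinuousOn_of_continuous (hf.continuousOn_ext hl)
  obtain ⟨δ, hδ, hδ'⟩ := Metric.uniformContinuousOn_iff_le.1 huc ε hε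
  filter_upwards [Ioc_mem_nhdsGT hδ] with r hr x hx
  rw [← dist_eq_norm, ← Metric.mem_closedBall]
  refine (convex_closedBall _ _).set_average_mem Metric.isClosed_closedBall
    (volume_ball_inter_ne_zero hU hx hr.1) (volume_ball_inter_ne_top x r) ?_
    (integrableOn_ball_inter hb (hf.memLp_pL hU hb hα) x r)
  filter_upwards [ae_restrict_mem (measurableSet_ball.inter hU.measurableSet)] with y hy
  rw [← hf.ext_eq hU hl hy.2]
  exact hδ' y (subset_closure hy.2) x hx ((Metric.mem_ball.1 hy.1).le.trans hr.2)

theorem SmoothUpTo.tendsto_setAverage {F : Type*} [NormedAddCommGroup F] [NormedSpace ℝ F]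
    [CompleteSpace F] (hU : IsOpen U) (hb : Bornology.IsBounded U) {f : Eu d → F}
    (hf : SmoothUpTo m U f) {α : Fin d → ℕ} (hα : α ∈ multiIdx d m) {x : Eu d}
    (hx : x ∈ closure U) :
    Tendsto (fun r => ⨍ y in Metric.ball x r ∩ U, pL (idxList α) f y) (𝓝[>] (0 : ℝ))
      (𝓝 (extendFrom U (pL (idxList α) f) x)) := by
  rw [tendsto_iff_norm_sub_tendsto_zero, Metric.tendsto_nhds]
  intro ε hε
  filter_upwards [hf.eventually_setAverage_le hU hb hα (half_pos hε)] with r hr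
  rw [Real.dist_0_eq_abs, abs_norm]
  exact (hr x hx).trans_lt (half_lt_self hε)

theorem SmoothUpTo.mean_toSobolev (hU : IsOpen U) (hb : Bornology.IsBounded U) {f : Eu d → ℝ}
    (hf : SmoothUpTo m U f) {α : Fin d → ℕ} (hα : α ∈ multiIdx d m) (x : Eu d) (r : ℝ) :
    (hf.toSobolev hU hb).mean α x r = ⨍ y in Metric.ball x r ∩ U, pL (idxList α) f y := by
  rw [Sobolev.mean, setAverage_eq, setAverage_eq]
  congr 1
  exact integral_congr_ae (ae_restrict_of_ae_restrict_of_subset inter_subset_right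
    (hf.D_toSobolev hU hb hα))

theorem SmoothUpTo.mean_incl {H : Type*} [NormedAddCommGroup H] [InnerProductSpace ℝ H]
    [CompleteSpace H] {k : Eu d → H} (hU : IsOpen U) (hb : Bornology.IsBounded U)
    (hk : SmoothUpTo m U k) {α : Fin d → ℕ} (hα : α ∈ multiIdx d m) (x : Eu d) (r : ℝ) (h : H) :
    (hk.incl hU hb h).mean α x r
      = inner ℝ (⨍ y in Metric.ball x r ∩ U, pL (idxList α) k y) h := by
  rw [Sobolev.mean, setAverage_eq, setAverage_eq, real_inner_smul_left, smul_eq_mul,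
    real_inner_comm, ← integral_inner (integrableOn_ball_inter hb (hk.memLp_pL hU hb hα) x r)]
  congr 1
  refine integral_congr_ae (ae_restrict_of_ae_restrict_of_subset inter_subset_right ?_)
  filter_upwards [hk.D_incl hU hb h hα] with y hy
  rw [hy, real_inner_comm]

/-- Lebesgue differentiation for the weak derivatives. -/
theorem Sobolev.ae_tendsto_mean (hU : IsOpen U) (hb : Bornology.IsBounded U) (u : Sobolev m U)
    {α : Fin d → ℕ} (hα : α ∈ multiIdx d m) :
    ∀ᵐ x ∂(volume.restrict U), Tendsto (fun r => u.mean α x r) (𝓝[>] 0) (𝓝 (u.D α x)) := by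
  have := isFiniteMeasure_restrict hb
  have hint : IntegrableOn (u.D α) U := (Sobolev.memLp_D hα u).integrable (by norm_num)
  have hint' : Integrable (U.indicator (u.D α)) := hint.integrable_indicator hU.measurableSet
  have h1 := (Besicovitch.vitaliFamily (volume : Measure (Eu d))).ae_tendsto_average
    hint'.locallyIntegrable
  filter_upwards [ae_restrict_of_ae h1, ae_restrict_mem hU.measurableSet] with x hx hxU
  have h2 := hx.comp (Besicovitch.tendsto_filterAt volume x)
  rw [indicator_of_mem hxU] at h2
  refine h2.congr' ?_
  obtain ⟨δ, hδ, hδU⟩ := Metric.isOpen_iff.1 hU x hxU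
  filter_upwards [Ioo_mem_nhdsGT hδ] with r hr
  have hsub : Metric.ball x r ⊆ U := (Metric.ball_subset_ball hr.2.le).trans hδU
  rw [Function.comp_apply, Sobolev.mean, inter_eq_self_of_subset_left hsub]
  have h3 : Metric.closedBall x r =ᵐ[volume] Metric.ball x r := by
    refine (ae_eq_of_subset_of_measure_ge Metric.ball_subset_closedBall ?_
      measurableSet_ball.nullMeasurableSet measure_closedBall_lt_top.ne).symm
    rw [← Metric.ball_union_sphere]
    refine (measure_union_le _ _).trans_eq ?_
    rw [Measure.addHaar_sphere_of_ne_zero volume x hr.1.ne', add_zero]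
  rw [setAverage_congr h3]
  exact setAverage_congr_fun measurableSet_ball
    (Eventually.of_forall fun y hy => indicator_of_mem (hsub hy) _)

end Means

/-! ### Pointwise values of a Gaussian random element of the Sobolev space -/

section PointValues

variable {d m : ℕ} {U : Set (Eu d)}

/-- The limit of the means of `∑_{|α| ≤ k} a_α(x) D^α u` over the balls of radius `r n` around `x`;
if the limit does not exist, this is an unspecified number. -/
def pointVal (r : ℕ → ℝ) (k : ℕ) (a : (Fin d → ℕ) → Eu d → ℝ) (x : Eu d) (u : Sobolev m U) : ℝ :=
  limUnder atTop fun n => ∑ α ∈ multiIdx d k, a α x * u.mean α x (r n)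

theorem pointVal_eq {r : ℕ → ℝ} {k : ℕ} {a : (Fin d → ℕ) → Eu d → ℝ} {x : Eu d}
    {u : Sobolev m U} {y : (Fin d → ℕ) → ℝ}
    (h : ∀ α ∈ multiIdx d k, Tendsto (fun n => u.mean α x (r n)) atTop (𝓝 (y α))) :
    pointVal r k a x u = ∑ α ∈ multiIdx d k, a α x * y α :=
  (tendsto_finsetSum _ fun α hα => (h α hα).const_mul (a α x)).limUnder_eq

theorem measurable_pointVal (r : ℕ → ℝ) {k : ℕ} (hk : k ≤ m) (a : (Fin d → ℕ) → Eu d → ℝ)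
    (x : Eu d) : Measurable fun u : Sobolev m U => pointVal r k a x u := by
  refine (StronglyMeasurable.limUnder fun n => ?_).measurable
  refine (continuous_finsetSum _ fun α hα => ?_).stronglyMeasurable
  exact continuous_const.mul (Sobolev.continuous_mean (multiIdx_mono hk hα) x (r n))

theorem pointVal_eq_of_hasValueAt (hU : IsOpen U) (hb : Bornology.IsBounded U) {r : ℕ → ℝ}
    (hr : Tendsto r atTop (𝓝[>] 0)) {k : ℕ} (hk : k ≤ m) {a : (Fin d → ℕ) → Eu d → ℝ} {x : Eu d}
    (hx : x ∈ closure U) {u : Sobolev m U} {v : ℝ} (h : HasValueAt U (frozenOp k a u x) x v) :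
    pointVal r k a x u = v := by
  have h1 := (h.tendsto_setAverage hU hx (integrableOn_frozenOp hb hk a u x x)).comp hr
  refine Tendsto.limUnder_eq (h1.congr fun n => ?_)
  exact setAverage_frozenOp hb hk a u x (r n)

theorem ae_pointVal_eq (hU : IsOpen U) (hb : Bornology.IsBounded U) {r : ℕ → ℝ}
    (hr : Tendsto r atTop (𝓝[>] 0)) {k : ℕ} (hk : k ≤ m) (a : (Fin d → ℕ) → Eu d → ℝ)
    (u : Sobolev m U) :
    ∀ᵐ x ∂(volume.restrict U), pointVal r k a x u = ∑ α ∈ multiIdx d k, a α x * u.D α x := by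
  have h : ∀ᵐ x ∂(volume.restrict U), ∀ α ∈ multiIdx d k,
      Tendsto (fun r => u.mean α x r) (𝓝[>] 0) (𝓝 (u.D α x)) :=
    (eventually_all_finset _).2 fun α hα => u.ae_tendsto_mean hU hb (multiIdx_mono hk hα)
  filter_upwards [h] with x hx
  exact pointVal_eq fun α hα => (hx α hα).comp hr

theorem coeFn_map_sum_smul {Ω H : Type*} [MeasurableSpace Ω] {Q : Measure Ω}
    [NormedAddCommGroup H] [InnerProductSpace ℝ H] (W : H →ₗᵢ[ℝ] Lp ℝ 2 Q)
    {κ : Type*} (s : Finset κ) (c : κ → ℝ)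
    (g : κ → H) : ∀ᵐ u ∂Q, W (∑ i ∈ s, c i • g i) u = ∑ i ∈ s, c i * W (g i) u := by
  have h1 : ∀ᵐ u ∂Q, ∀ i : s, (c i • W (g i) : Lp ℝ 2 Q) u = c i * W (g i) u :=
    ae_all_iff.2 fun i => Lp.coeFn_smul _ _
  filter_upwards [h1, Lp.coeFn_finsetSum s fun i => c i • W (g i)] with u h1 h2
  rw [map_sum, Finset.sum_congr rfl fun i _ => map_smul W (c i) (g i), h2, Finset.sum_apply]
  exact Finset.sum_congr rfl fun i hi => h1 ⟨i, hi⟩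

variable {H : Type*} [NormedAddCommGroup H] [InnerProductSpace ℝ H] [CompleteSpace H]
  {k : Eu d → H} {μ : Eu d → ℝ} {Q : Measure (Sobolev m U)}

/-- The functionals of a random element of `H^m(U)`, of law `Q`, are given by the function `μ` and
an isometry `W : H → L²(Q)`: if the functional `T` is `⟪g, ·⟫` on the feature space, then
`T = T μ + W g` almost surely. -/
def HasFunctionals (hU : IsOpen U) (hb : Bornology.IsBounded U) (hk : SmoothUpTo m U k)
    (hμ : SmoothUpTo m U μ) (Q : Measure (Sobolev m U)) (W : H →ₗᵢ[ℝ] Lp ℝ 2 Q) : Prop :=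
  ∀ (T : Sobolev m U →L[ℝ] ℝ) (g : H), (∀ h, T (hk.incl hU hb h) = inner ℝ g h) →
    ∀ᵐ u ∂Q, T u = T (hμ.toSobolev hU hb) + W g u

variable {hU : IsOpen U} {hb : Bornology.IsBounded U} {hk : SmoothUpTo m U k}
  {hμ : SmoothUpTo m U μ} {W : H →ₗᵢ[ℝ] Lp ℝ 2 Q}

theorem HasFunctionals.mean (hW : HasFunctionals hU hb hk hμ Q W) {α : Fin d → ℕ}
    (hα : α ∈ multiIdx d m) (x : Eu d) (r : ℝ) :
    ∀ᵐ u ∂Q, u.mean α x r = (⨍ y in Metric.ball x r ∩ U, pL (idxList α) μ y)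
      + W (⨍ y in Metric.ball x r ∩ U, pL (idxList α) k y) u := by
  have h := hW (Sobolev.meanL m U ⟨α, hα⟩ x r) (⨍ y in Metric.ball x r ∩ U, pL (idxList α) k y)
    fun h => by rw [← Sobolev.mean_eq hα, hk.mean_incl hU hb hα]
  filter_upwards [h] with u hu
  rw [Sobolev.mean_eq hα, hu, ← Sobolev.mean_eq hα, hμ.mean_toSobolev hU hb hα]

/-- Radii along which the means of the derivatives of the feature map converge geometrically fast,
uniformly on the closure of `U`. -/
theorem SmoothUpTo.exists_radii (hU : IsOpen U) (hb : Bornology.IsBounded U)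
    (hk : SmoothUpTo m U k) : ∃ r : ℕ → ℝ, Tendsto r atTop (𝓝[>] 0) ∧
      ∀ n, ∀ α ∈ multiIdx d m, ∀ x ∈ closure U,
        ‖(⨍ y in Metric.ball x (r n) ∩ U, pL (idxList α) k y) - extendFrom U (pL (idxList α) k) x‖
          ≤ (1 / 2) ^ n := by
  have h1 : ∀ n : ℕ, ∀ᶠ r in 𝓝[>] (0 : ℝ), r ∈ Ioc (0 : ℝ) (1 / (n + 1)) ∧
      ∀ α ∈ multiIdx d m, ∀ x ∈ closure U,
        ‖(⨍ y in Metric.ball x r ∩ U, pL (idxList α) k y) - extendFrom U (pL (idxList α) k) x‖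
          ≤ (1 / 2) ^ n := fun n =>
    Filter.Eventually.and (Ioc_mem_nhdsGT (by positivity)) ((eventually_all_finset _).2 fun α hα =>
      hk.eventually_setAverage_le hU hb hα (by positivity))
  choose r hr using fun n => (h1 n).exists
  refine ⟨r, tendsto_nhdsWithin_iff.2 ⟨?_, Eventually.of_forall fun n => (hr n).1.1⟩,
    fun n => (hr n).2⟩
  exact squeeze_zero (fun n => (hr n).1.1.le) (fun n => (hr n).1.2)
    tendsto_one_div_add_atTop_nhds_zero_nat

theorem HasFunctionals.ae_tendsto_mean (hW : HasFunctionals hU hb hk hμ Q W) {r : ℕ → ℝ}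
    (hr : Tendsto r atTop (𝓝[>] 0)) {α : Fin d → ℕ} (hα : α ∈ multiIdx d m) {x : Eu d}
    (hx : x ∈ closure U)
    (hr' : ∀ n, ‖(⨍ y in Metric.ball x (r n) ∩ U, pL (idxList α) k y)
      - extendFrom U (pL (idxList α) k) x‖ ≤ (1 / 2) ^ n) :
    ∀ᵐ u ∂Q, Tendsto (fun n => u.mean α x (r n)) atTop
      (𝓝 (extendFrom U (pL (idxList α) μ) x + W (extendFrom U (pL (idxList α) k) x) u)) := by
  have h1 : ∀ᵐ u ∂Q, ∀ n, u.mean α x (r n)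
      = (⨍ y in Metric.ball x (r n) ∩ U, pL (idxList α) μ y)
        + W (⨍ y in Metric.ball x (r n) ∩ U, pL (idxList α) k y) u :=
    ae_all_iff.2 fun n => hW.mean hα x (r n)
  have h2 : ∀ᵐ u ∂Q, Tendsto
      (fun n => W (⨍ y in Metric.ball x (r n) ∩ U, pL (idxList α) k y) u) atTop
      (𝓝 (W (extendFrom U (pL (idxList α) k) x) u)) :=
    ae_tendsto_of_norm_sub_le fun n => by
      rw [← map_sub, LinearIsometry.norm_map]; exact hr' n
  filter_upwards [h1, h2] with u h1 h2
  simp only [h1]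
  exact ((hμ.tendsto_setAverage hU hb hα hx).comp hr).add h2

/-- The pointwise values are affine images of the isonormal process. -/
theorem HasFunctionals.ae_pointVal (hW : HasFunctionals hU hb hk hμ Q W) {r : ℕ → ℝ}
    (hr : Tendsto r atTop (𝓝[>] 0)) {l : ℕ} (hl : l ≤ m) (a : (Fin d → ℕ) → Eu d → ℝ) {x : Eu d}
    (hx : x ∈ closure U)
    (hr' : ∀ n, ∀ α ∈ multiIdx d m, ‖(⨍ y in Metric.ball x (r n) ∩ U, pL (idxList α) k y)
      - extendFrom U (pL (idxList α) k) x‖ ≤ (1 / 2) ^ n) :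
    ∀ᵐ u ∂Q, pointVal r l a x u
      = (∑ α ∈ multiIdx d l, a α x * extendFrom U (pL (idxList α) μ) x)
        + W (∑ α ∈ multiIdx d l, a α x • extendFrom U (pL (idxList α) k) x) u := by
  have h1 : ∀ᵐ u ∂Q, ∀ α ∈ multiIdx d l, Tendsto (fun n => u.mean α x (r n)) atTop
      (𝓝 (extendFrom U (pL (idxList α) μ) x + W (extendFrom U (pL (idxList α) k) x) u)) :=
    (eventually_all_finset _).2 fun α hα =>
      hW.ae_tendsto_mean hr (multiIdx_mono hl hα) hx fun n => hr' n α (multiIdx_mono hl hα)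
  filter_upwards [h1, coeFn_map_sum_smul W (multiIdx d l) (fun α => a α x)
    fun α => extendFrom U (pL (idxList α) k) x] with u h1 h2
  rw [pointVal_eq h1, h2, ← Finset.sum_add_distrib]
  exact Finset.sum_congr rfl fun α _ => mul_add _ _ _

theorem HasFunctionals.isPointEvaluation [IsProbabilityMeasure Q]
    (hW : HasFunctionals hU hb hk hμ Q W) {r : ℕ → ℝ}
    (hr : Tendsto r atTop (𝓝[>] 0)) {l : ℕ} (hl : l ≤ m) (a : (Fin d → ℕ) → Eu d → ℝ)
    {S : Set (Eu d)} (hS : S ⊆ closure U)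
    (hr' : ∀ n, ∀ α ∈ multiIdx d m, ∀ x ∈ closure U,
      ‖(⨍ y in Metric.ball x (r n) ∩ U, pL (idxList α) k y)
        - extendFrom U (pL (idxList α) k) x‖ ≤ (1 / 2) ^ n) :
    IsPointEvaluation Q l a S (pointVal r l a) where
  measurable x _ := measurable_pointVal r hl a x
  value u x hx v h := pointVal_eq_of_hasValueAt hU hb hr hl (hS hx) h
  tendsto x hx := by
    -- in `L²(Q)`, the means are constants plus values of `W`, and these converge
    set A : ℝ → ℝ := fun t => ∑ α ∈ multiIdx d l, a α x *
      ⨍ y in Metric.ball x t ∩ U, pL (idxList α) μ y with hA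
    set G : ℝ → H := fun t => ∑ α ∈ multiIdx d l, a α x •
      ⨍ y in Metric.ball x t ∩ U, pL (idxList α) k y with hG
    have hAlim : Tendsto A (𝓝[>] 0)
        (𝓝 (∑ α ∈ multiIdx d l, a α x * extendFrom U (pL (idxList α) μ) x)) :=
      tendsto_finsetSum _ fun α hα =>
        (hμ.tendsto_setAverage hU hb (multiIdx_mono hl hα) (hS hx)).const_mul _
    have hGlim : Tendsto G (𝓝[>] 0)
        (𝓝 (∑ α ∈ multiIdx d l, a α x • extendFrom U (pL (idxList α) k) x)) :=
      tendsto_finsetSum _ fun α hα =>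
        (hk.tendsto_setAverage hU hb (multiIdx_mono hl hα) (hS hx)).const_smul _
    have hcoe : ∀ (c : ℝ) (g : H), (Lp.constL 2 Q ℝ c + W g : Lp ℝ 2 Q) =ᵐ[Q]
        fun u => c + W g u := by
      intro c g
      filter_upwards [Lp.coeFn_add (Lp.constL 2 Q ℝ c) (W g), Lp.coeFn_const (p := 2) (μ := Q) c]
        with u h1 h2
      rw [h1, Pi.add_apply]
      congr 1
    have hlim := tendstoInMeasure_of_tendsto_Lp
      ((((Lp.constL 2 Q ℝ).continuous.tendsto _).comp hAlim).add
        ((W.continuous.tendsto _).comp hGlim))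
    refine hlim.congr (fun t => ?_) ?_
    · have h1 : ∀ᵐ u ∂Q, ∀ α ∈ multiIdx d l, u.mean α x t
          = (⨍ y in Metric.ball x t ∩ U, pL (idxList α) μ y)
            + W (⨍ y in Metric.ball x t ∩ U, pL (idxList α) k y) u :=
        (eventually_all_finset _).2 fun α hα => hW.mean (multiIdx_mono hl hα) x t
      filter_upwards [h1, hcoe (A t) (G t), coeFn_map_sum_smul W (multiIdx d l) (fun α => a α x)
        fun α => ⨍ y in Metric.ball x t ∩ U, pL (idxList α) k y] with u h1 h2 h3
      rw [setAverage_frozenOp hb hl]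
      refine h2.trans ?_
      rw [hA, hG, h3, ← Finset.sum_add_distrib]
      exact Finset.sum_congr rfl fun α hα => by rw [h1 α hα, mul_add]
    · filter_upwards [hcoe _ _, hW.ae_pointVal hr hl a (hS hx) fun n α hα => hr' n α hα x (hS hx)]
        with u h1 h2
      rw [h2]
      exact h1

end PointValues

/-! ### Operators applied to the kernel -/

section Operators

variable {d m : ℕ} {U : Set (Eu d)}

theorem extendFrom_congr {X Y : Type*} [TopologicalSpace X] [TopologicalSpace Y] {A : Set X}
    {f g : X → Y} (h : EqOn f g A) : extendFrom A f = extendFrom A g := by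
  funext x
  have : map f (𝓝[A] x) = map g (𝓝[A] x) :=
    map_congr (eventually_mem_nhdsWithin.mono fun y hy => h hy)
  simp only [extendFrom, limUnder, this]

theorem ContDiffOnClosure.congr {F : Type*} [NormedAddCommGroup F] [NormedSpace ℝ F] {k : ℕ}
    {V : Set F} (hV : IsOpen V) {f g : F → ℝ} (hf : ContDiffOnClosure k V f) (h : EqOn g f V) :
    ContDiffOnClosure k V g := by
  refine ⟨hf.1.congr h, fun j hj => ?_⟩
  obtain ⟨G, hG, hGe⟩ := hf.2 j hj
  refine ⟨G, hG, fun x hx => (hGe hx).trans ?_⟩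
  have : g =ᶠ[𝓝 x] f := (hV.mem_nhds hx |> fun hx => Filter.eventually_of_mem hx fun y hy => h hy)
  exact (this.iteratedFDeriv ℝ j).eq_of_nhds.symm

theorem bdryOp_congr (hU : IsOpen U) (l : ℕ) (b : (Fin d → ℕ) → Eu d → ℝ) {f g : Eu d → ℝ}
    (h : EqOn f g U) : bdryOp U l b f = bdryOp U l b g := by
  funext x
  refine Finset.sum_congr rfl fun α _ => ?_
  rw [multiD_eq_pL, multiD_eq_pL, extendFrom_congr (pL_congr hU h _)]

theorem diffOp_eq_bdryOp (hU : IsOpen U) {l : ℕ} (hl : l ≤ m) (c : (Fin d → ℕ) → Eu d → ℝ)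
    {f : Eu d → ℝ} (hf : SmoothUpTo m U f) {x : Eu d} (hx : x ∈ U) :
    diffOp l c f x = bdryOp U l c f x := by
  refine Finset.sum_congr rfl fun α hα => ?_
  rw [multiD_eq_pL, hf.ext_eq hU (length_idxList_le (multiIdx_mono hl hα)) hx]

variable {H : Type*} [NormedAddCommGroup H] [InnerProductSpace ℝ H] {k : Eu d → H}
  {K : Eu d → Eu d → ℝ}

theorem SmoothUpTo.bdryOp_inner (hU : IsOpen U) (hk : SmoothUpTo m U k) {l : ℕ} (hl : l ≤ m)
    (b : (Fin d → ℕ) → Eu d → ℝ) (h : H) {x : Eu d} (hx : x ∈ closure U) :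
    bdryOp U l b (fun z => inner ℝ (k z) h) x
      = inner ℝ (∑ α ∈ multiIdx d l, b α x • extendFrom U (pL (idxList α) k) x) h := by
  rw [sum_inner]
  refine Finset.sum_congr rfl fun α hα => ?_
  rw [multiD_eq_pL, hk.ext_inner hU h (length_idxList_le (multiIdx_mono hl hα)) hx,
    real_inner_smul_left]

/-- The operator applied to both arguments of the kernel `⟪k ·, k ·⟫` gives the kernel of the
differentiated feature map. -/
theorem SmoothUpTo.bdryOpKernel_eq (hU : IsOpen U) (hk : SmoothUpTo m U k) {l : ℕ} (hl : l ≤ m)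
    (hK : ∀ x ∈ U, ∀ y ∈ U, inner ℝ (k x) (k y) = K x y) (b : (Fin d → ℕ) → Eu d → ℝ)
    {x y : Eu d} (hx : x ∈ closure U) (hy : y ∈ closure U) :
    bdryOpKernel U l b K x y
      = inner ℝ (∑ α ∈ multiIdx d l, b α x • extendFrom U (pL (idxList α) k) x)
          (∑ α ∈ multiIdx d l, b α y • extendFrom U (pL (idxList α) k) y) := by
  rw [← hk.bdryOp_inner hU hl b _ hx, bdryOpKernel]
  refine congrFun (bdryOp_congr hU l b fun z hz => ?_) x
  have h1 : EqOn (fun w => K z w) (fun w => inner ℝ (k w) (k z)) U := fun w hw =>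
    (hK z hz w hw).symm.trans (real_inner_comm _ _)
  rw [bdryOp_congr hU l b h1, hk.bdryOp_inner hU hl b _ hy, real_inner_comm]

theorem SmoothUpTo.diffOpKernel_eq (hU : IsOpen U) (hk : SmoothUpTo m U k) {l : ℕ} (hl : l ≤ m)
    (hK : ∀ x ∈ U, ∀ y ∈ U, inner ℝ (k x) (k y) = K x y) (c : (Fin d → ℕ) → Eu d → ℝ)
    {x y : Eu d} (hx : x ∈ U) (hy : y ∈ U) :
    diffOpKernel l c K x y
      = inner ℝ (∑ α ∈ multiIdx d l, c α x • extendFrom U (pL (idxList α) k) x)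
          (∑ α ∈ multiIdx d l, c α y • extendFrom U (pL (idxList α) k) y) := by
  set g := ∑ α ∈ multiIdx d l, c α y • extendFrom U (pL (idxList α) k) y with hg
  have h1 : EqOn (fun z => diffOp l c (fun w => K z w) y) (fun z => inner ℝ (k z) g) U := by
    intro z hz
    have h2 : ∀ α, multiD α (fun w => K z w) y = multiD α (fun w => inner ℝ (k w) (k z)) y := by
      intro α
      rw [multiD_eq_pL, multiD_eq_pL]
      exact pL_congr hU (fun w hw => by rw [← hK z hz w hw, real_inner_comm]) _ hy
    have h3 : diffOp l c (fun w => K z w) y = diffOp l c (fun w => inner ℝ (k w) (k z)) y :=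
      Finset.sum_congr rfl fun α _ => by rw [h2]
    simp only [h3]
    rw [diffOp_eq_bdryOp hU hl c (hk.inner_right hU (k z)) hy,
      hk.bdryOp_inner hU hl c _ (subset_closure hy), real_inner_comm]
  rw [← hk.bdryOp_inner hU hl c _ (subset_closure hx),
    ← diffOp_eq_bdryOp hU hl c (hk.inner_right hU g) hx, diffOpKernel]
  refine Finset.sum_congr rfl fun α _ => ?_
  rw [multiD_eq_pL, multiD_eq_pL]
  congr 1
  exact pL_congr hU h1 _ hx

end Operators

/-! ### The Gaussian measure on the Sobolev space -/

section SobolevMeasure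

variable {d m : ℕ} {U : Set (Eu d)} {H : Type*} [NormedAddCommGroup H] [InnerProductSpace ℝ H]
  {k : Eu d → H} (hU : IsOpen U) (hb : Bornology.IsBounded U)

/-- The inclusion of the feature space into the Sobolev space is a Hilbert–Schmidt operator, since
`∑_i ⟪D^α k(y), b_i⟫² ≤ ‖D^α k(y)‖²` by Bessel's inequality. -/
theorem SmoothUpTo.sum_norm_incl_sq_le (hk : SmoothUpTo m U k) {ι : Type*} {b : ι → H}
    (hb' : Orthonormal ℝ b) (s : Finset ι) :
    ∑ i ∈ s, ‖hk.incl hU hb (b i)‖ ^ 2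
      ≤ ∑ α ∈ multiIdx d m, ∫ y in U, ‖pL (idxList α) k y‖ ^ 2 := by
  have h1 : ∀ (α : multiIdx d m) (h : H), ‖Sobolev.deriv α (hk.incl hU hb h)‖ ^ 2
      = ∫ y in U, (inner ℝ (pL (idxList α) k y) h : ℝ) ^ 2 := by
    intro α h
    rw [← real_inner_self_eq_norm_sq, ← integral_mul_eq_inner, ← Sobolev.D_eq]
    refine integral_congr_ae ?_
    filter_upwards [hk.D_incl hU hb h α.2] with y hy
    rw [hy, sq]
  have hint : ∀ (α : multiIdx d m) (h : H),
      Integrable (fun y => (inner ℝ (pL (idxList α) k y) h : ℝ) ^ 2) (volume.restrict U) := by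
    intro α h
    have h2 := (Sobolev.memLp_D α.2 (hk.incl hU hb h)).ae_eq (hk.D_incl hU hb h α.2)
    exact h2.integrable_sq
  simp only [Sobolev.norm_sq, h1]
  rw [Finset.sum_comm, ← Finset.sum_coe_sort (multiIdx d m)]
  refine Finset.sum_le_sum fun α _ => ?_
  rw [← integral_finsetSum _ fun i _ => hint α (b i)]
  refine integral_mono (integrable_finsetSum _ fun i _ => hint α (b i))
    ((hk.memLp_pL hU hb α.2).integrable_norm_pow (by norm_num)) fun y => ?_
  have := hb'.sum_inner_products_le (pL (idxList α) k y) (s := s)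
  simpa [real_inner_comm] using this

theorem IsStdGaussianSeq.hasFunctionals [CompleteSpace H] {μ : Eu d → ℝ} (hk : SmoothUpTo m U k)
    (hμ : SmoothUpTo m U μ) {Q : Measure (Sobolev m U)} {ι : Type*} {ξ : ι → Sobolev m U → ℝ}
    (hξ : IsStdGaussianSeq ξ Q) (b : HilbertBasis ι ℝ H) (v : lp (fun _ : ι => Sobolev m U) 2)
    (hv : ∀ i, v i = hk.incl hU hb (b i))
    (hQ : ∀ᵐ u ∂Q, u = hμ.toSobolev hU hb + hξ.series v u) :
    HasFunctionals hU hb hk hμ Q (hξ.iso b) := by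
  intro T g hT
  filter_upwards [hQ, hξ.clm_series b v T g fun i => by rw [hv, hT, real_inner_comm]] with u h1 h2
  rw [← h2, ← map_add, ← h1]

end SobolevMeasure

/-! ### Boundary traces -/

section Trace

variable {d m : ℕ} {U : Set (Eu d)}

theorem SmoothUpTo.toSobolev_add (hU : IsOpen U) (hb : Bornology.IsBounded U) {f g : Eu d → ℝ}
    (hf : SmoothUpTo m U f) (hg : SmoothUpTo m U g) :
    (hf.add hU hg).toSobolev hU hb = hf.toSobolev hU hb + hg.toSobolev hU hb := by
  refine Sobolev.ext_deriv fun α => ?_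
  simp only [map_add, SmoothUpTo.deriv_toSobolev]
  rw [← MemLp.toLp_add, MemLp.toLp_eq_toLp_iff]
  filter_upwards [ae_restrict_mem hU.measurableSet] with x hx
  exact pL_add hU hf.contDiffOn hg.contDiffOn _ (length_idxList_le α.2) hx

theorem eLpNorm_two_eq {X : Type*} [MeasurableSpace X] {σ : Measure X} (f : X → ℝ) :
    eLpNorm f 2 σ = (∫⁻ x, ‖f x‖ₑ ^ 2 ∂σ) ^ (1 / 2 : ℝ) := by
  rw [eLpNorm_eq_lintegral_rpow_enorm_toReal (by norm_num) (by norm_num)]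
  simp

theorem tendsto_eLpNorm_pL_sub (hU : IsOpen U) (hb : Bornology.IsBounded U) {u : Sobolev m U}
    {f : ℕ → Eu d → ℝ} (hf : ∀ j, SmoothUpTo m U (f j))
    (hlim : Tendsto (fun j => (hf j).toSobolev hU hb) atTop (𝓝 u)) {α : Fin d → ℕ}
    (hα : α ∈ multiIdx d m) :
    Tendsto (fun j => eLpNorm (pL (idxList α) (f j) - u.D α) 2 (volume.restrict U)) atTop
      (𝓝 0) := by
  have h1 := ((Sobolev.deriv ⟨α, hα⟩).continuous.tendsto u).comp hlim
  rw [Lp.tendsto_Lp_iff_tendsto_eLpNorm'] at h1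
  refine h1.congr fun j => eLpNorm_congr_ae ?_
  rw [← Sobolev.D_eq hα, Function.comp_apply, ← Sobolev.D_eq hα]
  exact ((hf j).D_toSobolev hU hb hα).sub (EventuallyEq.refl _ _)

/-- If functions which are smooth up to the boundary converge to `u` in `H^m(U)`, and the boundary
values of their derivatives of order `α` converge in `L²(∂U)`, then the limit is the trace of
`D^α u`. -/
theorem hasTrace_of_tendsto (hU : IsOpen U) (hb : Bornology.IsBounded U) (hm : 1 ≤ m)
    (hσ : (Measure.hausdorffMeasure ((d : ℝ) - 1) : Measure (Eu d)) (frontier U) < ⊤)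
    {u : Sobolev m U} {f : ℕ → Eu d → ℝ} (hf : ∀ j, SmoothUpTo m U (f j))
    (hlim : Tendsto (fun j => (hf j).toSobolev hU hb) atTop (𝓝 u)) {α : Fin d → ℕ}
    (hα : α ∈ multiIdx d (m - 1)) {g : Eu d → ℝ} (hg : Measurable g)
    (hgl : Tendsto (fun j => ∫⁻ x, ‖extendFrom U (pL (idxList α) (f j)) x - g x‖ₑ ^ 2
      ∂((Measure.hausdorffMeasure ((d : ℝ) - 1)).restrict (frontier U))) atTop (𝓝 0)) :
    HasTrace U (u.D α) g := by
  set σ := (Measure.hausdorffMeasure ((d : ℝ) - 1) : Measure (Eu d)).restrict (frontier U) with hσd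
  have hfin : IsFiniteMeasure σ := ⟨by simpa [hσd] using hσ⟩
  have hαm : α ∈ multiIdx d m := multiIdx_mono (Nat.sub_le m 1) hα
  have hlen : (idxList α).length + 1 ≤ m := by
    have := length_idxList_le hα
    omega
  have hext : ∀ j, MemLp (extendFrom U (pL (idxList α) (f j))) 2 σ := by
    intro j
    have hc : ContinuousOn (extendFrom U (pL (idxList α) (f j))) (frontier U) :=
      ((hf j).continuousOn_ext (length_idxList_le hαm)).mono frontier_subset_closure
    obtain ⟨C, -, hC⟩ := (hf j).exists_bound hb
    refine MemLp.of_bound (hc.aestronglyMeasurable isClosed_frontier.measurableSet) C ?_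
    filter_upwards [ae_restrict_mem isClosed_frontier.measurableSet] with x hx
    exact hC α hαm x (frontier_subset_closure hx)
  refine ⟨fun i => u.D (α + Pi.single i 1), fun j => pL (idxList α) (f j), ?_, ?_, ?_, ?_, ?_, ?_,
    ?_⟩
  · exact fun i => Sobolev.memLp_D (add_single_mem_multiIdx hα hm i) u
  · exact fun i => Sobolev.isWeakDeriv_D_add_single hα hm u i
  · exact fun j => ((hf j).iteratedDeriv hU (idxList α) hlen).contDiffOnClosure_one hU
  · exact tendsto_eLpNorm_pL_sub hU hb hf hlim hαm
  · intro i
    refine (tendsto_eLpNorm_pL_sub hU hb hf hlim (add_single_mem_multiIdx hα hm i)).congr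
      fun j => eLpNorm_congr_ae ?_
    filter_upwards [ae_restrict_mem hU.measurableSet] with x hx
    simp only [Pi.sub_apply]
    congr 1
    exact pL_perm hU (hf j).contDiffOn (idxList_add_single_perm α i)
      (length_idxList_le (add_single_mem_multiIdx hα hm i)) hx
  · obtain ⟨j, hj⟩ := (hgl.eventually (gt_mem_nhds (zero_lt_one : (0 : ℝ≥0∞) < 1))).exists
    have h1 : MemLp (extendFrom U (pL (idxList α) (f j)) - g) 2 σ := by
      refine ⟨(hext j).aestronglyMeasurable.sub hg.aestronglyMeasurable, ?_⟩
      rw [eLpNorm_two_eq]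
      exact ENNReal.rpow_lt_top_of_nonneg (by norm_num) (hj.trans ENNReal.one_lt_top).ne
    have h2 := (hext j).sub h1
    rwa [sub_sub_cancel] at h2
  · simp only [eLpNorm_two_eq, Pi.sub_apply]
    have h3 := (ENNReal.continuous_rpow_const (y := (1 / 2 : ℝ))).tendsto 0 |>.comp hgl
    rwa [ENNReal.zero_rpow_of_pos (by norm_num)] at h3

theorem measurable_comp_swap {X Y : Type*} [MeasurableSpace X] [MeasurableSpace Y]
    {f : X × Y → ℝ} (hf : Measurable f) : Measurable fun p : Y × X => f (p.2, p.1) :=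
  hf.comp measurable_swap

/-- The pointwise value of `D^α u` at `x`, as the limit of the means over the balls of radius
`r n`. -/
def pointD (r : ℕ → ℝ) (α : Fin d → ℕ) (x : Eu d) (u : Sobolev m U) : ℝ :=
  limUnder atTop fun n => u.mean α x (r n)

theorem measurable_pointD_left (hU : IsOpen U) (r : ℕ → ℝ) {α : Fin d → ℕ}
    (hα : α ∈ multiIdx d m) (u : Sobolev m U) : Measurable fun x => pointD r α x u :=
  (StronglyMeasurable.limUnder fun n =>
    (u.measurable_mean_left hU hα (r n)).stronglyMeasurable).measurable

theorem measurable_pointD (hU : IsOpen U) (r : ℕ → ℝ) {α : Fin d → ℕ} (hα : α ∈ multiIdx d m) :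
    Measurable fun p : Eu d × Sobolev m U => pointD r α p.1 p.2 :=
  (StronglyMeasurable.limUnder fun n =>
    (Sobolev.measurable_mean hU hα (r n)).stronglyMeasurable).measurable

variable {H : Type*} [NormedAddCommGroup H] [InnerProductSpace ℝ H] [CompleteSpace H]
  {k : Eu d → H} {μ : Eu d → ℝ} {Q : Measure (Sobolev m U)} [IsProbabilityMeasure Q]
  {hU : IsOpen U} {hb : Bornology.IsBounded U} {hk : SmoothUpTo m U k} {hμ : SmoothUpTo m U μ}
  {ι : Type*} {ξ : ι → Sobolev m U → ℝ} {hξ : IsStdGaussianSeq ξ Q} {b : HilbertBasis ι ℝ H}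

/-- The boundary values of the finite Gaussian sums converge almost surely in `L²(σ)` to the
pointwise values of `D^α u`: by Tonelli, the expected squared distances are summable. -/
theorem HasFunctionals.ae_tendsto_lintegral (hW : HasFunctionals hU hb hk hμ Q (hξ.iso b))
    (hξm : ∀ i, Measurable (ξ i)) {r : ℕ → ℝ} (hr : Tendsto r atTop (𝓝[>] 0))
    (hr' : ∀ n, ∀ α ∈ multiIdx d m, ∀ x ∈ closure U,
      ‖(⨍ y in Metric.ball x (r n) ∩ U, pL (idxList α) k y)
        - extendFrom U (pL (idxList α) k) x‖ ≤ (1 / 2) ^ n)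
    {α : Fin d → ℕ} (hα : α ∈ multiIdx d m) {s : ℕ → Finset ι}
    (hs : ∀ j, ∀ x ∈ closure U, ‖extendFrom U (pL (idxList α) k) x
      - ∑ i ∈ s j, (inner ℝ (b i) (extendFrom U (pL (idxList α) k) x) : ℝ) • b i‖ ≤ (1 / 2) ^ j)
    (ν : Measure (Eu d)) [IsFiniteMeasure (ν.restrict (frontier U))] :
    ∀ᵐ u ∂Q, Tendsto (fun j => ∫⁻ x, ‖extendFrom U (pL (idxList α) μ) x
      + ∑ i ∈ s j, ξ i u * (inner ℝ (b i) (extendFrom U (pL (idxList α) k) x) : ℝ)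
        - pointD r α x u‖ₑ ^ 2 ∂(ν.restrict (frontier U))) atTop (𝓝 0) := by
  set σ := ν.restrict (frontier U) with hσ
  have hl := length_idxList_le hα
  have hfr : MeasurableSet (frontier U) := isClosed_frontier.measurableSet
  have hm : ∀ j, AEMeasurable (fun p : Sobolev m U × Eu d => ‖extendFrom U (pL (idxList α) μ) p.2
      + ∑ i ∈ s j, ξ i p.1 * (inner ℝ (b i) (extendFrom U (pL (idxList α) k) p.2) : ℝ)
        - pointD r α p.2 p.1‖ₑ ^ 2) (Q.prod σ) := by
    intro j
    have h1 : AEMeasurable (extendFrom U (pL (idxList α) μ)) σ :=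
      ((hμ.continuousOn_ext hl).mono frontier_subset_closure).aemeasurable hfr
    have h2 : ∀ i, AEMeasurable
        (fun x => (inner ℝ (b i) (extendFrom U (pL (idxList α) k) x) : ℝ)) σ := fun i =>
      ((continuousOn_const.inner (hk.continuousOn_ext hl)).mono
        frontier_subset_closure).aemeasurable hfr
    have h3 : Measurable fun p : Sobolev m U × Eu d => pointD r α p.2 p.1 :=
      measurable_comp_swap (f := fun p : Eu d × Sobolev m U => pointD r α p.1 p.2)
        (measurable_pointD hU r hα)
    have h4 : AEMeasurable (fun p : Sobolev m U × Eu d => ∑ i ∈ s j,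
        ξ i p.1 * (inner ℝ (b i) (extendFrom U (pL (idxList α) k) p.2) : ℝ)) (Q.prod σ) :=
      Finset.aemeasurable_fun_sum _ fun i _ =>
        ((hξm i).comp measurable_fst).aemeasurable.mul (h2 i).comp_snd
    exact ((h1.comp_snd.add h4).sub h3.aemeasurable).enorm.pow_const 2
  refine ae_tendsto_zero_of_tsum_lintegral (fun j => (hm j).lintegral_prod_right') ?_
  refine ne_top_of_le_ne_top (tsum_ofReal_two_pow_ne_top (σ univ) (measure_ne_top _ _))
    (ENNReal.tsum_le_tsum fun j => ?_)
  rw [lintegral_lintegral_swap (hm j), mul_comm, ← lintegral_const]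
  refine lintegral_mono_ae ?_
  filter_upwards [ae_restrict_mem hfr] with x hx
  have hxc := frontier_subset_closure hx
  have h5 : ∀ᵐ u ∂Q, pointD r α x u = extendFrom U (pL (idxList α) μ) x
      + hξ.iso b (extendFrom U (pL (idxList α) k) x) u := by
    filter_upwards [hW.ae_tendsto_mean hr hα hxc fun n => hr' n α hα x hxc] with u hu
    exact hu.limUnder_eq
  calc ∫⁻ u, ‖extendFrom U (pL (idxList α) μ) x
      + ∑ i ∈ s j, ξ i u * (inner ℝ (b i) (extendFrom U (pL (idxList α) k) x) : ℝ)
        - pointD r α x u‖ₑ ^ 2 ∂Q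
      = ∫⁻ u, ‖∑ i ∈ s j, ξ i u * (inner ℝ (b i) (extendFrom U (pL (idxList α) k) x) : ℝ)
        - hξ.iso b (extendFrom U (pL (idxList α) k) x) u‖ₑ ^ 2 ∂Q := by
        refine lintegral_congr_ae ?_
        filter_upwards [h5] with u hu
        rw [hu, add_sub_add_left_eq_sub]
    _ = ‖extendFrom U (pL (idxList α) k) x
        - ∑ i ∈ s j, (inner ℝ (b i) (extendFrom U (pL (idxList α) k) x) : ℝ) • b i‖ₑ ^ 2 :=
        hξ.lintegral_sum_sub_iso b (s j) _
    _ ≤ ENNReal.ofReal ((1 / 2) ^ j) ^ 2 := by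
        gcongr
        rw [← ofReal_norm]
        exact ENNReal.ofReal_le_ofReal (hs j x hxc)

/-- Almost surely, the means of all derivatives converge at almost every boundary point. -/
theorem HasFunctionals.ae_ae_pointVal (hW : HasFunctionals hU hb hk hμ Q (hξ.iso b))
    {r : ℕ → ℝ} (hr : Tendsto r atTop (𝓝[>] 0))
    (hr' : ∀ n, ∀ α ∈ multiIdx d m, ∀ x ∈ closure U,
      ‖(⨍ y in Metric.ball x (r n) ∩ U, pL (idxList α) k y)
        - extendFrom U (pL (idxList α) k) x‖ ≤ (1 / 2) ^ n)
    {l : ℕ} (hl : l ≤ m) (a : (Fin d → ℕ) → Eu d → ℝ)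
    (ν : Measure (Eu d)) [IsFiniteMeasure (ν.restrict (frontier U))] :
    ∀ᵐ u ∂Q, ∀ᵐ x ∂(ν.restrict (frontier U)),
      pointVal r l a x u = ∑ α ∈ multiIdx d l, a α x * pointD r α x u := by
  have hmeas : MeasurableSet {p : Eu d × Sobolev m U | ∀ α ∈ multiIdx d l,
      ∃ c, Tendsto (fun n => p.2.mean α p.1 (r n)) atTop (𝓝 c)} := by
    have : {p : Eu d × Sobolev m U | ∀ α ∈ multiIdx d l,
        ∃ c, Tendsto (fun n => p.2.mean α p.1 (r n)) atTop (𝓝 c)} = ⋂ α ∈ multiIdx d l,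
        {p : Eu d × Sobolev m U | ∃ c, Tendsto (fun n => p.2.mean α p.1 (r n)) atTop (𝓝 c)} := by
      ext p; simp
    rw [this]
    exact Finset.measurableSet_biInter _ fun α hα =>
      StronglyMeasurable.measurableSet_exists_tendsto fun n =>
        (Sobolev.measurable_mean hU (multiIdx_mono hl hα) (r n)).stronglyMeasurable
  have h1 : ∀ᵐ x ∂(ν.restrict (frontier U)), ∀ᵐ u ∂Q, ∀ α ∈ multiIdx d l,
      ∃ c, Tendsto (fun n => u.mean α x (r n)) atTop (𝓝 c) := by
    filter_upwards [ae_restrict_mem isClosed_frontier.measurableSet] with x hx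
    have hxc := frontier_subset_closure hx
    refine (eventually_all_finset _).2 fun α hα => ?_
    filter_upwards [hW.ae_tendsto_mean hr (multiIdx_mono hl hα) hxc
      fun n => hr' n α (multiIdx_mono hl hα) x hxc] with u hu
    exact ⟨_, hu⟩
  have h2 := (Measure.ae_ae_comm hmeas).1 h1
  filter_upwards [h2] with u hu
  filter_upwards [hu] with x hx
  exact pointVal_eq fun α hα => tendsto_nhds_limUnder (hx α hα)

end Trace

section BoundaryValues

variable {d m : ℕ} {U : Set (Eu d)} {H : Type*} [NormedAddCommGroup H] [InnerProductSpace ℝ H]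
  [CompleteSpace H] {k : Eu d → H} {μ : Eu d → ℝ} {Q : Measure (Sobolev m U)}
  [IsProbabilityMeasure Q] {hU : IsOpen U} {hb : Bornology.IsBounded U} {hk : SmoothUpTo m U k}
  {hμ : SmoothUpTo m U μ} {ι : Type*} {ξ : ι → Sobolev m U → ℝ} {hξ : IsStdGaussianSeq ξ Q}
  {b : HilbertBasis ι ℝ H}

/-- Almost surely, the pointwise values of the derivatives of order less than `m` at the boundary
are the traces of these derivatives. -/
theorem HasFunctionals.ae_hasTrace (hW : HasFunctionals hU hb hk hμ Q (hξ.iso b))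
    (hξm : ∀ i, Measurable (ξ i)) (hm : 1 ≤ m)
    (hσ : (Measure.hausdorffMeasure ((d : ℝ) - 1) : Measure (Eu d)) (frontier U) < ⊤)
    (v : lp (fun _ : ι => Sobolev m U) 2) (hv : ∀ i, v i = hk.incl hU hb (b i))
    (hQ : ∀ᵐ u ∂Q, u = hμ.toSobolev hU hb + hξ.series v u)
    {r : ℕ → ℝ} (hr : Tendsto r atTop (𝓝[>] 0))
    (hr' : ∀ n, ∀ α ∈ multiIdx d m, ∀ x ∈ closure U,
      ‖(⨍ y in Metric.ball x (r n) ∩ U, pL (idxList α) k y)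
        - extendFrom U (pL (idxList α) k) x‖ ≤ (1 / 2) ^ n) :
    ∀ᵐ u ∂Q, ∀ α ∈ multiIdx d (m - 1), HasTrace U (u.D α) fun x => pointD r α x u := by
  set S : Set H := ⋃ α ∈ multiIdx d m, extendFrom U (pL (idxList α) k) '' closure U with hS
  have hSc : IsCompact S := Finset.isCompact_biUnion _ fun α hα =>
    hb.isCompact_closure.image_of_continuousOn (hk.continuousOn_ext (length_idxList_le hα))
  obtain ⟨s, hs, hlim⟩ := hξ.exists_finset_seq b hSc v
  have hfin : IsFiniteMeasure
      ((Measure.hausdorffMeasure ((d : ℝ) - 1) : Measure (Eu d)).restrict (frontier U)) :=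
    ⟨by simpa using hσ⟩
  have h1 : ∀ᵐ u ∂Q, ∀ α ∈ multiIdx d m, Tendsto (fun j => ∫⁻ x, ‖extendFrom U (pL (idxList α) μ) x
      + ∑ i ∈ s j, ξ i u * (inner ℝ (b i) (extendFrom U (pL (idxList α) k) x) : ℝ)
        - pointD r α x u‖ₑ ^ 2
          ∂((Measure.hausdorffMeasure ((d : ℝ) - 1)).restrict (frontier U))) atTop (𝓝 0) :=
    (eventually_all_finset _).2 fun α hα => hW.ae_tendsto_lintegral hξm hr hr' hα
      (fun j x hx => hs j _ (mem_iUnion₂.2 ⟨α, hα, mem_image_of_mem _ hx⟩)) _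
  filter_upwards [h1, hlim, hQ] with u h1 hlim hu α hα
  have hαm : α ∈ multiIdx d m := multiIdx_mono (Nat.sub_le m 1) hα
  -- the finite Gaussian sums are smooth up to the boundary and converge to `u` in `H^m(U)`
  set g : ℕ → H := fun j => ∑ i ∈ s j, ξ i u • b i with hg
  have hf : ∀ j, SmoothUpTo m U fun x => μ x + inner ℝ (k x) (g j) := fun j =>
    hμ.add hU (hk.inner_right hU (g j))
  have hfl : Tendsto (fun j => (hf j).toSobolev hU hb) atTop (𝓝 u) := by
    rw [hu]
    convert hlim.const_add (hμ.toSobolev hU hb) using 2 with j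
    rw [SmoothUpTo.toSobolev_add hU hb hμ (hk.inner_right hU (g j)), ← hk.incl_apply hU hb, hg,
      map_sum]
    simp only [map_smul, hv]
  have hmeas : Measurable fun x => pointD r α x u := measurable_pointD_left hU r hαm u
  refine hasTrace_of_tendsto hU hb hm hσ hf hfl hα hmeas ((h1 α hαm).congr fun j => ?_)
  refine setLIntegral_congr_fun isClosed_frontier.measurableSet fun x hx => ?_
  have hl := length_idxList_le hαm
  have hxc := frontier_subset_closure hx
  have e : extendFrom U (pL (idxList α) fun x => μ x + inner ℝ (k x) (g j)) x
      = extendFrom U (pL (idxList α) μ) x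
        + ∑ i ∈ s j, ξ i u * (inner ℝ (b i) (extendFrom U (pL (idxList α) k) x) : ℝ) := by
    rw [hμ.ext_add hU (hk.inner_right hU (g j)) hl hxc, hk.ext_inner hU _ hl hxc, hg, inner_sum]
    congr 1
    exact Finset.sum_congr rfl fun i _ => by rw [real_inner_smul_right, real_inner_comm]
  simp only [e]

end BoundaryValues

end GaussPDE

end

theorem theoremt (d m : ℕ) (hd : 1 ≤ d) (hm : (d : ℝ) / 2 < m)
    (U : Set (GaussPDE.Eu d)) (hU : GaussPDE.IsBoundedLipschitzDomain U)
    (K : GaussPDE.Eu d → GaussPDE.Eu d → ℝ) (hK : GaussPDE.IsPosDefKernel U K)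
    (hKsmooth : GaussPDE.ContDiffOnClosure (2 * m) (U ×ˢ U)
      (fun p : GaussPDE.Eu d × GaussPDE.Eu d => K p.1 p.2))
    (μ : GaussPDE.Eu d → ℝ) (hμ : GaussPDE.ContDiffOnClosure m U μ) :
    ∃ Q : Measure (GaussPDE.Sobolev m U), IsProbabilityMeasure Q ∧
      (∀ c : (Fin d → ℕ) → GaussPDE.Eu d → ℝ,
        (∀ α ∈ GaussPDE.multiIdx d m, ContinuousOn (c α) (closure U)) →
        ∃ PS : GaussPDE.Eu d → GaussPDE.Sobolev m U → ℝ,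
          GaussPDE.IsDiffOpProcess Q m c PS ∧
          GaussPDE.IsGaussianField Q U PS
            (GaussPDE.diffOp m c μ) (GaussPDE.diffOpKernel m c K)) ∧
      (∀ b : (Fin d → ℕ) → GaussPDE.Eu d → ℝ,
        (∀ α ∈ GaussPDE.multiIdx d (m - 1), ContinuousOn (b α) (frontier U)) →
        ∃ BS : GaussPDE.Eu d → GaussPDE.Sobolev m U → ℝ,
          GaussPDE.IsBdryOpProcess Q (m - 1) b BS ∧
          GaussPDE.IsGaussianField Q (frontier U) BS
            (GaussPDE.bdryOp U (m - 1) b μ) (GaussPDE.bdryOpKernel U (m - 1) b K)) := by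
  open GaussPDE in
  have hO := hU.isOpen
  have hb := hU.isBounded
  have hm1 : 1 ≤ m := by
    have h : (0 : ℝ) < m := lt_of_le_of_lt (by positivity) hm
    exact_mod_cast h
  obtain ⟨H, _, _, _, k, hkK, htot⟩ := hK.exists_feature
  have hk : SmoothUpTo m U k := smoothUpTo_feature hO
    (hKsmooth.congr (hO.prod hO) fun p hp => hkK p.1 hp.1 p.2 hp.2)
  have hμ' : SmoothUpTo m U μ := hμ.smoothUpTo hO
  obtain ⟨Q, hQp, ι, b, κ, v, hξ, -, hv, hQ⟩ := exists_gaussianMeasure (hk.incl hO hb)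
    (hk.incl_injective hO hb htot) (fun _ _ hb' s => hk.sum_norm_incl_sq_le hO hb hb' s)
    (hμ'.toSobolev hO hb)
  have hW := hξ.hasFunctionals hO hb hk hμ' b v hv hQ
  have hξm : ∀ i, Measurable fun u : Sobolev m U =>
      (inner ℝ (κ i) (u - hμ'.toSobolev hO hb) : ℝ) := fun i => by
    have : Continuous fun u : Sobolev m U =>
        (inner ℝ (κ i) (u - hμ'.toSobolev hO hb) : ℝ) := by fun_prop
    exact this.measurable
  obtain ⟨r, hr, hr'⟩ := hk.exists_radii hO hb
  have hσ := hU.hausdorffMeasure_frontier_lt_top hd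
  have hfin : IsFiniteMeasure
      ((Measure.hausdorffMeasure ((d : ℝ) - 1) : Measure (Eu d)).restrict (frontier U)) :=
    ⟨by simpa using hσ⟩
  have hm' : m - 1 ≤ m := Nat.sub_le m 1
  refine ⟨Q, hQp, fun c _ => ⟨pointVal r m c, ⟨?_, ?_⟩, ?_⟩,
    fun a _ => ⟨pointVal r (m - 1) a, ⟨?_, ?_⟩, ?_⟩⟩
  · exact hW.isPointEvaluation hr le_rfl c subset_closure hr'
  · exact ae_pointVal_eq hO hb hr le_rfl c
  · refine hξ.isGaussianField b
      (h := fun x => ∑ α ∈ multiIdx d m, c α x • extendFrom U (pL (idxList α) k) x)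
      (fun x hx => ?_) fun x hx y hy => (hk.diffOpKernel_eq hO le_rfl hkK c hx hy).symm
    rw [diffOp_eq_bdryOp hO le_rfl c hμ' hx]
    simp only [bdryOp, multiD_eq_pL]
    exact hW.ae_pointVal hr le_rfl c (subset_closure hx)
      fun n α hα => hr' n α hα x (subset_closure hx)
  · exact hW.isPointEvaluation hr hm' a frontier_subset_closure hr'
  · filter_upwards [hW.ae_ae_pointVal hr hr' hm' a (Measure.hausdorffMeasure ((d : ℝ) - 1)),
      hW.ae_hasTrace hξm hm1 hσ v hv hQ hr hr'] with u h1 h2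
    exact ⟨fun α x => pointD r α x u, h2, h1⟩
  · refine hξ.isGaussianField b
      (h := fun x => ∑ α ∈ multiIdx d (m - 1), a α x • extendFrom U (pL (idxList α) k) x)
      (fun x hx => ?_) fun x hx y hy => (hk.bdryOpKernel_eq hO hm' hkK a
        (frontier_subset_closure hx) (frontier_subset_closure hy)).symm
    simp only [bdryOp, multiD_eq_pL]
    exact hW.ae_pointVal hr hm' a (frontier_subset_closure hx)
      fun n α hα => hr' n α hα x (frontier_subset_closure hx)
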